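/- **Jensen's inequality for conditional expectations.** Let $\mathcal A$ be a separable $C^*$-algebra with multiplier algebra $M(\mathcal A)$, and let every functional $\psi\in\mathcal A^*$ be extended to $M(\mathcal A)$ canonically (strictly continuously). Let $\mathcal C=C_0(S)$ be an abelian $C^*$-subalgebra of $\mathcal A$, where $S$ is a locally compact metric space, and let $\varphi$ be a positive functional on $\mathcal A$ whose centralizer $\mathcal A^\varphi=\{y\in\mathcal A:\varphi(xy)=\varphi(yx)\ \forall x\in\mathcal A\}$ contains $\mathcal C$. Let $\mu_\varphi$ be the finite Radon measure on $S$ with $\varphi(z)=\int_S z\,d\mu_\varphi$ for $z\in\mathcal C$, and let $\Phi\colon M(\mathcal A)\to L^\infty(S,\mu_\varphi)$ be the conditional expectation, i.e. $\Phi(m)$ is the unique element with $$\int_S z(s)\,\Phi(m)(s)\,d\mu_\varphi(s)=\varphi(zm)\qquad (z\in\mathcal C,\ m\in M(\mathcal A)).$$ Let $T$ be a locally compact Hausdorff space with a Radon measure $\nu$. A field $t\mapsto b_t\in M(\mathcal A)$ is weak*-measurable if $t\mapsto\psi(b_t)$ is $\nu$-measurable for every $\psi\in\mathcal A^*$. We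 say that $b=\int_T b_t\,d\nu(t)$ exists in $M(\mathcal A)$ if $(b_t)$ is weak*-measurable, $\int_T|\psi(b_t)|\,d\nu(t)$ is bounded uniformly over the states $\psi$ of $\mathcal A$, and $b\in M(\mathcal A)$ satisfies $\psi(b)=\int_T\psi(b_t)\,d\nu(t)$ for all $\psi\in\mathcal A^*$. Let $(a_t)_{t\in T}$ be a unital column field in $M(\mathcal A)$, i.e. weak*-measurable with $\int_T a_t^*a_t\,d\nu(t)=1$. Let $\underline I=I_1\times\dots\times I_n$ be a product of real intervals, and let $f\colon\underline I\to\mathbf R$ be continuous and convex. Let $t\mapsto\underline x_t=(x_{1t},\dots,x_{nt})$ be an essentially bounded weak*-measurable field of $n$-tuples of mutually commuting self-adjoint elements of $\mathcal A$ such that the spectrum of $x_{it}$ (computed in $M(\mathcal A)$) is contained in $I_i$ for all $i$ and $t$, and let $f(\underline x_t)\in M(\mathcal A)$ be given by the joint continuous functional calculus. Then: 1. The integrals $y_i=\int_T a_t^*x_{it}a_t\,d\nu(t)$, $i=1,\dots,n$, exist in $M(\mathcal A)$, and $\Phi(y_i)(s)\in I_i$ for all $i$, for $\mu_\varphi$-almost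 every $s\in S$. 2. If all the intervals $I_i$ are closed, or more generally if $t\mapsto f(\underline x_t)$ is essentially bounded, then $\int_T a_t^*f(\underline x_t)a_t\,d\nu(t)$ exists in $M(\mathcal A)$. 3. Whenever $\int_T a_t^*f(\underline x_t)a_t\,d\nu(t)$ exists in $M(\mathcal A)$ (in particular in the situation of 2), $$f\bigl(\Phi(y_1)(s),\dots,\Phi(y_n)(s)\bigr)\le\Phi\Bigl(\int_T a_t^*f(\underline x_t)a_t\,d\nu(t)\Bigr)(s)$$ for $\mu_\varphi$-almost every $s\in S$. -/

import Mathlib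

open Filter Topology MeasureTheory
open scoped ComplexOrder MultiplierAlgebra ZeroAtInfty CompactlySupported ENNReal

namespace CondJensen

noncomputable section

set_option linter.unusedSectionVars false

section JointCalculus
variable {B : Type*} [CStarAlgebra B] {n : ℕ}

/-- The product of the real spectra of the entries of a tuple. -/
abbrev spectralBox (x : Fin n → B) : Set (Fin n → ℝ) :=
  Set.pi Set.univ fun i => spectrum ℝ (x i)

/-- The `i`-th coordinate function on the product of the spectra. -/
def coordFun (x : Fin n → B) (i : Fin n) : C(spectralBox x, ℂ) where
  toFun p := (p.1 i : ℂ)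
  continuous_toFun := Complex.continuous_ofReal.comp
    ((continuous_apply i).comp continuous_subtype_val)

theorem isCompact_spectralBox (x : Fin n → B) : IsCompact (spectralBox x) :=
  isCompact_univ_pi fun i => spectrum.isCompact (𝕜 := ℝ) (x i)

/-- An abelian tuple of self-adjoint elements has a joint functional calculus: a unital
`*`-homomorphism on the continuous functions on the product of the spectra which sends the
coordinate functions to the entries. -/
theorem exists_jointHom (x : Fin n → B) (hx : ∀ i, IsSelfAdjoint (x i))
    (hc : ∀ i j, Commute (x i) (x j)) :
    ∃ Ψ : C(spectralBox x, ℂ) →⋆ₐ[ℂ] B, ∀ i, Ψ (coordFun x i) = x i := by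
  have h1 : ∀ a ∈ Set.range x, ∀ b ∈ Set.range x, a * b = b * a := by
    rintro _ ⟨i, rfl⟩ _ ⟨j, rfl⟩
    exact hc i j
  have h2 : ∀ a ∈ Set.range x, ∀ b ∈ Set.range x, a * star b = star b * a := by
    rintro _ ⟨i, rfl⟩ _ ⟨j, rfl⟩
    rw [(hx j).star_eq]
    exact hc i j
  let S₀ : StarSubalgebra ℂ B := StarAlgebra.adjoin ℂ (Set.range x)
  have hcm : IsMulCommutative S₀ := StarAlgebra.isMulCommutative_adjoin ℂ h1 h2
  let S : StarSubalgebra ℂ B := S₀.topologicalClosure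
  have hS : IsClosed (S : Set B) := S₀.isClosed_topologicalClosure
  let _ : CommRing S := S₀.commRingTopologicalClosure fun a b => mul_comm' a b
  let _ : CommCStarAlgebra S := { }
  have hxS : ∀ i, x i ∈ S := fun i =>
    S₀.le_topologicalClosure (StarAlgebra.subset_adjoin ℂ _ ⟨i, rfl⟩)
  let X : Fin n → S := fun i => ⟨x i, hxS i⟩
  have hX : ∀ i, IsSelfAdjoint (X i) := fun i => Subtype.ext (hx i)
  have hsp : ∀ (χ : WeakDual.characterSpace ℂ S) i, (χ (X i)).re ∈ spectrum ℝ (x i) ∧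
      χ (X i) = ((χ (X i)).re : ℂ) := by
    intro χ i
    have h3 : χ (X i) ∈ spectrum ℂ (X i) := AlgHom.apply_mem_spectrum χ (X i)
    have h5 := (hX i).mem_spectrum_eq_re h3
    refine ⟨?_, h5⟩
    rw [StarSubalgebra.spectrum_eq (hS := hS)] at h3
    rw [h5] at h3
    exact (spectrum.algebraMap_mem_iff ℂ (R := ℝ)).mp h3
  let p : C(WeakDual.characterSpace ℂ S, spectralBox x) :=
    { toFun := fun χ => ⟨fun i => (χ (X i)).re, fun i _ => (hsp χ i).1⟩
      continuous_toFun := by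
        refine Continuous.subtype_mk (continuous_pi fun i => ?_) _
        exact Complex.continuous_re.comp
          (map_continuous (WeakDual.gelfandTransform ℂ S (X i))) }
  refine ⟨(S.subtype.comp (gelfandStarTransform S).symm.toStarAlgHom).comp
    (ContinuousMap.compStarAlgHom' ℂ ℂ p), fun i => ?_⟩
  have h6 : (coordFun x i).comp p = gelfandStarTransform S (X i) := by
    ext χ
    exact (hsp χ i).2.symm
  change ((gelfandStarTransform S).symm ((coordFun x i).comp p) : B) = x i
  rw [h6, StarAlgEquiv.symm_apply_apply]

/-- The joint functional calculus is unique. -/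
theorem jointHom_unique (x : Fin n → B) (Ψ₁ Ψ₂ : C(spectralBox x, ℂ) →⋆ₐ[ℂ] B)
    (h₁ : ∀ i, Ψ₁ (coordFun x i) = x i) (h₂ : ∀ i, Ψ₂ (coordFun x i) = x i) : Ψ₁ = Ψ₂ := by
  have : CompactSpace (spectralBox x) := isCompact_iff_compactSpace.mp (isCompact_spectralBox x)
  let R : StarSubalgebra ℂ C(spectralBox x, ℂ) := StarAlgebra.adjoin ℂ (Set.range (coordFun x))
  have hR : R.topologicalClosure = ⊤ := by
    refine ContinuousMap.starSubalgebra_topologicalClosure_eq_top_of_separatesPoints _ ?_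
    intro p q hpq
    obtain ⟨i, hi⟩ : ∃ i, p.1 i ≠ q.1 i := by
      by_contra! h
      exact hpq (Subtype.ext (funext h))
    refine ⟨_, ⟨coordFun x i, StarAlgebra.subset_adjoin ℂ _ ⟨i, rfl⟩, rfl⟩, ?_⟩
    simpa [coordFun] using hi
  have hE : R ≤ StarAlgHom.equalizer Ψ₁ Ψ₂ := by
    refine StarAlgebra.adjoin_le ?_
    rintro _ ⟨i, rfl⟩
    exact (h₁ i).trans (h₂ i).symm
  have hcont : ∀ Ψ : C(spectralBox x, ℂ) →⋆ₐ[ℂ] B, Continuous Ψ := fun Ψ =>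
    (NonUnitalStarAlgHom.instContinuousLinearMapClassComplex).map_continuous Ψ
  have hcl : IsClosed (StarAlgHom.equalizer Ψ₁ Ψ₂ : Set C(spectralBox x, ℂ)) :=
    isClosed_eq (hcont Ψ₁) (hcont Ψ₂)
  have := StarSubalgebra.topologicalClosure_minimal hE hcl
  rw [hR] at this
  exact StarAlgHom.ext fun g => this (StarSubalgebra.mem_top)

open Classical in
/-- `f(x₁, …, xₙ)` for an abelian tuple of self-adjoint elements and a real function `f` that is
continuous on the product of their spectra: the value at `f` of the (unique) `*`-homomorphism
`C(σ(x₁) × ⋯ × σ(xₙ)) → B` with `λᵢ ↦ xᵢ`, which is integration against the joint spectral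
measure. -/
def jointCFC (f : (Fin n → ℝ) → ℝ) (x : Fin n → B) : B :=
  if h : (∃ Ψ : C(spectralBox x, ℂ) →⋆ₐ[ℂ] B, ∀ i, Ψ (coordFun x i) = x i) ∧
      ContinuousOn f (spectralBox x) then
    h.1.choose ⟨fun p => (f p.1 : ℂ), Complex.continuous_ofReal.comp h.2.domRestrict⟩
  else 0

end JointCalculus

section Multipliers
variable {A : Type*} [NonUnitalCStarAlgebra A] [PartialOrder A] [StarOrderedRing A]

/-- The canonical (strictly continuous) extension of a functional `ψ ∈ A*` to the multiplier
algebra: `ψ(m) = lim ψ(m e)` along the canonical approximate unit of `A`. Here `m.fst e = m e`. -/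
def extend (ψ : A →L[ℂ] ℂ) (m : 𝓜(ℂ, A)) : ℂ :=
  limUnder (CStarAlgebra.approximateUnit A) fun e => ψ (m.fst e)

theorem extend_coe (ψ : A →L[ℂ] ℂ) (x : A) : extend ψ (x : 𝓜(ℂ, A)) = ψ x := by
  refine Tendsto.limUnder_eq ?_
  have h := (CStarAlgebra.increasingApproximateUnit A).toIsApproximateUnit.tendsto_mul_left x
  exact (ψ.continuous.tendsto x).comp h

theorem norm_mul_add_mul_sub_le {U : Type*} [CStarAlgebra U] [PartialOrder U] [StarOrderedRing U]
    {a b e : U} (ha : ‖a‖ ≤ 1) (hb : ‖b‖ ≤ 1) (he : 0 ≤ e) (he1 : ‖e‖ ≤ 1) {δ : ℝ} (hδ : 0 < δ) :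
    ‖a * e + (δ : ℂ) • (b * (1 - e))‖ ^ 2 ≤ 1 + δ ^ 2 := by
  have hsm : ∀ c : U, ‖c‖ ≤ 1 → star c * c ≤ 1 := by
    intro c hc
    rw [← CStarAlgebra.norm_le_one_iff_of_nonneg _ (star_mul_self_nonneg c),
      CStarRing.norm_star_mul_self]
    nlinarith [norm_nonneg c]
  have hes : star e = e := (IsSelfAdjoint.of_nonneg he).star_eq
  have he2 : e ≤ 1 := (CStarAlgebra.norm_le_one_iff_of_nonneg e he).mp he1
  set q := 1 - e with hq
  have hq0 : 0 ≤ q := sub_nonneg.mpr he2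
  have hqs : star q = q := (IsSelfAdjoint.of_nonneg hq0).star_eq
  have hX : star (a * e) * (a * e) ≤ e * e := by
    have := star_left_conjugate_le_conjugate (hsm a ha) e
    simpa [hes, mul_assoc] using this
  have hY : star (b * q) * (b * q) ≤ q * q := by
    have := star_left_conjugate_le_conjugate (hsm b hb) q
    simpa [hqs, mul_assoc] using this
  have heq : e * e + q * q ≤ 1 := by
    have hcm : Commute e q := by
      rw [hq]; exact (Commute.one_right e).sub_right (Commute.refl e)
    have h0 : 0 ≤ e * q := (commute_iff_mul_nonneg he hq0).mp hcm
    have : (1 : U) - (e * e + q * q) = e * q + e * q := by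
      rw [hq]; noncomm_ring
    rw [← sub_nonneg, this]
    exact add_nonneg h0 h0
  set X := a * e
  set Y := b * q
  have hid : ((1 + δ ^ 2 : ℝ) : ℂ) • (star X * X + star Y * Y) -
      star (X + (δ : ℂ) • Y) * (X + (δ : ℂ) • Y) = star ((δ : ℂ) • X - Y) * ((δ : ℂ) • X - Y) := by
    simp only [star_add, star_sub, star_smul, Complex.star_def, Complex.conj_ofReal, add_mul,
      mul_add, sub_mul, mul_sub, smul_mul_assoc, mul_smul_comm]
    push_cast
    module
  have hle : star (X + (δ : ℂ) • Y) * (X + (δ : ℂ) • Y) ≤ ((1 + δ ^ 2 : ℝ) : ℂ) • (1 : U) := by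
    have h1 : star (X + (δ : ℂ) • Y) * (X + (δ : ℂ) • Y) ≤
        ((1 + δ ^ 2 : ℝ) : ℂ) • (star X * X + star Y * Y) := by
      rw [← sub_nonneg, hid]; exact star_mul_self_nonneg _
    refine h1.trans ?_
    have hr : (0 : ℂ) ≤ ((1 + δ ^ 2 : ℝ) : ℂ) := by
      rw [Complex.zero_le_real]; positivity
    exact smul_le_smul_of_nonneg_left ((add_le_add hX hY).trans heq) hr
  have hn := CStarAlgebra.norm_le_norm_of_nonneg_of_le (star_mul_self_nonneg _) hle
  rw [CStarRing.norm_star_mul_self, ← sq] at hn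
  refine hn.trans ?_
  rw [norm_smul]
  have h1 : ‖(1 : U)‖ ≤ 1 := by
    rcases subsingleton_or_nontrivial U with h | h
    · simp [Subsingleton.elim (1 : U) 0]
    · simp
  have h2 : ‖((1 + δ ^ 2 : ℝ) : ℂ)‖ = 1 + δ ^ 2 := by
    rw [Complex.norm_real, Real.norm_of_nonneg (by positivity)]
  rw [h2]
  nlinarith [sq_nonneg δ]

theorem exists_phase (z : ℂ) : ∃ w : ℂ, ‖w‖ = 1 ∧ w * z = (‖z‖ : ℂ) := by
  rcases eq_or_ne z 0 with rfl | hz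
  · exact ⟨1, by simp⟩
  · refine ⟨(‖z‖ : ℂ) / z, by simp [hz], by field_simp⟩

theorem eventually_norm_sub_mul_le (ψ : A →L[ℂ] ℂ) {ε : ℝ} (hε : 0 < ε) :
    ∀ᶠ e in CStarAlgebra.approximateUnit A, ∀ b : A, ‖b‖ ≤ 1 → ‖ψ (b - b * e)‖ ≤ ε := by
  let _ := CStarAlgebra.spectralOrder (Unitization ℂ A)
  have := CStarAlgebra.spectralOrderedRing (Unitization ℂ A)
  set N := ‖ψ‖ with hN
  obtain ⟨δ, hδ, hδε⟩ : ∃ δ : ℝ, 0 < δ ∧ N * δ + δ ≤ ε := by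
    refine ⟨ε / (N + 1), by positivity, le_of_eq ?_⟩
    have : N + 1 ≠ 0 := by positivity
    field_simp
  -- a unit vector almost attaining the norm
  obtain ⟨a, ha1, ha⟩ : ∃ a : A, ‖a‖ ≤ 1 ∧ N - δ ^ 2 / 4 ≤ (ψ a).re := by
    have hlt : N - δ ^ 2 / 4 < ‖ψ‖ := by rw [← hN]; linarith [sq_pos_of_pos hδ]
    rcases lt_or_ge (N - δ ^ 2 / 4) 0 with h0 | h0
    · exact ⟨0, by simp, by simpa using h0.le⟩
    obtain ⟨a, ha1, ha⟩ := ψ.exists_lt_apply_of_lt_opNorm hlt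
    obtain ⟨w, hw, hwz⟩ := exists_phase (ψ a)
    refine ⟨w • a, by rw [norm_smul, hw, one_mul]; exact ha1.le, ?_⟩
    rw [map_smul, smul_eq_mul, hwz, Complex.ofReal_re]
    exact ha.le
  have hl := CStarAlgebra.increasingApproximateUnit A
  have hlim : Tendsto (fun e => (ψ (a * e)).re) (CStarAlgebra.approximateUnit A) (𝓝 (ψ a).re) :=
    (Complex.continuous_re.tendsto _).comp
      ((ψ.continuous.tendsto a).comp (hl.toIsApproximateUnit.tendsto_mul_left a))
  have hev := hlim.eventually (lt_mem_nhds (show (ψ a).re - δ ^ 2 / 4 < (ψ a).re by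
    linarith [sq_pos_of_pos hδ]))
  filter_upwards [hev, hl.eventually_nonneg, hl.eventually_norm] with e he he0 he1 b hb
  obtain ⟨w, hw, hwz⟩ := exists_phase (ψ (b - b * e))
  set b' := w • b with hb'
  have hb'1 : ‖b'‖ ≤ 1 := by rw [hb', norm_smul, hw, one_mul]; exact hb
  have hbe : ψ (b' - b' * e) = (‖ψ (b - b * e)‖ : ℂ) := by
    rw [← hwz, hb', smul_mul_assoc, ← smul_sub, map_smul, smul_eq_mul]
  have hnorm := norm_mul_add_mul_sub_le (U := Unitization ℂ A) (a := (a : Unitization ℂ A))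
    (b := (b' : Unitization ℂ A)) (e := (e : Unitization ℂ A))
    (by rwa [Unitization.norm_inr]) (by rwa [Unitization.norm_inr])
    (Unitization.inr_nonneg_iff.mpr he0) (by rwa [Unitization.norm_inr]) hδ
  have hcoe : (a : Unitization ℂ A) * (e : Unitization ℂ A) +
      (δ : ℂ) • ((b' : Unitization ℂ A) * (1 - (e : Unitization ℂ A))) =
      ((a * e + (δ : ℂ) • (b' - b' * e) : A) : Unitization ℂ A) := by
    simp [mul_sub, Unitization.inr_mul]
  rw [hcoe, Unitization.norm_inr] at hnorm
  have hle : ‖a * e + (δ : ℂ) • (b' - b' * e)‖ ≤ 1 + δ ^ 2 / 2 := by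
    refine le_of_sq_le_sq ?_ (by positivity)
    nlinarith [sq_nonneg (δ ^ 2)]
  have h1 := ψ.le_opNorm (a * e + (δ : ℂ) • (b' - b' * e))
  have h2 := Complex.re_le_norm (ψ (a * e + (δ : ℂ) • (b' - b' * e)))
  rw [map_add, map_smul, hbe, smul_eq_mul, ← Complex.ofReal_mul, Complex.add_re,
    Complex.ofReal_re] at h2
  rw [map_add, map_smul, hbe, smul_eq_mul, ← Complex.ofReal_mul] at h1
  have h3 : N * ‖a * e + (δ : ℂ) • (b' - b' * e)‖ ≤ N * (1 + δ ^ 2 / 2) :=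
    mul_le_mul_of_nonneg_left hle (norm_nonneg _)
  have h4 : δ * ‖ψ (b - b * e)‖ ≤ δ * (N * δ + δ) := by
    have hN0 : 0 ≤ N := norm_nonneg _
    nlinarith [sq_nonneg δ, mul_nonneg hN0 (sq_nonneg δ)]
  exact (le_of_mul_le_mul_left h4 hδ).trans hδε

theorem fst_mul (m : 𝓜(ℂ, A)) (x y : A) : m.fst x * y = m.fst (x * y) := by
  have h : ∀ c : A, c * (m.fst x * y - m.fst (x * y)) = 0 := by
    intro c
    rw [mul_sub, ← mul_assoc, ← m.central, ← m.central, mul_assoc, sub_self]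
  have h2 := h (star (m.fst x * y - m.fst (x * y)))
  exact sub_eq_zero.mp (CStarRing.star_mul_self_eq_zero_iff _ |>.mp h2)

/-- The limit that defines the extension exists. -/
theorem tendsto_extend (ψ : A →L[ℂ] ℂ) (m : 𝓜(ℂ, A)) :
    Tendsto (fun e => ψ (m.fst e)) (CStarAlgebra.approximateUnit A) (𝓝 (extend ψ m)) := by
  refine tendsto_nhds_limUnder ?_
  have hl := CStarAlgebra.increasingApproximateUnit A
  refine cauchy_map_iff_exists_tendsto.mp ?_
  rw [Metric.cauchy_iff]
  refine ⟨inferInstance, fun ε hε => ?_⟩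
  set K := 2 * ‖m.fst‖ + 1 with hK
  have hK0 : 0 < K := by positivity
  obtain ⟨f, hf, hfn⟩ := ((eventually_norm_sub_mul_le ψ (ε := ε / (4 * K)) (by positivity)).and
    hl.eventually_norm).exists
  have hr := hl.toIsApproximateUnit.tendsto_mul_right f
  have hr' := hr.eventually (Metric.ball_mem_nhds f
    (show 0 < ε / (8 * ((‖ψ‖ + 1) * K)) by positivity))
  refine ⟨_, image_mem_map (hr'.and hl.eventually_norm), ?_⟩
  rintro _ ⟨e, ⟨he, he1⟩, rfl⟩ _ ⟨e', ⟨he', he1'⟩, rfl⟩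
  rw [dist_eq_norm] at he he'
  set b := m.fst (e - e') with hb
  have hbn : ‖b‖ ≤ K := by
    have := m.fst.le_opNorm (e - e')
    have h2 := norm_sub_le e e'
    nlinarith [norm_nonneg m.fst]
  have h1 : ‖ψ (b - b * f)‖ ≤ ε / 4 := by
    have h := hf ((K : ℂ)⁻¹ • b) (by
      rw [norm_smul, norm_inv, Complex.norm_real, Real.norm_of_nonneg hK0.le]
      rw [inv_mul_le_iff₀ hK0]; simpa using hbn)
    rw [smul_mul_assoc, ← smul_sub, map_smul, norm_smul, norm_inv, Complex.norm_real,
      Real.norm_of_nonneg hK0.le, inv_mul_le_iff₀ hK0] at h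
    refine h.trans (le_of_eq ?_)
    field_simp
  have h2 : ‖ψ (b * f)‖ < ε / 4 * 2 := by
    have hbf : b * f = m.fst (e * f - f) - m.fst (e' * f - f) := by
      have : b * f = m.fst ((e - e') * f) := fst_mul m _ _
      rw [this, ← map_sub]; congr 1; noncomm_ring
    have hd : ‖b * f‖ ≤ K * (ε / (8 * ((‖ψ‖ + 1) * K)) + ε / (8 * ((‖ψ‖ + 1) * K))) := by
      rw [hbf, ← map_sub]
      refine (m.fst.le_opNorm _).trans ?_
      refine mul_le_mul (by linarith [norm_nonneg m.fst]) ?_ (norm_nonneg _) hK0.le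
      exact (norm_sub_le _ _).trans (add_le_add he.le he'.le)
    have h3 := (ψ.le_opNorm (b * f)).trans (mul_le_mul_of_nonneg_left hd (norm_nonneg _))
    refine h3.trans_lt ?_
    have : ‖ψ‖ * (K * (ε / (8 * ((‖ψ‖ + 1) * K)) + ε / (8 * ((‖ψ‖ + 1) * K)))) =
      (‖ψ‖ / (‖ψ‖ + 1)) * (ε / 4) := by
      field_simp; ring
    rw [this]
    have h5 : ‖ψ‖ / (‖ψ‖ + 1) ≤ 1 := by
      rw [div_le_one (by positivity)]; linarith
    nlinarith
  rw [dist_eq_norm, ← map_sub, ← map_sub]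
  change ‖ψ b‖ < ε
  have : ψ b = ψ (b - b * f) + ψ (b * f) := by rw [← map_add]; congr 1; abel
  rw [this]
  refine (norm_add_le _ _).trans_lt ?_
  linarith

end Multipliers

section Fields

variable {A : Type*} [NonUnitalCStarAlgebra A] [PartialOrder A] [StarOrderedRing A]
variable {T : Type*} [MeasurableSpace T]

/-- Weak*-measurability of a field of multipliers: `t ↦ ψ(a_t)` is `ν`-measurable for all
`ψ ∈ A*`. -/
def IsWeakStarMeasurable (ν : Measure T) (a : T → 𝓜(ℂ, A)) : Prop :=
  ∀ ψ : A →L[ℂ] ℂ, AEMeasurable (fun t => extend ψ (a t)) ν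

/-- States of `A`. -/
def IsState (ψ : A →L[ℂ] ℂ) : Prop :=
  (∀ x : A, 0 ≤ x → 0 ≤ ψ x) ∧ ‖ψ‖ = 1

/-- The field `a` is integrable and `b` is its integral: `a` is weak*-measurable, the integrals
`∫ |ψ(a_t)| dν(t)` are uniformly bounded over the states of `A`, and `ψ(b) = ∫ ψ(a_t) dν(t)` for
all `ψ ∈ A*`. -/
structure HasCStarIntegral (ν : Measure T) (a : T → 𝓜(ℂ, A)) (b : 𝓜(ℂ, A)) : Prop where
  measurable : IsWeakStarMeasurable ν a
  bounded : ∃ K : ℝ, ∀ ψ : A →L[ℂ] ℂ, IsState ψ →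
    Integrable (fun t => extend ψ (a t)) ν ∧ ∫ t, ‖extend ψ (a t)‖ ∂ν ≤ K
  integral_eq : ∀ ψ : A →L[ℂ] ℂ,
    Integrable (fun t => extend ψ (a t)) ν ∧ ∫ t, extend ψ (a t) ∂ν = extend ψ b

/-- Unital column fields: weak*-measurable with `∫ a_t* a_t dν(t) = 1`. -/
def IsUnitalColumnField (ν : Measure T) (a : T → 𝓜(ℂ, A)) : Prop :=
  IsWeakStarMeasurable ν a ∧ HasCStarIntegral ν (fun t => star (a t) * a t) 1

end Fields

section CondExp
variable {A : Type*} [NonUnitalCStarAlgebra A] [PartialOrder A] [StarOrderedRing A]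
variable {S : Type*} [MetricSpace S] [LocallyCompactSpace S] [MeasurableSpace S] [BorelSpace S]

/-- The centralizer of a functional. -/
def centralizer (φ : A →ₚ[ℂ] ℂ) : Set A :=
  {y | ∀ x : A, φ (x * y) = φ (y * x)}

section Measure

variable {C : NonUnitalStarSubalgebra ℂ A}

/-- A compactly supported real function as a complex function vanishing at infinity. -/
def liftC0 (z : C_c(S, ℝ)) : C₀(S, ℂ) where
  toFun s := (z s : ℂ)
  continuous_toFun := Complex.continuous_ofReal.comp (map_continuous z)
  zero_at_infty' := by
    have h := (Complex.continuous_ofReal.tendsto 0).comp (zero_at_infty z)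
    rw [Complex.ofReal_zero] at h
    exact h

theorem nonneg_of_c0 (φ : A →ₚ[ℂ] ℂ) (e : C₀(S, ℂ) ≃⋆ₐ[ℂ] C) (z : C₀(S, ℂ))
    (hz : ∀ s, 0 ≤ z s) : 0 ≤ φ (e z : A) := by
  let w : C₀(S, ℂ) :=
    { toFun := fun s => (Real.sqrt (z s).re : ℂ)
      continuous_toFun := Complex.continuous_ofReal.comp
        (Real.continuous_sqrt.comp (Complex.continuous_re.comp (map_continuous z)))
      zero_at_infty' := by
        have hc : Continuous fun u : ℂ => (Real.sqrt u.re : ℂ) := by fun_prop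
        have h := (hc.tendsto 0).comp (zero_at_infty z)
        rw [Complex.zero_re, Real.sqrt_zero, Complex.ofReal_zero] at h
        exact h }
  have hw : z = star w * w := by
    ext s
    have h1 := Complex.nonneg_iff.mp (hz s)
    apply Complex.ext
    · simp [w, Real.mul_self_sqrt h1.1]
    · simp [w, ← h1.2]
  have h2 : (e z : A) = star (e w : A) * (e w : A) := by
    rw [hw, map_mul, map_star]; rfl
  rw [h2]
  exact φ.map_nonneg (star_mul_self_nonneg _)

theorem exists_bound_c0 (φ : A →ₚ[ℂ] ℂ) (e : C₀(S, ℂ) ≃⋆ₐ[ℂ] C) :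
    ∃ M : ℝ, 0 ≤ M ∧ ∀ z : C₀(S, ℂ), ‖φ (e z : A)‖ ≤ M * ‖z‖ := by
  obtain ⟨K, hK⟩ := φ.exists_norm_apply_le
  refine ⟨K, K.2, fun z => (hK _).trans ?_⟩
  let j : C₀(S, ℂ) →⋆ₙₐ[ℂ] A :=
    { toFun := fun z => (e z : A)
      map_smul' := fun c z => by simp
      map_zero' := by simp
      map_add' := fun a b => by simp
      map_mul' := fun a b => by simp
      map_star' := fun a => by rw [map_star]; rfl }
  have : ‖j z‖ ≤ ‖z‖ := NonUnitalStarAlgHom.norm_apply_le j z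
  exact mul_le_mul_of_nonneg_left this K.2

/-- The restriction of a positive functional to `C = C₀(S)`, on compactly supported functions. -/
def posFunctional (φ : A →ₚ[ℂ] ℂ) (e : C₀(S, ℂ) ≃⋆ₐ[ℂ] C) : C_c(S, ℝ) →ₚ[ℝ] ℝ where
  toFun z := (φ (e (liftC0 z) : A)).re
  map_add' z w := by
    have : liftC0 (z + w) = liftC0 z + liftC0 w := by ext s; simp [liftC0]
    simp [this]
  map_smul' c z := by
    have : liftC0 (c • z) = (c : ℂ) • liftC0 z := by ext s; simp [liftC0]
    simp [this]
  monotone' z w hzw := by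
    have h := nonneg_of_c0 φ e (liftC0 w - liftC0 z) (fun s => by
      have := hzw s
      simp only [liftC0, ZeroAtInftyContinuousMap.coe_sub, Pi.sub_apply]
      change (0 : ℂ) ≤ (w s : ℂ) - (z s : ℂ)
      rw [← Complex.ofReal_sub, Complex.zero_le_real]
      exact sub_nonneg.mpr this)
    have h' := (Complex.nonneg_iff.mp h).1
    simp at h'
    exact h'

/-- Riesz representation of the restriction of a positive functional to `C = C₀(S)`. -/
theorem exists_condMeasure (φ : A →ₚ[ℂ] ℂ) (e : C₀(S, ℂ) ≃⋆ₐ[ℂ] C) :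
    ∃ μ : Measure S, IsFiniteMeasure μ ∧ μ.Regular ∧
      ∀ z : C₀(S, ℂ), φ (e z : A) = ∫ s, z s ∂μ := by
  obtain ⟨M, hM0, hM⟩ := exists_bound_c0 φ e
  set Λ := posFunctional φ e with hΛ
  set μ := RealRMK.rieszMeasure Λ with hμ
  have hΛM : ∀ z : C_c(S, ℝ), (∀ s, z s ∈ Set.Icc (0 : ℝ) 1) → Λ z ≤ M := by
    intro z hz
    have h1 : Λ z ≤ ‖φ (e (liftC0 z) : A)‖ := Complex.re_le_norm _
    have h2 : ‖liftC0 z‖ ≤ 1 := by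
      rw [← ZeroAtInftyContinuousMap.norm_toBCF_eq_norm]
      refine (BoundedContinuousFunction.norm_le zero_le_one).mpr fun s => ?_
      change ‖(z s : ℂ)‖ ≤ 1
      rw [Complex.norm_real, Real.norm_of_nonneg (hz s).1]
      exact (hz s).2
    nlinarith [hM (liftC0 z)]
  have hcut : ∀ K : Set S, IsCompact K → ∃ χ : C_c(S, ℝ), (∀ s ∈ K, χ s = 1) ∧
      ∀ s, χ s ∈ Set.Icc (0 : ℝ) 1 := by
    intro K hK
    obtain ⟨f, hf1, -, hf2, hf3⟩ :=
      exists_continuous_one_zero_of_isCompact hK isClosed_empty (Set.disjoint_empty K)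
    exact ⟨⟨f, hf2⟩, fun s hs => hf1 hs, hf3⟩
  have hfin : IsFiniteMeasure μ := by
    refine ⟨lt_of_le_of_lt ?_ (ENNReal.ofReal_lt_top (r := M))⟩
    rw [isOpen_univ.measure_eq_iSup_isCompact]
    refine iSup₂_le fun K _ => iSup_le fun hK => ?_
    obtain ⟨χ, h1, h2⟩ := hcut K hK
    exact (RealRMK.rieszMeasure_le_of_eq_one Λ (fun s => (h2 s).1) hK h1).trans
      (ENNReal.ofReal_le_ofReal (hΛM χ h2))
  refine ⟨μ, hfin, inferInstance, ?_⟩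
  have hint : ∀ z : C₀(S, ℂ), Integrable z μ := fun z => z.toBCF.integrable μ
  have hreal : ∀ z : C_c(S, ℝ), φ (e (liftC0 z) : A) = ∫ s, liftC0 z s ∂μ := by
    intro z
    have h1 : Λ z = ∫ s, z s ∂μ := (RealRMK.integral_rieszMeasure Λ z).symm
    have h2 : ∫ s, liftC0 z s ∂μ = ((∫ s, z s ∂μ : ℝ) : ℂ) := integral_ofReal
    rw [h2, ← h1]
    have hsa : star (liftC0 z) = liftC0 z := by
      ext s
      exact Complex.conj_ofReal _
    have h3 : star (φ (e (liftC0 z) : A)) = φ (e (liftC0 z) : A) := by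
      rw [← map_star]
      congr 1
      conv_rhs => rw [← hsa, map_star]
      rfl
    exact (Complex.conj_eq_iff_re.mp h3).symm
  intro z
  have key : ∀ ε : ℝ, 0 < ε → ‖φ (e z : A) - ∫ s, z s ∂μ‖ ≤ (M + μ.real Set.univ) * ε := by
    intro ε hε
    have hK : ∃ K : Set S, IsCompact K ∧ ∀ s ∉ K, ‖z s‖ ≤ ε := by
      have h := (zero_at_infty z).eventually (Metric.closedBall_mem_nhds (0 : ℂ) hε)
      obtain ⟨K, hK, hKs⟩ := mem_cocompact.mp h
      exact ⟨K, hK, fun s hs => by simpa using hKs hs⟩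
    obtain ⟨K, hK, hKs⟩ := hK
    obtain ⟨χ, h1, h2⟩ := hcut K hK
    let r : C_c(S, ℝ) := ⟨⟨fun s => χ s * (z s).re, (map_continuous χ).mul
      (Complex.continuous_re.comp (map_continuous z))⟩, χ.hasCompactSupport.mul_right⟩
    let i : C_c(S, ℝ) := ⟨⟨fun s => χ s * (z s).im, (map_continuous χ).mul
      (Complex.continuous_im.comp (map_continuous z))⟩, χ.hasCompactSupport.mul_right⟩
    set w : C₀(S, ℂ) := liftC0 r + Complex.I • liftC0 i with hw
    have hws : ∀ s, w s = (χ s : ℂ) * z s := by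
      intro s
      change ((χ s * (z s).re : ℝ) : ℂ) + Complex.I * ((χ s * (z s).im : ℝ) : ℂ) = _
      conv_rhs => rw [← Complex.re_add_im (z s)]
      push_cast
      ring
    have hφw : φ (e w : A) = ∫ s, w s ∂μ := by
      have : ∫ s, w s ∂μ = ∫ s, liftC0 r s ∂μ + Complex.I * ∫ s, liftC0 i s ∂μ := by
        rw [← integral_const_mul, ← integral_add (hint _) ((hint _).const_mul _)]
        rfl
      rw [this, ← hreal, ← hreal, hw]
      simp
    have hzw : ∀ s, ‖(z - w) s‖ ≤ ε := by
      intro s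
      rw [ZeroAtInftyContinuousMap.sub_apply, hws]
      by_cases hs : s ∈ K
      · rw [h1 s hs]; simpa using hε.le
      · have h3 : z s - (χ s : ℂ) * z s = ((1 - χ s : ℝ) : ℂ) * z s := by push_cast; ring
        rw [h3, norm_mul, Complex.norm_real, Real.norm_of_nonneg (by linarith [(h2 s).2])]
        have := hKs s hs
        nlinarith [(h2 s).1, (h2 s).2, norm_nonneg (z s)]
    have hn : ‖z - w‖ ≤ ε := by
      rw [← ZeroAtInftyContinuousMap.norm_toBCF_eq_norm]
      exact (BoundedContinuousFunction.norm_le hε.le).mpr hzw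
    have hd : φ (e z : A) - ∫ s, z s ∂μ = φ (e (z - w) : A) - ∫ s, (z - w) s ∂μ := by
      have : ∫ s, (z - w) s ∂μ = ∫ s, z s ∂μ - ∫ s, w s ∂μ := by
        rw [← integral_sub (hint _) (hint _)]
        rfl
      rw [this, ← hφw, map_sub]
      simp
    rw [hd]
    refine (norm_sub_le _ _).trans ?_
    have h5 := hM (z - w)
    have h6 : ‖∫ s, (z - w) s ∂μ‖ ≤ ε * μ.real Set.univ :=
      norm_integral_le_of_norm_le_const (Eventually.of_forall hzw)
    nlinarith
  have hz : ‖φ (e z : A) - ∫ s, z s ∂μ‖ ≤ 0 := by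
    have hB : 0 ≤ M + μ.real Set.univ := by positivity
    refine le_of_forall_pos_le_add fun ε hε => ?_
    have := key (ε / (M + μ.real Set.univ + 1)) (by positivity)
    refine this.trans ?_
    rw [zero_add, mul_div_assoc', div_le_iff₀ (by positivity)]
    nlinarith
  exact sub_eq_zero.mp (norm_le_zero_iff.mp hz)

/-- The finite Radon measure on `S` that represents the restriction of `φ` to `C = C₀(S)`. -/
def condMeasure (φ : A →ₚ[ℂ] ℂ) (e : C₀(S, ℂ) ≃⋆ₐ[ℂ] C) : Measure S :=
  (exists_condMeasure φ e).choose

instance (φ : A →ₚ[ℂ] ℂ) (e : C₀(S, ℂ) ≃⋆ₐ[ℂ] C) : IsFiniteMeasure (condMeasure φ e) :=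
  (exists_condMeasure φ e).choose_spec.1

instance (φ : A →ₚ[ℂ] ℂ) (e : C₀(S, ℂ) ≃⋆ₐ[ℂ] C) : (condMeasure φ e).Regular :=
  (exists_condMeasure φ e).choose_spec.2.1

theorem integral_condMeasure (φ : A →ₚ[ℂ] ℂ) (e : C₀(S, ℂ) ≃⋆ₐ[ℂ] C) (z : C₀(S, ℂ)) :
    φ (e z : A) = ∫ s, z s ∂(condMeasure φ e) :=
  (exists_condMeasure φ e).choose_spec.2.2 z

end Measure

section Expectation

variable {C : NonUnitalStarSubalgebra ℂ A}

theorem star_fst_mul_fst (m : 𝓜(ℂ, A)) (a : A) :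
    star (m.fst a) * m.fst a = star a * (star m * m).fst a := by
  have h : (star m * m).fst a = (star m).fst (m.fst a) := by
    rw [DoubleCentralizer.mul_fst]; rfl
  rw [h, DoubleCentralizer.star_fst, ← star_mul, m.central, star_mul, star_star]

theorem star_fst_mul_fst_le (φ : A →ₚ[ℂ] ℂ) (m : 𝓜(ℂ, A)) (a : A) :
    (φ (star (m.fst a) * m.fst a)).re ≤ ‖m‖ ^ 2 * (φ (star a * a)).re := by
  let _ := CStarAlgebra.spectralOrder 𝓜(ℂ, A)
  have := CStarAlgebra.spectralOrderedRing 𝓜(ℂ, A)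
  have h1 : star m * m ≤ algebraMap ℝ 𝓜(ℂ, A) ‖star m * m‖ :=
    IsSelfAdjoint.le_algebraMap_norm_self (IsSelfAdjoint.star_mul_self m)
  rw [CStarRing.norm_star_mul_self, ← sq, ← sub_nonneg] at h1
  obtain ⟨d, hd⟩ := CStarAlgebra.nonneg_iff_eq_star_mul_self.mp h1
  have h2 : star (d.fst a) * d.fst a =
      ((‖m‖ ^ 2 : ℝ) : ℂ) • (star a * a) - star (m.fst a) * m.fst a := by
    rw [star_fst_mul_fst, star_fst_mul_fst m, ← hd]
    have : (algebraMap ℝ 𝓜(ℂ, A) (‖m‖ ^ 2)) = algebraMap ℂ 𝓜(ℂ, A) ((‖m‖ ^ 2 : ℝ) : ℂ) := rfl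
    rw [this, DoubleCentralizer.sub_fst, DoubleCentralizer.algebraMap_fst]
    simp [mul_sub, mul_smul_comm, Algebra.algebraMap_eq_smul_one]
  have h3 := (Complex.nonneg_iff.mp (φ.map_nonneg (star_mul_self_nonneg (d.fst a)))).1
  rw [h2, map_sub, map_smul, smul_eq_mul, Complex.sub_re, Complex.re_ofReal_mul] at h3
  linarith

theorem norm_apply_star_mul_le (φ : A →ₚ[ℂ] ℂ) (a b : A) {r s : ℝ} (hr : 0 ≤ r) (hs : 0 ≤ s)
    (ha : (φ (star a * a)).re ≤ r ^ 2) (hb : (φ (star b * b)).re ≤ s ^ 2) :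
    ‖φ (star a * b)‖ ≤ r * s := by
  have h := norm_inner_le_norm (𝕜 := ℂ) (φ.toPreGNS a) (φ.toPreGNS b)
  rw [PositiveLinearMap.preGNS_inner_def, PositiveLinearMap.preGNS_norm_def,
    PositiveLinearMap.preGNS_norm_def] at h
  simp only [PositiveLinearMap.ofPreGNS_toPreGNS] at h
  exact h.trans (mul_le_mul (Real.sqrt_le_iff.mpr ⟨hr, ha⟩) (Real.sqrt_le_iff.mpr ⟨hs, hb⟩)
    (Real.sqrt_nonneg _) hr)

theorem norm_apply_snd_le (φ : A →ₚ[ℂ] ℂ) (e : C₀(S, ℂ) ≃⋆ₐ[ℂ] C)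
    (hC : (C : Set A) ⊆ centralizer φ) (m : 𝓜(ℂ, A)) (z : C₀(S, ℂ)) :
    ‖φ (m.snd (e z))‖ ≤ ‖m‖ * ∫ s, ‖z s‖ ∂(condMeasure φ e) := by
  let v : C₀(S, ℂ) :=
    { toFun := fun s => (Real.sqrt ‖z s‖ : ℂ)
      continuous_toFun := Complex.continuous_ofReal.comp
        (Real.continuous_sqrt.comp (map_continuous z).norm)
      zero_at_infty' := by
        have hc : Continuous fun u : ℂ => (Real.sqrt ‖u‖ : ℂ) := by fun_prop
        have h := (hc.tendsto 0).comp (zero_at_infty z)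
        rw [norm_zero, Real.sqrt_zero, Complex.ofReal_zero] at h
        exact h }
  have hdn : ∀ u : ℂ, ‖u / (Real.sqrt ‖u‖ : ℂ)‖ = Real.sqrt ‖u‖ := by
    intro u
    rw [norm_div, Complex.norm_real, Real.norm_of_nonneg (Real.sqrt_nonneg _), Real.div_sqrt]
  have hdc : Continuous fun u : ℂ => u / (Real.sqrt ‖u‖ : ℂ) := by
    rw [continuous_iff_continuousAt]
    intro u
    by_cases hu : u = 0
    · subst hu
      rw [ContinuousAt, zero_div]
      rw [tendsto_zero_iff_norm_tendsto_zero]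
      simp only [hdn]
      have hc : Continuous fun u : ℂ => Real.sqrt ‖u‖ := by fun_prop
      simpa using hc.tendsto 0
    · refine ContinuousAt.div continuousAt_id (by fun_prop) ?_
      have : 0 < Real.sqrt ‖u‖ := Real.sqrt_pos.mpr (norm_pos_iff.mpr hu)
      exact_mod_cast this.ne'
  let w : C₀(S, ℂ) :=
    { toFun := fun s => z s / (Real.sqrt ‖z s‖ : ℂ)
      continuous_toFun := hdc.comp (map_continuous z)
      zero_at_infty' := by
        have h := (hdc.tendsto 0).comp (zero_at_infty z)
        rw [zero_div] at h
        exact h }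
  have hz : z = w * v := by
    ext s
    change z s = z s / (Real.sqrt ‖z s‖ : ℂ) * (Real.sqrt ‖z s‖ : ℂ)
    by_cases h : z s = 0
    · simp [h]
    · have : 0 < Real.sqrt ‖z s‖ := Real.sqrt_pos.mpr (norm_pos_iff.mpr h)
      have : (Real.sqrt ‖z s‖ : ℂ) ≠ 0 := by exact_mod_cast this.ne'
      field_simp
  set I := ∫ s, ‖z s‖ ∂(condMeasure φ e) with hI
  have hI0 : 0 ≤ I := integral_nonneg fun s => norm_nonneg _
  have hself : ∀ u : C₀(S, ℂ), (∀ s, ‖u s‖ = Real.sqrt ‖z s‖) →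
      (φ (star (e u : A) * (e u : A))).re = I := by
    intro u hu
    have h1 : star (e u : A) * (e u : A) = (e (star u * u) : A) := by
      rw [map_mul, map_star]; rfl
    rw [h1, integral_condMeasure]
    have h2 : ∀ s, (star u * u) s = ((‖z s‖ : ℝ) : ℂ) := by
      intro s
      change star (u s) * u s = _
      rw [Complex.star_def, ← Complex.normSq_eq_conj_mul_self, Complex.normSq_eq_norm_sq, hu,
        Real.sq_sqrt (norm_nonneg _)]
    simp_rw [h2]
    rw [integral_complex_ofReal, Complex.ofReal_re]
  have hvs : star v = v := by
    ext s
    exact Complex.conj_ofReal _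
  have hves : star (e v : A) = (e v : A) := by
    conv_rhs => rw [← hvs, map_star]
    rfl
  have h1 : m.snd (e z) = (e w : A) * m.snd (e v) := by
    have : (e z : A) = (e w : A) * (e v : A) := by rw [hz, map_mul]; rfl
    rw [this]
    -- right multipliers commute with left multiplication
    have h : ∀ c : A, (m.snd ((e w : A) * (e v : A)) - (e w : A) * m.snd (e v)) * c = 0 := by
      intro c
      rw [sub_mul, m.central, mul_assoc, mul_assoc, m.central, sub_self]
    exact sub_eq_zero.mp (CStarRing.mul_star_self_eq_zero_iff _ |>.mp (h _))
  have h2 : φ (m.snd (e z)) = φ (star (e v : A) * m.fst (e w)) := by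
    rw [h1, ← (hC (e w).2 _), m.central, hves]
  rw [h2]
  have h3 := norm_apply_star_mul_le φ (e v : A) (m.fst (e w)) (r := Real.sqrt I)
    (s := ‖m‖ * Real.sqrt I) (Real.sqrt_nonneg _) (by positivity)
    (by rw [Real.sq_sqrt hI0]; refine (hself v fun s => ?_).le
        change ‖(Real.sqrt ‖z s‖ : ℂ)‖ = _
        rw [Complex.norm_real, Real.norm_of_nonneg (Real.sqrt_nonneg _)])
    (by rw [mul_pow, Real.sq_sqrt hI0, ← hself w fun s => hdn (z s)]
        exact star_fst_mul_fst_le φ m _)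
  refine h3.trans (le_of_eq ?_)
  rw [mul_left_comm, Real.mul_self_sqrt hI0]

/-- A bounded functional on `L¹` of a finite measure is given by a bounded function. -/
theorem exists_density {X : Type*} [MeasurableSpace X] (μ : Measure X) [IsFiniteMeasure μ]
    (G : Lp ℂ 1 μ →L[ℂ] ℂ) :
    ∃ g : Lp ℂ ∞ μ, ∀ h : X → ℂ, ∀ hh : MemLp h 2 μ,
      ∫ s, h s * g s ∂μ = G ((hh.mono_exponent one_le_two).toLp h) := by
  have hle : ∀ h : Lp ℂ 2 μ, MemLp h 1 μ := fun h => (Lp.memLp h).mono_exponent one_le_two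
  let J₀ : Lp ℂ 2 μ →ₗ[ℂ] Lp ℂ 1 μ :=
    { toFun := fun h => (hle h).toLp h
      map_add' := fun a b => by
        rw [← MemLp.toLp_add]
        exact MemLp.toLp_congr _ _ (Lp.coeFn_add a b)
      map_smul' := fun c a => by
        rw [RingHom.id_apply, ← MemLp.toLp_const_smul]
        exact MemLp.toLp_congr _ _ (Lp.coeFn_smul c a) }
  let K : ℝ := (μ Set.univ ^ (1 / 2 : ℝ)).toReal
  have hJb : ∀ h, ‖J₀ h‖ ≤ K * ‖h‖ := by
    intro h
    have h1 := eLpNorm_le_eLpNorm_mul_rpow_measure_univ (μ := μ) (p := 1) (q := 2) one_le_two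
      (Lp.memLp h).1
    change ‖(hle h).toLp h‖ ≤ _
    rw [Lp.norm_toLp, Lp.norm_def, mul_comm, ← ENNReal.toReal_mul]
    refine ENNReal.toReal_mono ?_ (h1.trans (le_of_eq ?_))
    · exact ENNReal.mul_ne_top (Lp.eLpNorm_ne_top h)
        (ENNReal.rpow_ne_top_of_nonneg (by norm_num) (measure_ne_top _ _))
    · congr 2
      norm_num
  let J : Lp ℂ 2 μ →L[ℂ] Lp ℂ 1 μ := J₀.mkContinuous K hJb
  let k : Lp ℂ 2 μ := (InnerProductSpace.toDual ℂ (Lp ℂ 2 μ)).symm (G.comp J)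
  have hk : ∀ h : X → ℂ, ∀ hh : MemLp h 2 μ,
      ∫ s, h s * star (k s) ∂μ = G ((hh.mono_exponent one_le_two).toLp h) := by
    intro h hh
    have h1 : inner ℂ k (hh.toLp h) = G (J (hh.toLp h)) := by
      rw [InnerProductSpace.toDual_symm_apply]; rfl
    have h2 : J (hh.toLp h) = (hh.mono_exponent one_le_two).toLp h :=
      MemLp.toLp_congr (hle _) (hh.mono_exponent one_le_two) hh.coeFn_toLp
    rw [← h2, ← h1, L2.inner_def]
    refine integral_congr_ae ?_
    filter_upwards [hh.coeFn_toLp] with s hs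
    rw [hs, RCLike.inner_apply]
    rfl
  have hkm : AEStronglyMeasurable (fun s => star (k s)) μ :=
    (Lp.aestronglyMeasurable k).star
  have hki : Integrable (fun s => ‖k s‖) μ := (hle k).integrable le_rfl |>.norm
  have hb : ∀ᵐ s ∂μ, ‖k s‖ ≤ ‖G‖ := by
    refine ae_le_of_forall_setIntegral_le hki (integrable_const _) fun E hE _ => ?_
    let q : X → ℂ := E.indicator fun s => k s / ‖k s‖
    have hqm : AEStronglyMeasurable q μ := by
      refine AEStronglyMeasurable.indicator ?_ hE
      have hk0 := (Lp.stronglyMeasurable k).measurable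
      exact (hk0.div (Complex.measurable_ofReal.comp hk0.norm)).aestronglyMeasurable
    have hqb : ∀ s, ‖q s‖ ≤ E.indicator (fun _ => (1 : ℝ)) s := by
      intro s
      by_cases hs : s ∈ E
      · simp only [q, Set.indicator_of_mem hs, norm_div, Complex.norm_real, norm_norm]
        exact div_self_le_one _
      · simp [q, hs]
    have hq2 : MemLp q 2 μ := MemLp.of_bound hqm 1 <| Eventually.of_forall fun s =>
      (hqb s).trans (Set.indicator_le_self' (fun _ _ => zero_le_one) s)
    have h1 := hk q hq2
    have h2 : ∫ s, q s * star (k s) ∂μ = ((∫ s in E, ‖k s‖ ∂μ : ℝ) : ℂ) := by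
      rw [← integral_complex_ofReal, ← integral_indicator hE]
      refine integral_congr_ae (Eventually.of_forall fun s => ?_)
      by_cases hs : s ∈ E
      · simp only [q, Set.indicator_of_mem hs]
        by_cases h0 : k s = 0
        · simp [h0]
        · have h3 : (‖k s‖ : ℂ) ≠ 0 := by simpa using h0
          rw [div_mul_eq_mul_div, Complex.star_def, Complex.mul_conj, Complex.normSq_eq_norm_sq]
          push_cast
          field_simp
      · simp [q, hs]
    have h3 : ‖(hq2.mono_exponent one_le_two).toLp q‖ ≤ ∫ s in E, (1 : ℝ) ∂μ := by
      rw [← integral_indicator hE, L1.norm_eq_integral_norm]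
      refine integral_mono_ae (L1.integrable_coeFn _).norm
        ((integrable_const _).indicator hE) ?_
      filter_upwards [(hq2.mono_exponent one_le_two).coeFn_toLp] with s hs
      rw [hs]
      exact hqb s
    have h4 : ‖((∫ s in E, ‖k s‖ ∂μ : ℝ) : ℂ)‖ ≤ ‖G‖ * ∫ s in E, (1 : ℝ) ∂μ := by
      rw [← h2, h1]
      exact (G.le_opNorm _).trans (mul_le_mul_of_nonneg_left h3 (norm_nonneg _))
    rw [Complex.norm_real] at h4
    have h5 : ∫ s in E, ‖G‖ ∂μ = ‖G‖ * ∫ s in E, (1 : ℝ) ∂μ := by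
      rw [← integral_const_mul]; simp
    rw [h5]
    exact (le_abs_self _).trans h4
  have hmem : MemLp (fun s => star (k s)) ∞ μ :=
    memLp_top_of_bound hkm ‖G‖ (hb.mono fun s hs => by rwa [norm_star])
  refine ⟨hmem.toLp _, fun h hh => ?_⟩
  rw [← hk h hh]
  refine integral_congr_ae ?_
  filter_upwards [hmem.coeFn_toLp] with s hs
  rw [hs]

/-- Existence of the conditional expectation; `m.snd c` is the product `c m` in `A`. -/
theorem exists_condExp (φ : A →ₚ[ℂ] ℂ) (e : C₀(S, ℂ) ≃⋆ₐ[ℂ] C)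
    (hC : (C : Set A) ⊆ centralizer φ) (m : 𝓜(ℂ, A)) :
    ∃ g : Lp ℂ ∞ (condMeasure φ e), ∀ z : C₀(S, ℂ),
      ∫ s, z s * g s ∂(condMeasure φ e) = φ (m.snd (e z)) := by
  set μ := condMeasure φ e with hμ
  have hint : ∀ z : C₀(S, ℂ), Integrable z μ := fun z => z.toBCF.integrable μ
  let ℓ : C₀(S, ℂ) →ₗ[ℂ] ℂ :=
    { toFun := fun z => φ (m.snd (e z))
      map_add' := fun a b => by simp
      map_smul' := fun c a => by simp }
  let T : C₀(S, ℂ) →ₗ[ℂ] Lp ℂ 1 μ :=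
    { toFun := fun z => (hint z).toL1 z
      map_add' := fun a b => Integrable.toL1_add _ _ (hint a) (hint b)
      map_smul' := fun c a => Integrable.toL1_smul _ (hint a) c }
  have hT : ∀ z, ‖ℓ z‖ ≤ ‖m‖ * ‖T z‖ := by
    intro z
    refine (norm_apply_snd_le φ e hC m z).trans (le_of_eq ?_)
    congr 1
    change _ = ‖(hint z).toL1 z‖
    rw [L1.norm_eq_integral_norm]
    refine integral_congr_ae ?_
    filter_upwards [(hint z).coeFn_toL1] with s hs
    rw [hs]
  obtain ⟨r, hr⟩ := T.rangeRestrict.exists_rightInverse_of_surjective T.range_rangeRestrict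
  have hr' : ∀ y : LinearMap.range T, T (r y) = y := fun y =>
    congrArg Subtype.val (LinearMap.congr_fun hr y)
  let f : LinearMap.range T →L[ℂ] ℂ := (ℓ.comp r).mkContinuous ‖m‖ fun y => by
    have := hT (r y)
    rw [hr'] at this
    exact this
  obtain ⟨G, hG, -⟩ := exists_extension_norm_eq (LinearMap.range T) f
  have hGT : ∀ z, G (T z) = ℓ z := by
    intro z
    have h1 : G (T z) = ℓ (r ⟨T z, z, rfl⟩) := hG ⟨T z, z, rfl⟩
    rw [h1, ← sub_eq_zero, ← map_sub, ← norm_le_zero_iff]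
    refine (hT _).trans (le_of_eq ?_)
    rw [map_sub, hr', sub_self, norm_zero, mul_zero]
  obtain ⟨g, hg⟩ := exists_density μ G
  refine ⟨g, fun z => ?_⟩
  have hz2 : MemLp z 2 μ := MemLp.of_bound (hint z).1 ‖z‖ <| Eventually.of_forall fun s => by
    rw [← ZeroAtInftyContinuousMap.norm_toBCF_eq_norm]
    exact z.toBCF.norm_coe_le_norm s
  rw [hg z hz2]
  exact hGT z

/-- The conditional expectation `Φ : M(A) → L^∞(S, μ)`: for `m ∈ M(A)`, the element `Φ(m)` (unique
by `condExp_unique`) with `∫ z Φ(m) dμ = φ(z m)` for all `z ∈ C = C₀(S)`. Here `m.snd z = z m`. -/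
def condExp (φ : A →ₚ[ℂ] ℂ) (e : C₀(S, ℂ) ≃⋆ₐ[ℂ] C)
    (hC : (C : Set A) ⊆ centralizer φ) (m : 𝓜(ℂ, A)) : Lp ℂ ∞ (condMeasure φ e) :=
  (exists_condExp φ e hC m).choose

/-- The conditional expectation is determined by its defining property. -/
theorem condExp_unique (μ : Measure S) [IsFiniteMeasure μ] [μ.Regular] (g h : Lp ℂ ∞ μ)
    (hgh : ∀ z : C₀(S, ℂ), ∫ s, z s * g s ∂μ = ∫ s, z s * h s ∂μ) : g = h := by
  set d := g - h with hd
  have hdm : MemLp d ∞ μ := Lp.memLp d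
  have hdi : Integrable d μ := hdm.integrable le_top
  have hgi : ∀ u : Lp ℂ ∞ μ, ∀ z : C₀(S, ℂ), Integrable (fun s => z s * u s) μ := fun u z =>
    ((Lp.memLp u).integrable le_top).bdd_mul (c := ‖z.toBCF‖)
      (map_continuous z).aestronglyMeasurable
      (Eventually.of_forall fun s => z.toBCF.norm_coe_le_norm s)
  have h0 : ∀ z : C₀(S, ℂ), ∫ s, z s * d s ∂μ = 0 := by
    intro z
    have : ∫ s, z s * d s ∂μ = ∫ s, (z s * g s - z s * h s) ∂μ := by
      refine integral_congr_ae ?_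
      filter_upwards [Lp.coeFn_sub g h] with s hs
      rw [hd, hs, Pi.sub_apply, mul_sub]
    rw [this, integral_sub (hgi g z) (hgi h z), hgh, sub_self]
  have hb : ∀ᵐ s ∂μ, ‖d s‖ ≤ ‖d‖ := by
    have := ae_le_eLpNormEssSup (f := d) (μ := μ)
    filter_upwards [this] with s hs
    rw [Lp.norm_def, eLpNorm_exponent_top]
    have hfin : eLpNormEssSup d μ ≠ ∞ := by
      have := hdm.2.ne
      rwa [eLpNorm_exponent_top] at this
    have h1 := ENNReal.toReal_mono hfin hs
    simpa using h1
  have hzero : (d : S → ℂ) =ᵐ[μ] 0 := by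
    refine hdi.ae_eq_zero_of_forall_setIntegral_eq_zero fun E hE _ => ?_
    rw [← norm_le_zero_iff]
    refine le_of_forall_pos_le_add fun ε hε => ?_
    have hε' : 0 < ε / (‖d‖ + 1) := by positivity
    have hq : MemLp (E.indicator fun _ => (1 : ℂ)) 1 μ :=
      memLp_one_iff_integrable.mpr ((integrable_const _).indicator hE)
    obtain ⟨q, hqs, hqn, hqc, hqi⟩ := hq.exists_hasCompactSupport_eLpNorm_sub_le (by norm_num)
      (ε := ENNReal.ofReal (ε / (‖d‖ + 1))) (by simpa using hε')
    let z : C₀(S, ℂ) :=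
      { toFun := q
        continuous_toFun := hqc
        zero_at_infty' := hqs.is_zero_at_infty }
    have hdiff : Integrable ((E.indicator fun _ => (1 : ℂ)) - q) μ :=
      memLp_one_iff_integrable.mp (hq.sub hqi)
    have h1 : ∫ s in E, d s ∂μ = ∫ s, ((E.indicator fun _ => (1 : ℂ)) - q) s * d s ∂μ := by
      have h2 : ∫ s in E, d s ∂μ = ∫ s, (E.indicator fun _ => (1 : ℂ)) s * d s ∂μ := by
        rw [← integral_indicator hE]
        refine integral_congr_ae (Eventually.of_forall fun s => ?_)
        by_cases hs : s ∈ E <;> simp [hs]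
      have h3 : Integrable (fun s => (E.indicator fun _ => (1 : ℂ)) s * d s) μ := by
        refine (hdi.indicator hE).congr (Eventually.of_forall fun s => ?_)
        by_cases hs : s ∈ E <;> simp [hs]
      have h4 := integral_sub h3 (hgi d z)
      rw [h0 z, sub_zero] at h4
      rw [h2, ← h4]
      refine integral_congr_ae (Eventually.of_forall fun s => ?_)
      simp only [Pi.sub_apply, sub_mul]
      rfl
    have h5 : ∫ s, ‖((E.indicator fun _ => (1 : ℂ)) - q) s‖ ∂μ ≤ ε / (‖d‖ + 1) := by
      rw [← ENNReal.ofReal_le_ofReal_iff hε'.le, ofReal_integral_norm_eq_lintegral_enorm hdiff,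
        ← eLpNorm_one_eq_lintegral_enorm]
      exact hqn
    rw [h1, zero_add]
    have h6 : ‖∫ s, ((E.indicator fun _ => (1 : ℂ)) - q) s * d s ∂μ‖ ≤
        ∫ s, ‖((E.indicator fun _ => (1 : ℂ)) - q) s‖ * ‖d‖ ∂μ := by
      refine norm_integral_le_of_norm_le (hdiff.norm.mul_const _) ?_
      filter_upwards [hb] with s hs
      rw [norm_mul]
      exact mul_le_mul_of_nonneg_left hs (norm_nonneg _)
    refine h6.trans ?_
    rw [integral_mul_const]
    refine (mul_le_mul_of_nonneg_right h5 (norm_nonneg _)).trans ?_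
    rw [div_mul_eq_mul_div, div_le_iff₀ (by positivity)]
    nlinarith [norm_nonneg d]
  have : d = 0 := Lp.eq_zero_iff_ae_eq_zero.mpr hzero
  exact sub_eq_zero.mp this

theorem integral_mul_condExp (φ : A →ₚ[ℂ] ℂ) (e : C₀(S, ℂ) ≃⋆ₐ[ℂ] C)
    (hC : (C : Set A) ⊆ centralizer φ) (m : 𝓜(ℂ, A)) (z : C₀(S, ℂ)) :
    ∫ s, z s * condExp φ e hC m s ∂(condMeasure φ e) = φ (m.snd (e z)) :=
  (exists_condExp φ e hC m).choose_spec z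

end Expectation
end CondExp

end

end CondJensen

namespace CondJensen

set_option linter.unusedSectionVars false

section ExtendProperties

variable {A : Type*} [NonUnitalCStarAlgebra A] [PartialOrder A] [StarOrderedRing A]

theorem mul_snd (m : 𝓜(ℂ, A)) (x y : A) : x * m.snd y = m.snd (x * y) := by
  have h : ∀ c : A, (m.snd (x * y) - x * m.snd y) * c = 0 := by
    intro c
    rw [sub_mul, m.central, mul_assoc, mul_assoc, m.central, sub_self]
  exact (sub_eq_zero.mp (CStarRing.mul_star_self_eq_zero_iff _ |>.mp (h _))).symm

theorem extend_eq_of_tendsto {ψ : A →L[ℂ] ℂ} {m : 𝓜(ℂ, A)} {z : ℂ}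
    (h : Tendsto (fun e => ψ (m.fst e)) (CStarAlgebra.approximateUnit A) (𝓝 z)) :
    extend ψ m = z :=
  have := (CStarAlgebra.increasingApproximateUnit A).neBot
  tendsto_nhds_unique (tendsto_extend ψ m) h

theorem extend_add (ψ : A →L[ℂ] ℂ) (m k : 𝓜(ℂ, A)) :
    extend ψ (m + k) = extend ψ m + extend ψ k := by
  refine extend_eq_of_tendsto ?_
  simpa using (tendsto_extend ψ m).add (tendsto_extend ψ k)

theorem extend_smul (ψ : A →L[ℂ] ℂ) (c : ℂ) (m : 𝓜(ℂ, A)) :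
    extend ψ (c • m) = c * extend ψ m := by
  refine extend_eq_of_tendsto ?_
  simpa using (tendsto_extend ψ m).const_mul c

theorem extend_sub (ψ : A →L[ℂ] ℂ) (m k : 𝓜(ℂ, A)) :
    extend ψ (m - k) = extend ψ m - extend ψ k := by
  refine extend_eq_of_tendsto ?_
  simpa using (tendsto_extend ψ m).sub (tendsto_extend ψ k)

theorem norm_extend_le (ψ : A →L[ℂ] ℂ) (m : 𝓜(ℂ, A)) : ‖extend ψ m‖ ≤ ‖ψ‖ * ‖m‖ := by
  have hl := CStarAlgebra.increasingApproximateUnit A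
  have := hl.neBot
  refine le_of_tendsto (tendsto_extend ψ m).norm ?_
  filter_upwards [hl.eventually_norm] with e he
  refine (ψ.le_opNorm _).trans (mul_le_mul_of_nonneg_left ?_ (norm_nonneg _))
  refine (m.fst.le_opNorm e).trans ?_
  rw [DoubleCentralizer.norm_fst]
  nlinarith [norm_nonneg m]

theorem extend_comp_mul_right (ψ : A →L[ℂ] ℂ) (c : A) (m : 𝓜(ℂ, A)) :
    extend (ψ.comp ((ContinuousLinearMap.mul ℂ A).flip c)) m = ψ (m.fst c) := by
  have hl := CStarAlgebra.increasingApproximateUnit A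
  refine extend_eq_of_tendsto ?_
  have h := (ψ.continuous.tendsto _).comp ((m.fst.continuous.tendsto c).comp
    (hl.toIsApproximateUnit.tendsto_mul_right c))
  refine h.congr fun e => ?_
  simp [fst_mul]

theorem extend_comp_mul_left (ψ : A →L[ℂ] ℂ) (d : A) (m : 𝓜(ℂ, A)) :
    extend (ψ.comp (ContinuousLinearMap.mul ℂ A d)) m = ψ (m.snd d) := by
  have hl := CStarAlgebra.increasingApproximateUnit A
  refine extend_eq_of_tendsto ?_
  have h := (ψ.continuous.tendsto _).comp (hl.toIsApproximateUnit.tendsto_mul_left (m.snd d))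
  refine h.congr fun e => ?_
  simp [m.central]

theorem exists_norm_extend_sub_le (ψ : A →L[ℂ] ℂ) {ε : ℝ} (hε : 0 < ε) :
    ∃ f : A, ∀ m : 𝓜(ℂ, A), ‖extend ψ m - ψ (m.fst f)‖ ≤ ε * ‖m‖ := by
  have hl := CStarAlgebra.increasingApproximateUnit A
  have := hl.neBot
  obtain ⟨f, hf⟩ := (eventually_norm_sub_mul_le ψ hε).exists
  have hf' : ∀ b : A, ‖ψ (b - b * f)‖ ≤ ε * ‖b‖ := by
    intro b
    rcases eq_or_ne b 0 with rfl | hb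
    · simp
    have hb0 : 0 < ‖b‖ := norm_pos_iff.mpr hb
    have h := hf ((‖b‖ : ℂ)⁻¹ • b) (by
      rw [norm_smul, norm_inv, Complex.norm_real, norm_norm, inv_mul_cancel₀ hb0.ne'])
    rwa [smul_mul_assoc, ← smul_sub, map_smul, norm_smul, norm_inv, Complex.norm_real, norm_norm,
      inv_mul_le_iff₀ hb0, mul_comm] at h
  refine ⟨f, fun m => ?_⟩
  have h1 : Tendsto (fun e => ψ (m.fst (e * f))) (CStarAlgebra.approximateUnit A)
      (𝓝 (ψ (m.fst f))) := (ψ.continuous.tendsto _).comp ((m.fst.continuous.tendsto f).comp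
    (hl.toIsApproximateUnit.tendsto_mul_right f))
  refine le_of_tendsto ((tendsto_extend ψ m).sub h1).norm ?_
  filter_upwards [hl.eventually_norm] with e he
  have h2 := hf' (m.fst e)
  rw [fst_mul, map_sub] at h2
  refine h2.trans (mul_le_mul_of_nonneg_left ?_ hε.le)
  refine (m.fst.le_opNorm e).trans ?_
  rw [DoubleCentralizer.norm_fst]
  nlinarith [norm_nonneg m]

theorem exists_seq_tendsto_extend (ψ : A →L[ℂ] ℂ) :
    ∃ f : ℕ → A, (∀ m : 𝓜(ℂ, A), Tendsto (fun k => ψ (m.fst (f k))) atTop (𝓝 (extend ψ m))) ∧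
      ∀ k (m : 𝓜(ℂ, A)), ‖ψ (m.fst (f k))‖ ≤ (‖ψ‖ + 1) * ‖m‖ := by
  choose f hf using fun k : ℕ => exists_norm_extend_sub_le ψ (ε := 1 / (k + 1)) (by positivity)
  refine ⟨f, fun m => tendsto_iff_norm_sub_tendsto_zero.mpr ?_, fun k m => ?_⟩
  · refine squeeze_zero (fun _ => norm_nonneg _) (fun k => ?_)
      (g := fun k : ℕ => 1 / ((k : ℝ) + 1) * ‖m‖) ?_
    · rw [norm_sub_rev]
      exact hf k m
    · simpa using tendsto_one_div_add_atTop_nhds_zero_nat.mul_const ‖m‖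
  · have h1 : 1 / ((k : ℝ) + 1) ≤ 1 := by
      rw [div_le_one (by positivity)]
      linarith [(Nat.cast_nonneg k : (0 : ℝ) ≤ k)]
    have h2 := mul_le_mul_of_nonneg_right h1 (norm_nonneg m)
    have h3 := norm_sub_le (extend ψ m) (extend ψ m - ψ (m.fst (f k)))
    rw [sub_sub_cancel] at h3
    linarith [hf k m, norm_extend_le ψ m]

theorem tendsto_extend_of_strict (ψ : A →L[ℂ] ℂ) {B : ℕ → 𝓜(ℂ, A)} {b : 𝓜(ℂ, A)} {K : ℝ}
    (hK : ∀ k, ‖B k‖ ≤ K) (h : ∀ c, Tendsto (fun k => (B k).fst c) atTop (𝓝 (b.fst c))) :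
    Tendsto (fun k => extend ψ (B k)) atTop (𝓝 (extend ψ b)) := by
  have hK0 : 0 ≤ K := (norm_nonneg _).trans (hK 0)
  rw [Metric.tendsto_atTop']
  intro ε hε
  obtain ⟨f, hf⟩ := exists_norm_extend_sub_le ψ (ε := ε / (2 * (K + ‖b‖ + 1))) (by positivity)
  have h1 := ((ψ.continuous.tendsto _).comp (h f))
  rw [Metric.tendsto_atTop'] at h1
  obtain ⟨N, hN⟩ := h1 (ε / 2) (by positivity)
  refine ⟨N, fun k hk => ?_⟩
  have h2 := hN k hk
  rw [dist_eq_norm] at h2 ⊢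
  have h3 : extend ψ (B k) - extend ψ b = (extend ψ (B k) - ψ ((B k).fst f)) +
    (ψ ((B k).fst f) - ψ (b.fst f)) - (extend ψ b - ψ (b.fst f)) := by ring
  rw [h3]
  have h4 := hf (B k)
  have h5 := hf b
  have h6 : ε / (2 * (K + ‖b‖ + 1)) * ‖B k‖ + ε / (2 * (K + ‖b‖ + 1)) * ‖b‖ ≤ ε / 2 := by
    rw [← mul_add, div_mul_eq_mul_div, div_le_iff₀ (by positivity)]
    nlinarith [hK k, norm_nonneg b]
  calc _ ≤ _ := norm_sub_le _ _
    _ ≤ _ := add_le_add_left (norm_add_le _ _) _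
    _ < ε := by simp only [Function.comp] at h2; linarith

theorem multiplier_ext {m k : 𝓜(ℂ, A)} (h : ∀ c, m.fst c = k.fst c) : m = k := by
  rw [← sub_eq_zero, ← norm_le_zero_iff, ← DoubleCentralizer.norm_fst,
    DoubleCentralizer.sub_fst, norm_le_zero_iff]
  ext c
  simp [h c]

theorem star_conj_fst (a x : 𝓜(ℂ, A)) (c : A) :
    star c * (star a * x * a).fst c = star (a.fst c) * x.fst (a.fst c) := by
  have h : (star a * x * a).fst c = (star a).fst (x.fst (a.fst c)) := by
    simp only [DoubleCentralizer.mul_fst]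
    rfl
  rw [h, DoubleCentralizer.star_fst, ← star_mul, a.central, star_mul, star_star]

end ExtendProperties

section Pettis

variable {E : Type*} [NormedAddCommGroup E] [NormedSpace ℂ E] [TopologicalSpace.SeparableSpace E]

theorem exists_separating_seq (E : Type*) [NormedAddCommGroup E] [NormedSpace ℂ E]
    [TopologicalSpace.SeparableSpace E] :
    ∃ ψ : ℕ → E →L[ℂ] ℂ, ∀ x : E, (∀ n, ψ n x = 0) → x = 0 := by
  choose ψ hψ1 hψ2 using fun n => exists_dual_vector'' ℂ (TopologicalSpace.denseSeq E n)
  refine ⟨ψ, fun x hx => ?_⟩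
  rw [← norm_le_zero_iff]
  refine le_of_forall_pos_le_add fun ε hε => ?_
  obtain ⟨n, hn⟩ := Metric.denseRange_iff.mp (TopologicalSpace.denseRange_denseSeq E) x (ε / 2)
    (by positivity)
  set d := TopologicalSpace.denseSeq E n
  have h1 : ‖d‖ ≤ ‖d - x‖ := by
    have h2 := (ψ n).le_opNorm (d - x)
    rw [map_sub, hx, sub_zero, hψ2 n, RCLike.norm_ofReal, abs_norm] at h2
    exact h2.trans (mul_le_of_le_one_left (norm_nonneg _) (hψ1 n))
  rw [dist_eq_norm, norm_sub_rev] at hn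
  have h3 : ‖x‖ ≤ ‖d‖ + ‖d - x‖ := by
    have := norm_sub_le d (d - x)
    rwa [sub_sub_cancel] at this
  linarith

/-- The Pettis measurability theorem for separable Banach spaces. -/
theorem aestronglyMeasurable_of_forall_dual [CompleteSpace E] {T : Type*} [MeasurableSpace T]
    {ν : Measure T} {g : T → E} (h : ∀ ψ : E →L[ℂ] ℂ, AEMeasurable (fun t => ψ (g t)) ν) :
    AEStronglyMeasurable g ν := by
  borelize E
  obtain ⟨ψ, hψ⟩ := exists_separating_seq E
  have : PolishSpace E := { }
  let ι : E → ℕ → ℂ := fun x n => ψ n x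
  have hι : MeasurableEmbedding ι := by
    refine Continuous.measurableEmbedding (continuous_pi fun n => (ψ n).continuous) ?_
    intro x y hxy
    rw [← sub_eq_zero]
    refine hψ _ fun n => ?_
    rw [map_sub, sub_eq_zero]
    exact congrFun hxy n
  have : AEMeasurable (ι ∘ g) ν := aemeasurable_pi_iff.mpr fun n => h (ψ n)
  exact (hι.aemeasurable_comp_iff.mp this).aestronglyMeasurable

end Pettis

section WeakStarMeasurable

variable {A : Type*} [NonUnitalCStarAlgebra A] [PartialOrder A] [StarOrderedRing A]
  {T : Type*} [MeasurableSpace T] {ν : Measure T}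

theorem isWeakStarMeasurable_of_fst {a : T → 𝓜(ℂ, A)}
    (h : ∀ c, AEStronglyMeasurable (fun t => (a t).fst c) ν) : IsWeakStarMeasurable ν a := by
  intro ψ
  obtain ⟨f, hf, -⟩ := exists_seq_tendsto_extend ψ
  exact aemeasurable_of_tendsto_metrizable_ae atTop
    (fun k => (ψ.continuous.comp_aestronglyMeasurable (h (f k))).aemeasurable)
    (Eventually.of_forall fun t => hf (a t))

theorem IsWeakStarMeasurable.congr {a b : T → 𝓜(ℂ, A)} (ha : IsWeakStarMeasurable ν a)
    (h : a =ᵐ[ν] b) : IsWeakStarMeasurable ν b := fun ψ =>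
  (ha ψ).congr (h.mono fun t ht => by simp only [ht])

theorem IsWeakStarMeasurable.mono_measure {a : T → 𝓜(ℂ, A)} {ν' : Measure T}
    (ha : IsWeakStarMeasurable ν a) (h : ν' ≤ ν) : IsWeakStarMeasurable ν' a := fun ψ =>
  (ha ψ).mono_measure h

theorem isWeakStarMeasurable_const (m : 𝓜(ℂ, A)) :
    IsWeakStarMeasurable ν fun _ => m := fun _ => aemeasurable_const

theorem IsWeakStarMeasurable.add {a b : T → 𝓜(ℂ, A)} (ha : IsWeakStarMeasurable ν a)
    (hb : IsWeakStarMeasurable ν b) : IsWeakStarMeasurable ν fun t => a t + b t := fun ψ => by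
  simp only [extend_add]
  exact (ha ψ).add (hb ψ)

theorem IsWeakStarMeasurable.sub {a b : T → 𝓜(ℂ, A)} (ha : IsWeakStarMeasurable ν a)
    (hb : IsWeakStarMeasurable ν b) : IsWeakStarMeasurable ν fun t => a t - b t := fun ψ => by
  simp only [extend_sub]
  exact (ha ψ).sub (hb ψ)

theorem IsWeakStarMeasurable.smul {a : T → 𝓜(ℂ, A)} (ha : IsWeakStarMeasurable ν a) (c : ℂ) :
    IsWeakStarMeasurable ν fun t => c • a t := fun ψ => by
  simp only [extend_smul]
  exact (ha ψ).const_mul c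

theorem isWeakStarMeasurable_of_tendsto {a : ℕ → T → 𝓜(ℂ, A)} {b : T → 𝓜(ℂ, A)}
    (ha : ∀ k, IsWeakStarMeasurable ν (a k))
    (h : ∀ᵐ t ∂ν, Tendsto (fun k => a k t) atTop (𝓝 (b t))) : IsWeakStarMeasurable ν b := by
  intro ψ
  refine aemeasurable_of_tendsto_metrizable_ae atTop (fun k => ha k ψ) ?_
  filter_upwards [h] with t ht
  refine tendsto_iff_norm_sub_tendsto_zero.mpr ?_
  refine squeeze_zero (fun _ => norm_nonneg _) (fun k => ?_)
    (g := fun k => ‖ψ‖ * ‖a k t - b t‖) ?_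
  · rw [← extend_sub]
    exact norm_extend_le ψ _
  · simpa using (tendsto_iff_norm_sub_tendsto_zero.mp ht).const_mul ‖ψ‖

variable [TopologicalSpace.SeparableSpace A]

theorem IsWeakStarMeasurable.fst {a : T → 𝓜(ℂ, A)} (ha : IsWeakStarMeasurable ν a) (c : A) :
    AEStronglyMeasurable (fun t => (a t).fst c) ν := by
  refine aestronglyMeasurable_of_forall_dual fun ψ => ?_
  simpa only [extend_comp_mul_right] using ha (ψ.comp ((ContinuousLinearMap.mul ℂ A).flip c))

theorem IsWeakStarMeasurable.snd {a : T → 𝓜(ℂ, A)} (ha : IsWeakStarMeasurable ν a) (c : A) :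
    AEStronglyMeasurable (fun t => (a t).snd c) ν := by
  refine aestronglyMeasurable_of_forall_dual fun ψ => ?_
  simpa only [extend_comp_mul_left] using ha (ψ.comp (ContinuousLinearMap.mul ℂ A c))

theorem IsWeakStarMeasurable.fst_apply {a : T → 𝓜(ℂ, A)} (ha : IsWeakStarMeasurable ν a)
    {g : T → A} (hg : AEStronglyMeasurable g ν) :
    AEStronglyMeasurable (fun t => (a t).fst (g t)) ν := by
  obtain ⟨g', hg', hgg'⟩ := hg
  refine AEStronglyMeasurable.congr ?_ (hgg'.mono fun t ht => congrArg (a t).fst ht.symm)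
  refine aestronglyMeasurable_of_tendsto_ae atTop (f := fun k t => (a t).fst (hg'.approx k t))
    (fun k => ?_) (Eventually.of_forall fun t =>
      ((a t).fst.continuous.tendsto _).comp (hg'.tendsto_approx t))
  set s := hg'.approx k
  have h : (fun t => (a t).fst (s t)) =
      ∑ y ∈ s.range, (s ⁻¹' {y}).indicator fun t => (a t).fst y := by
    ext t
    rw [Finset.sum_apply, Finset.sum_eq_single (s t)]
    · simp
    · intro y _ hy
      exact Set.indicator_of_notMem (fun h => hy h.symm) _
    · intro h
      exact absurd (s.mem_range_self t) h
  rw [h]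
  exact Finset.aestronglyMeasurable_sum _ fun y _ => (ha.fst y).indicator (s.measurableSet_fiber y)

theorem IsWeakStarMeasurable.mul {a b : T → 𝓜(ℂ, A)} (ha : IsWeakStarMeasurable ν a)
    (hb : IsWeakStarMeasurable ν b) : IsWeakStarMeasurable ν fun t => a t * b t := by
  refine isWeakStarMeasurable_of_fst fun c => ?_
  simp only [DoubleCentralizer.mul_fst]
  exact ha.fst_apply (hb.fst c)

theorem IsWeakStarMeasurable.star {a : T → 𝓜(ℂ, A)} (ha : IsWeakStarMeasurable ν a) :
    IsWeakStarMeasurable ν fun t => star (a t) := by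
  refine isWeakStarMeasurable_of_fst fun c => ?_
  simp only [DoubleCentralizer.star_fst]
  exact (ha.snd _).star

theorem IsWeakStarMeasurable.pow {a : T → 𝓜(ℂ, A)} (ha : IsWeakStarMeasurable ν a) (k : ℕ) :
    IsWeakStarMeasurable ν fun t => a t ^ k := by
  induction k with
  | zero => simpa using isWeakStarMeasurable_const 1
  | succ k ih => simpa only [pow_succ] using ih.mul ha

end WeakStarMeasurable

section Positive

variable {A : Type*} [NonUnitalCStarAlgebra A] [PartialOrder A] [StarOrderedRing A]

/-- Positive multipliers. -/
def IsPositive (m : 𝓜(ℂ, A)) : Prop := ∃ d : 𝓜(ℂ, A), m = star d * d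

theorem IsPositive.isSelfAdjoint {m : 𝓜(ℂ, A)} (h : IsPositive m) : IsSelfAdjoint m := by
  obtain ⟨d, rfl⟩ := h
  exact IsSelfAdjoint.star_mul_self d

theorem IsPositive.nonneg {m : 𝓜(ℂ, A)} (h : IsPositive m) (c : A) : 0 ≤ star c * m.fst c := by
  obtain ⟨d, rfl⟩ := h
  rw [← star_fst_mul_fst]
  exact star_mul_self_nonneg _

theorem isPositive_of_nonneg {m : 𝓜(ℂ, A)} (hm : IsSelfAdjoint m)
    (h : ∀ c, 0 ≤ star c * m.fst c) : IsPositive m := by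
  let _ := CStarAlgebra.spectralOrder 𝓜(ℂ, A)
  have := CStarAlgebra.spectralOrderedRing 𝓜(ℂ, A)
  set p := m⁻ with hp
  have hp0 : 0 ≤ p := CFC.negPart_nonneg m
  have hps : star p = p := (IsSelfAdjoint.of_nonneg hp0).star_eq
  obtain ⟨q, hq⟩ := CStarAlgebra.nonneg_iff_eq_star_mul_self.mp hp0
  have h1 : star p * m * p = - (star (q * p) * (q * p)) := by
    have h2 : m⁺ * p = 0 := CFC.posPart_mul_negPart m
    have h3 : m * p = - (p * p) := by
      conv_lhs => rw [← CFC.posPart_sub_negPart m hm, ← hp, sub_mul, h2, zero_sub]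
    rw [mul_assoc, h3, star_mul, mul_assoc, ← mul_assoc (star q), ← hq, mul_neg]
  have h2 : ∀ c, (q * p).fst c = 0 := by
    intro c
    have h3 := h (p.fst c)
    rw [← star_conj_fst, h1, DoubleCentralizer.neg_fst] at h3
    have h4 : star ((q * p).fst c) * (q * p).fst c ≤ 0 := by
      rw [star_fst_mul_fst]
      simpa using h3
    exact CStarRing.star_mul_self_eq_zero_iff _ |>.mp (le_antisymm h4 (star_mul_self_nonneg _))
  have h3 : q * p = 0 := multiplier_ext fun c => by rw [h2 c]; rfl
  have h4 : p * p = 0 := by rw [hq, ← hq, hq, mul_assoc, ← hq, h3, mul_zero]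
  have h5 : p = 0 := by
    rw [← CStarRing.star_mul_self_eq_zero_iff, hps, h4]
  have h6 : 0 ≤ m := by rwa [← CFC.negPart_eq_zero_iff m hm]
  exact CStarAlgebra.nonneg_iff_eq_star_mul_self.mp h6

theorem IsPositive.conj {m : 𝓜(ℂ, A)} (hm : IsPositive m) (a : 𝓜(ℂ, A)) :
    IsPositive (star a * m * a) := by
  obtain ⟨d, rfl⟩ := hm
  exact ⟨d * a, by simp only [star_mul, mul_assoc]⟩

theorem isPositive_add_norm {m : 𝓜(ℂ, A)} (hm : IsSelfAdjoint m) {R : ℝ} (hR : ‖m‖ ≤ R) :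
    IsPositive (m + (R : ℂ) • (1 : 𝓜(ℂ, A))) := by
  let _ := CStarAlgebra.spectralOrder 𝓜(ℂ, A)
  have := CStarAlgebra.spectralOrderedRing 𝓜(ℂ, A)
  refine CStarAlgebra.nonneg_iff_eq_star_mul_self.mp ?_
  have h1 := hm.neg_algebraMap_norm_le_self
  have h2 : algebraMap ℝ 𝓜(ℂ, A) ‖m‖ ≤ algebraMap ℝ 𝓜(ℂ, A) R :=
    algebraMap_mono _ hR
  have h3 : (R : ℂ) • (1 : 𝓜(ℂ, A)) = algebraMap ℝ 𝓜(ℂ, A) R := by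
    rw [Algebra.algebraMap_eq_smul_one]; rfl
  rw [h3, ← neg_le_iff_add_nonneg]
  exact (neg_le_neg h2).trans h1

theorem isPositive_norm_sub {m : 𝓜(ℂ, A)} (hm : IsSelfAdjoint m) {R : ℝ} (hR : ‖m‖ ≤ R) :
    IsPositive ((R : ℂ) • (1 : 𝓜(ℂ, A)) - m) := by
  have := isPositive_add_norm hm.neg (R := R) (by rwa [norm_neg])
  rwa [neg_add_eq_sub] at this

theorem IsPositive.norm_fst_sq_le {m : 𝓜(ℂ, A)} (hm : IsPositive m) (c : A) :
    ‖m.fst c‖ ^ 2 ≤ ‖m‖ * ‖star c * m.fst c‖ := by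
  obtain ⟨s, rfl⟩ := hm
  rw [← star_fst_mul_fst, CStarRing.norm_star_mul_self, CStarRing.norm_star_mul_self]
  have h1 : ‖(star s * s).fst c‖ ≤ ‖s‖ * ‖s.fst c‖ := by
    rw [DoubleCentralizer.mul_fst]
    refine ((star s).fst.le_opNorm _).trans (le_of_eq ?_)
    rw [DoubleCentralizer.norm_fst, norm_star]
    rfl
  calc _ ≤ (‖s‖ * ‖s.fst c‖) ^ 2 := pow_le_pow_left₀ (norm_nonneg _) h1 2
    _ = _ := by ring

theorem IsPositive.norm_le {m : 𝓜(ℂ, A)} (hm : IsPositive m) {R : ℝ} (hR : 0 ≤ R)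
    (h : ∀ c, ‖star c * m.fst c‖ ≤ R * ‖c‖ ^ 2) : ‖m‖ ≤ R := by
  have h1 : ∀ c, ‖m.fst c‖ ^ 2 ≤ ‖m‖ * (R * ‖c‖ ^ 2) := fun c =>
    (hm.norm_fst_sq_le c).trans (mul_le_mul_of_nonneg_left (h c) (norm_nonneg _))
  have h2 : ‖m‖ ≤ Real.sqrt (‖m‖ * R) := by
    rw [← DoubleCentralizer.norm_fst]
    refine ContinuousLinearMap.opNorm_le_bound _ (Real.sqrt_nonneg _) fun c => ?_
    rw [DoubleCentralizer.norm_fst]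
    refine le_of_sq_le_sq ?_ (by positivity)
    rw [mul_pow, Real.sq_sqrt (by positivity), mul_assoc]
    exact h1 c
  rw [Real.le_sqrt (norm_nonneg _) (by positivity)] at h2
  rcases (norm_nonneg m).eq_or_lt with h0 | h0
  · rw [← h0]; exact hR
  · nlinarith

theorem star_mul_fst_le {m : 𝓜(ℂ, A)} {R : ℝ}
    (h1 : IsPositive ((R : ℂ) • (1 : 𝓜(ℂ, A)) - m)) (c : A) :
    star c * m.fst c ≤ (R : ℂ) • (star c * c) := by
  have h2 := h1.nonneg c
  rw [DoubleCentralizer.sub_fst, DoubleCentralizer.smul_fst, DoubleCentralizer.one_fst] at h2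
  simpa [mul_sub, mul_smul_comm] using h2

theorem norm_le_of_isPositive {m : 𝓜(ℂ, A)} (h0 : IsPositive m) {R : ℝ} (hR : 0 ≤ R)
    (h1 : IsPositive ((R : ℂ) • (1 : 𝓜(ℂ, A)) - m)) : ‖m‖ ≤ R := by
  refine h0.norm_le hR fun c => ?_
  refine (CStarAlgebra.norm_le_norm_of_nonneg_of_le (h0.nonneg c)
    (star_mul_fst_le h1 c)).trans (le_of_eq ?_)
  rw [norm_smul, Complex.norm_real, Real.norm_of_nonneg hR, CStarRing.norm_star_mul_self, sq]

end Positive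

section Dini

variable {A : Type*} [NonUnitalCStarAlgebra A] [PartialOrder A] [StarOrderedRing A]

theorem mem_of_tendsto_dual {C : Set A} (hC : Convex ℝ C) (hcl : IsClosed C) {H : ℕ → A} {d : A}
    (hH : ∀ᶠ k in atTop, H k ∈ C)
    (h : ∀ ψ : A →L[ℂ] ℂ, Tendsto (fun k => ψ (H k)) atTop (𝓝 (ψ d))) : d ∈ C := by
  by_contra hd
  obtain ⟨ψ, u, h1, h2⟩ := RCLike.geometric_hahn_banach_closed_point (𝕜 := ℂ) hC hcl hd
  have h3 : Tendsto (fun k => (ψ (H k)).re) atTop (𝓝 (ψ d).re) :=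
    (Complex.continuous_re.tendsto _).comp (h ψ)
  exact absurd (le_of_tendsto h3 (hH.mono fun k hk => (h1 _ hk).le)) (not_le.mpr h2)

/-- An increasing sequence in a C*-algebra which converges weakly converges in norm. -/
theorem tendsto_of_monotone_of_tendsto_dual {H : ℕ → A} {d : A} (hH : Monotone H)
    (h : ∀ ψ : A →L[ℂ] ℂ, Tendsto (fun k => ψ (H k)) atTop (𝓝 (ψ d))) :
    Tendsto H atTop (𝓝 d) ∧ ∀ k, H k ≤ d := by
  have hle : ∀ k, H k ≤ d := fun k =>
    mem_of_tendsto_dual (convex_Ici (𝕜 := ℝ) (H k)) isClosed_Ici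
      ((eventually_ge_atTop k).mono fun l hl => hH hl) h
  refine ⟨?_, hle⟩
  have hcl : d ∈ closure (convexHull ℝ (Set.range H)) :=
    mem_of_tendsto_dual (convex_convexHull ℝ _).closure isClosed_closure
      (Eventually.of_forall fun k => subset_closure (subset_convexHull ℝ _ ⟨k, rfl⟩)) h
  have hsub : convexHull ℝ (Set.range H) ⊆ ⋃ k, Set.Iic (H k) := by
    refine convexHull_min ?_ ?_
    · rintro _ ⟨k, rfl⟩
      exact Set.mem_iUnion.mpr ⟨k, le_rfl⟩
    · refine Directed.convex_iUnion ?_ fun k => convex_Iic (𝕜 := ℝ) (H k)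
      exact (show Monotone fun k => Set.Iic (H k) from
        fun k l hkl => Set.Iic_subset_Iic.mpr (hH hkl)).directed_le
  rw [Metric.tendsto_atTop]
  intro ε hε
  obtain ⟨y, hy, hyd⟩ := Metric.mem_closure_iff.mp hcl ε hε
  obtain ⟨N, hN⟩ := Set.mem_iUnion.mp (hsub hy)
  refine ⟨N, fun k hk => ?_⟩
  rw [dist_comm, dist_eq_norm]
  rw [dist_eq_norm] at hyd
  refine lt_of_le_of_lt ?_ hyd
  exact CStarAlgebra.norm_le_norm_of_nonneg_of_le (sub_nonneg.mpr (hle k))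
    (sub_le_sub_left (le_trans hN (hH hk)) d)

end Dini

section BoundedFields

variable {A : Type*} [NonUnitalCStarAlgebra A] [PartialOrder A] [StarOrderedRing A]
  [TopologicalSpace.SeparableSpace A] {T : Type*} [MeasurableSpace T] {ν : Measure T}

theorem integrable_fst [IsFiniteMeasure ν] {b : T → 𝓜(ℂ, A)} (hb : IsWeakStarMeasurable ν b)
    {K : ℝ} (hK : ∀ᵐ t ∂ν, ‖b t‖ ≤ K) (c : A) : Integrable (fun t => (b t).fst c) ν := by
  refine Integrable.of_bound (hb.fst c) (K * ‖c‖) (hK.mono fun t ht => ?_)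
  refine ((b t).fst.le_opNorm c).trans (mul_le_mul_of_nonneg_right ?_ (norm_nonneg _))
  rwa [DoubleCentralizer.norm_fst]

theorem integrable_snd [IsFiniteMeasure ν] {b : T → 𝓜(ℂ, A)} (hb : IsWeakStarMeasurable ν b)
    {K : ℝ} (hK : ∀ᵐ t ∂ν, ‖b t‖ ≤ K) (c : A) : Integrable (fun t => (b t).snd c) ν := by
  refine Integrable.of_bound (hb.snd c) (K * ‖c‖) (hK.mono fun t ht => ?_)
  refine ((b t).snd.le_opNorm c).trans (mul_le_mul_of_nonneg_right ?_ (norm_nonneg _))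
  rwa [DoubleCentralizer.norm_snd]

/-- A bounded weak*-measurable field on a finite measure space has a strict integral. -/
theorem exists_integral_of_bounded [IsFiniteMeasure ν] {b : T → 𝓜(ℂ, A)}
    (hb : IsWeakStarMeasurable ν b) {K : ℝ} (hK : ∀ᵐ t ∂ν, ‖b t‖ ≤ K) :
    ∃ B : 𝓜(ℂ, A), (∀ c, B.fst c = ∫ t, (b t).fst c ∂ν) ∧
      (∀ c, B.snd c = ∫ t, (b t).snd c ∂ν) ∧
      ∀ ψ : A →L[ℂ] ℂ, Integrable (fun t => extend ψ (b t)) ν ∧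
        extend ψ B = ∫ t, extend ψ (b t) ∂ν := by
  have h1 := integrable_fst hb hK
  have h2 := integrable_snd hb hK
  have hbd : ∀ {g : T → A →L[ℂ] A} (hg : ∀ᵐ t ∂ν, ‖g t‖ ≤ K) (c : A),
      ‖∫ t, g t c ∂ν‖ ≤ (K * ν.real Set.univ) * ‖c‖ := by
    intro g hg c
    refine (norm_integral_le_of_norm_le_const (C := K * ‖c‖) (hg.mono fun t ht => ?_)).trans
      (le_of_eq (by ring))
    exact ((g t).le_opNorm c).trans (mul_le_mul_of_nonneg_right ht (norm_nonneg _))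
  let L : A →L[ℂ] A := LinearMap.mkContinuous
    { toFun := fun c => ∫ t, (b t).fst c ∂ν
      map_add' := fun c d => by simp only [map_add]; exact integral_add (h1 c) (h1 d)
      map_smul' := fun z c => by
        simp only [map_smul, RingHom.id_apply]; exact integral_smul z _ }
    (K * ν.real Set.univ) (hbd (hK.mono fun t ht => by rwa [DoubleCentralizer.norm_fst]))
  let R : A →L[ℂ] A := LinearMap.mkContinuous
    { toFun := fun c => ∫ t, (b t).snd c ∂ν
      map_add' := fun c d => by simp only [map_add]; exact integral_add (h2 c) (h2 d)
      map_smul' := fun z c => by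
        simp only [map_smul, RingHom.id_apply]; exact integral_smul z _ }
    (K * ν.real Set.univ) (hbd (hK.mono fun t ht => by rwa [DoubleCentralizer.norm_snd]))
  let B : 𝓜(ℂ, A) := ⟨(L, R), fun x y => by
    change (∫ t, (b t).snd x ∂ν) * y = x * ∫ t, (b t).fst y ∂ν
    have h3 := ((ContinuousLinearMap.mul ℂ A).flip y).integral_comp_comm (h2 x)
    have h4 := (ContinuousLinearMap.mul ℂ A x).integral_comp_comm (h1 y)
    simp only [ContinuousLinearMap.flip_apply, ContinuousLinearMap.mul_apply'] at h3 h4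
    rw [← h3, ← h4]
    simp only [DoubleCentralizer.central]⟩
  refine ⟨B, fun c => rfl, fun c => rfl, fun ψ => ⟨?_, ?_⟩⟩
  · refine Integrable.of_bound (hb ψ).aestronglyMeasurable (‖ψ‖ * K) (hK.mono fun t ht => ?_)
    exact (norm_extend_le ψ _).trans (mul_le_mul_of_nonneg_left ht (norm_nonneg _))
  · obtain ⟨f, hf, hfb⟩ := exists_seq_tendsto_extend ψ
    refine tendsto_nhds_unique (hf B) ?_
    have h3 : ∀ k, ψ (B.fst (f k)) = ∫ t, ψ ((b t).fst (f k)) ∂ν := fun k =>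
      (ψ.integral_comp_comm (h1 (f k))).symm
    simp only [h3]
    refine tendsto_integral_of_dominated_convergence (fun _ => (‖ψ‖ + 1) * K)
      (fun k => ψ.continuous.comp_aestronglyMeasurable (hb.fst _)) (integrable_const _)
      (fun k => hK.mono fun t ht => (hfb k (b t)).trans ?_)
      (Eventually.of_forall fun t => hf (b t))
    exact mul_le_mul_of_nonneg_left ht (by positivity)

theorem integral_norm_le_of_forall_abs_setIntegral_le {u : T → ℝ} (hu : Integrable u ν) {M : ℝ}
    (h : ∀ E, MeasurableSet E → |∫ t in E, u t ∂ν| ≤ M) : ∫ t, ‖u t‖ ∂ν ≤ 2 * M := by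
  obtain ⟨v, hv, huv⟩ := hu.1
  have hE : MeasurableSet {t | 0 ≤ v t} := measurableSet_le measurable_const hv.measurable
  have h1 : ∫ t in {t | 0 ≤ v t}, ‖u t‖ ∂ν = ∫ t in {t | 0 ≤ v t}, u t ∂ν := by
    refine setIntegral_congr_ae hE ?_
    filter_upwards [huv] with t ht h0
    change 0 ≤ v t at h0
    rw [← ht] at h0
    exact Real.norm_of_nonneg h0
  have h2 : ∫ t in {t | 0 ≤ v t}ᶜ, ‖u t‖ ∂ν = - ∫ t in {t | 0 ≤ v t}ᶜ, u t ∂ν := by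
    rw [← integral_neg]
    refine setIntegral_congr_ae hE.compl ?_
    filter_upwards [huv] with t ht h0
    have h0 : ¬ 0 ≤ v t := h0
    rw [not_le, ← ht] at h0
    exact Real.norm_of_nonpos h0.le
  rw [← integral_add_compl hE hu.norm, h1, h2]
  have h3 := abs_le.mp (h _ hE)
  have h4 := abs_le.mp (h _ hE.compl)
  linarith

theorem integral_norm_le_of_forall_norm_setIntegral_le {g : T → ℂ} (hg : Integrable g ν) {M : ℝ}
    (h : ∀ E, MeasurableSet E → ‖∫ t in E, g t ∂ν‖ ≤ M) : ∫ t, ‖g t‖ ∂ν ≤ 4 * M := by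
  have h1 := integral_norm_le_of_forall_abs_setIntegral_le hg.re (M := M) fun E hE => by
    have h2 : ∫ t in E, RCLike.re (g t) ∂ν = RCLike.re (∫ t in E, g t ∂ν) :=
      integral_re hg.integrableOn
    rw [h2]
    exact (RCLike.abs_re_le_norm _).trans (h E hE)
  have h2 := integral_norm_le_of_forall_abs_setIntegral_le hg.im (M := M) fun E hE => by
    have h2 : ∫ t in E, RCLike.im (g t) ∂ν = RCLike.im (∫ t in E, g t ∂ν) :=
      integral_im hg.integrableOn
    rw [h2]
    exact (RCLike.abs_im_le_norm _).trans (h E hE)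
  have h3 : ∫ t, ‖g t‖ ∂ν ≤ ∫ t, (‖RCLike.re (g t)‖ + ‖RCLike.im (g t)‖) ∂ν :=
    integral_mono hg.norm (hg.re.norm.add hg.im.norm) fun t => Complex.norm_le_abs_re_add_abs_im _
  rw [integral_add hg.re.norm hg.im.norm] at h3
  linarith

end BoundedFields

section Exhaustion

variable {A : Type*} [NonUnitalCStarAlgebra A] [PartialOrder A] [StarOrderedRing A]
  {T : Type*} [MeasurableSpace T] {ν : Measure T}

theorem extend_conj (ψ : A →L[ℂ] ℂ) (c : A) (m : 𝓜(ℂ, A)) :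
    extend ((ψ.comp (ContinuousLinearMap.mul ℂ A (star c))).comp
      ((ContinuousLinearMap.mul ℂ A).flip c)) m = ψ (star c * m.fst c) := by
  rw [extend_comp_mul_right]
  rfl

theorem IsUnitalColumnField.integrable_apply {a : T → 𝓜(ℂ, A)} (ha : IsUnitalColumnField ν a)
    (ψ : A →L[ℂ] ℂ) (c : A) :
    Integrable (fun t => ψ (star ((a t).fst c) * (a t).fst c)) ν ∧
      ∫ t, ψ (star ((a t).fst c) * (a t).fst c) ∂ν = ψ (star c * c) := by
  have h := ha.2.integral_eq ((ψ.comp (ContinuousLinearMap.mul ℂ A (star c))).comp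
    ((ContinuousLinearMap.mul ℂ A).flip c))
  simp only [extend_conj, ← star_fst_mul_fst] at h
  exact h

theorem norm_le_of_denseRange {m : 𝓜(ℂ, A)} {c : ℕ → A} (hc : DenseRange c) {K : ℝ} (hK : 0 ≤ K)
    (h : ∀ j, ‖m.fst (c j)‖ ≤ K * ‖c j‖) : ‖m‖ ≤ K := by
  rw [← DoubleCentralizer.norm_fst]
  refine ContinuousLinearMap.opNorm_le_bound _ hK fun x => ?_
  exact hc.induction_on (p := fun x => ‖m.fst x‖ ≤ K * ‖x‖) x
    (isClosed_le m.fst.continuous.norm (continuous_const.mul continuous_norm)) h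

variable [TopologicalSpace.SeparableSpace A]

/-- A unital column field is exhausted by sets of finite measure on which it is bounded. -/
theorem IsUnitalColumnField.exists_exhaustion {a : T → 𝓜(ℂ, A)} (ha : IsUnitalColumnField ν a) :
    ∃ U : ℕ → Set T, Monotone U ∧ (∀ k, MeasurableSet (U k)) ∧ (∀ k, ν (U k) < ∞) ∧
      (∀ᵐ t ∂ν, ∀ k, t ∈ U k → ‖a t‖ ≤ k) ∧ ∀ᵐ t ∂ν, t ∉ ⋃ k, U k → a t = 0 := by
  obtain ⟨ψ, hψ⟩ := exists_separating_seq A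
  set c := TopologicalSpace.denseSeq A
  have hc : DenseRange c := TopologicalSpace.denseRange_denseSeq A
  have hF := fun j n => (ha.integrable_apply (ψ n) (c j)).1
  choose F' hF'm hF' using fun j n => (hF j n).1
  have hF'i : ∀ j n, Integrable (F' j n) ν := fun j n => (hF j n).congr (hF' j n)
  choose g hgm hg using fun j => ha.1.fst (c j)
  let V : ℕ → Set T := fun k => ⋃ j ∈ Finset.range k, ⋃ n ∈ Finset.range k,
    {t | 1 / ((k : ℝ) + 1) ≤ ‖F' j n t‖}
  let W : ℕ → Set T := fun k => ⋂ j, {t | ‖g j t‖ ≤ k * ‖c j‖}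
  have hV : ∀ k, MeasurableSet (V k) := fun k =>
    Finset.measurableSet_biUnion _ fun j _ => Finset.measurableSet_biUnion _ fun n _ =>
      measurableSet_le measurable_const (hF'm j n).measurable.norm
  have hW : ∀ k, MeasurableSet (W k) := fun k => MeasurableSet.iInter fun j =>
    measurableSet_le (hgm j).norm.measurable measurable_const
  have hVfin : ∀ k, ν (V k) < ∞ := fun k => by
    refine measure_biUnion_lt_top (Finset.finite_toSet _) fun j _ => ?_
    refine measure_biUnion_lt_top (Finset.finite_toSet _) fun n _ => ?_
    exact (hF'i j n).measure_norm_ge_lt_top (by positivity)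
  have hVmem : ∀ k t, t ∈ V k ↔ ∃ j < k, ∃ n < k, 1 / ((k : ℝ) + 1) ≤ ‖F' j n t‖ := fun k t => by
    simp [V]
  have hWmem : ∀ k t, t ∈ W k ↔ ∀ j, ‖g j t‖ ≤ k * ‖c j‖ := fun k t => by simp [W]
  refine ⟨fun k => V k ∩ W k, ?_, fun k => (hV k).inter (hW k),
    fun k => (measure_mono Set.inter_subset_left).trans_lt (hVfin k), ?_, ?_⟩
  · intro k l hkl t ht
    have hkl' : (k : ℝ) ≤ l := by exact_mod_cast hkl
    obtain ⟨h1, h2⟩ := ht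
    rw [hVmem] at h1
    rw [hWmem] at h2
    obtain ⟨j, hj, n, hn, h⟩ := h1
    refine ⟨(hVmem l t).mpr ⟨j, hj.trans_le hkl, n, hn.trans_le hkl, le_trans ?_ h⟩,
      (hWmem l t).mpr fun j => (h2 j).trans ?_⟩
    · exact one_div_le_one_div_of_le (by positivity) (by linarith)
    · exact mul_le_mul_of_nonneg_right hkl' (norm_nonneg _)
  · filter_upwards [ae_all_iff.mpr hg] with t ht k hk
    refine norm_le_of_denseRange hc (Nat.cast_nonneg k) fun j => ?_
    rw [ht j]
    exact (hWmem k t).mp hk.2 j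
  · filter_upwards [ae_all_iff.mpr hg, ae_all_iff.mpr fun j => ae_all_iff.mpr (hF' j)]
      with t ht htF htU
    obtain ⟨K, hK⟩ := exists_nat_ge ‖a t‖
    have hWt : ∀ k, K ≤ k → t ∈ W k := fun k hk => (hWmem k t).mpr fun j => by
      rw [← ht j]
      refine ((a t).fst.le_opNorm _).trans (mul_le_mul_of_nonneg_right ?_ (norm_nonneg _))
      rw [DoubleCentralizer.norm_fst]
      exact hK.trans (by exact_mod_cast hk)
    have hzero : ∀ j n, F' j n t = 0 := by
      intro j n
      have hlim := tendsto_one_div_add_atTop_nhds_zero_nat (𝕜 := ℝ)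
      have hev : ∀ᶠ k : ℕ in atTop, ‖F' j n t‖ ≤ 1 / ((k : ℝ) + 1) := by
        filter_upwards [eventually_ge_atTop K, eventually_gt_atTop j, eventually_gt_atTop n]
          with k h1 h2 h3
        by_contra! h
        exact htU (Set.mem_iUnion.mpr ⟨k, (hVmem k t).mpr ⟨j, h2, n, h3, h.le⟩, hWt k h1⟩)
      exact norm_le_zero_iff.mp (ge_of_tendsto hlim hev)
    have hac : ∀ j, (a t).fst (c j) = 0 := by
      intro j
      refine CStarRing.star_mul_self_eq_zero_iff _ |>.mp (hψ _ fun n => ?_)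
      rw [htF j n, hzero j n]
    rw [← norm_le_zero_iff]
    exact norm_le_of_denseRange hc le_rfl fun j => by simp [hac j]

end Exhaustion

section Existence

variable {A : Type*} [NonUnitalCStarAlgebra A] [PartialOrder A] [StarOrderedRing A]
  {T : Type*} [MeasurableSpace T] {ν : Measure T}

theorem HasCStarIntegral.congr {b b' : T → 𝓜(ℂ, A)} {B : 𝓜(ℂ, A)} (h : HasCStarIntegral ν b B)
    (hb : b =ᵐ[ν] b') : HasCStarIntegral ν b' B := by
  have hψ : ∀ ψ : A →L[ℂ] ℂ, (fun t => extend ψ (b t)) =ᵐ[ν] fun t => extend ψ (b' t) :=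
    fun ψ => hb.mono fun t ht => by simp only [ht]
  obtain ⟨K, hK⟩ := h.bounded
  refine ⟨h.measurable.congr hb, ⟨K, fun ψ hs => ⟨(hK ψ hs).1.congr (hψ ψ), ?_⟩⟩, fun ψ =>
    ⟨(h.integral_eq ψ).1.congr (hψ ψ), ?_⟩⟩
  · rw [← integral_congr_ae ((hψ ψ).mono fun t ht => congrArg norm ht)]
    exact (hK ψ hs).2
  · rw [← integral_congr_ae (hψ ψ)]
    exact (h.integral_eq ψ).2

theorem HasCStarIntegral.sub {b b' : T → 𝓜(ℂ, A)} {B B' : 𝓜(ℂ, A)}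
    (h : HasCStarIntegral ν b B) (h' : HasCStarIntegral ν b' B') :
    HasCStarIntegral ν (fun t => b t - b' t) (B - B') := by
  obtain ⟨K, hK⟩ := h.bounded
  obtain ⟨K', hK'⟩ := h'.bounded
  refine ⟨h.measurable.sub h'.measurable, ⟨K + K', fun ψ hs => ?_⟩, fun ψ => ?_⟩
  · simp only [extend_sub]
    have h1 := (hK ψ hs).1
    have h2 := (hK' ψ hs).1
    refine ⟨h1.sub h2, ?_⟩
    have h3 := integral_mono (h1.sub h2).norm (h1.norm.add h2.norm) fun t => norm_sub_le _ _
    rw [Pi.add_def, integral_add h1.norm h2.norm] at h3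
    exact h3.trans (add_le_add (hK ψ hs).2 (hK' ψ hs).2)
  · simp only [extend_sub]
    have h1 := h.integral_eq ψ
    have h2 := h'.integral_eq ψ
    exact ⟨h1.1.sub h2.1, by rw [integral_sub h1.1 h2.1, h1.2, h2.2]⟩

theorem HasCStarIntegral.smul {b : T → 𝓜(ℂ, A)} {B : 𝓜(ℂ, A)}
    (h : HasCStarIntegral ν b B) (c : ℂ) : HasCStarIntegral ν (fun t => c • b t) (c • B) := by
  obtain ⟨K, hK⟩ := h.bounded
  refine ⟨h.measurable.smul c, ⟨‖c‖ * K, fun ψ hs => ?_⟩, fun ψ => ?_⟩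
  · simp only [extend_smul]
    refine ⟨(hK ψ hs).1.const_mul c, ?_⟩
    simp only [norm_mul]
    rw [integral_const_mul]
    exact mul_le_mul_of_nonneg_left (hK ψ hs).2 (norm_nonneg c)
  · simp only [extend_smul]
    have h1 := h.integral_eq ψ
    exact ⟨h1.1.const_mul c, by rw [integral_const_mul, h1.2]⟩

theorem HasCStarIntegral.add {b b' : T → 𝓜(ℂ, A)} {B B' : 𝓜(ℂ, A)}
    (h : HasCStarIntegral ν b B) (h' : HasCStarIntegral ν b' B') :
    HasCStarIntegral ν (fun t => b t + b' t) (B + B') := by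
  simpa using h.sub (h'.smul (-1))

/-- A strictly Cauchy sequence of multipliers converges strictly. -/
theorem exists_strict_limit {B : ℕ → 𝓜(ℂ, A)}
    (h1 : ∀ c, CauchySeq fun k => (B k).fst c) (h2 : ∀ c, CauchySeq fun k => (B k).snd c) :
    ∃ b : 𝓜(ℂ, A), ∀ c, Tendsto (fun k => (B k).fst c) atTop (𝓝 (b.fst c)) := by
  choose L hL using fun c => cauchySeq_tendsto_of_complete (h1 c)
  choose R hR using fun c => cauchySeq_tendsto_of_complete (h2 c)
  refine ⟨⟨(continuousLinearMapOfTendsto (fun k => (B k).fst) (tendsto_pi_nhds.mpr hL),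
    continuousLinearMapOfTendsto (fun k => (B k).snd) (tendsto_pi_nhds.mpr hR)), fun x y => ?_⟩,
    hL⟩
  change R x * y = x * L y
  refine tendsto_nhds_unique ((hR x).mul_const y) ?_
  simp only [DoubleCentralizer.central]
  exact (hL y).const_mul x

variable [TopologicalSpace.SeparableSpace A]

theorem integral_fst_isPositive [IsFiniteMeasure ν] {b : T → 𝓜(ℂ, A)}
    (hb : IsWeakStarMeasurable ν b) {K : ℝ} (hK : ∀ᵐ t ∂ν, ‖b t‖ ≤ K)
    (hpos : ∀ᵐ t ∂ν, IsPositive (b t)) {B : 𝓜(ℂ, A)} (h1 : ∀ c, B.fst c = ∫ t, (b t).fst c ∂ν)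
    (h2 : ∀ c, B.snd c = ∫ t, (b t).snd c ∂ν) : IsPositive B := by
  refine isPositive_of_nonneg (multiplier_ext fun c => ?_) fun c => ?_
  · have h3 := (starL' ℝ : A ≃L[ℝ] A).toContinuousLinearMap.integral_comp_comm
      (integrable_snd hb hK (star c))
    rw [DoubleCentralizer.star_fst, h2, h1]
    refine h3.symm.trans ?_
    refine integral_congr_ae (hpos.mono fun t ht => ?_)
    change star ((b t).snd (star c)) = _
    rw [← DoubleCentralizer.star_fst, ht.isSelfAdjoint.star_eq]
  · have h3 := (ContinuousLinearMap.mul ℂ A (star c)).integral_comp_comm (integrable_fst hb hK c)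
    simp only [ContinuousLinearMap.mul_apply'] at h3
    rw [h1, ← h3]
    exact integral_nonneg_of_ae (hpos.mono fun t ht => ht.nonneg c)

/-- Existence of `∫ a_t* x_t a_t` for positive bounded fields. -/
theorem exists_hasCStarIntegral_of_isPositive {a x : T → 𝓜(ℂ, A)}
    (ha : IsUnitalColumnField ν a) (hx : IsWeakStarMeasurable ν x) {R : ℝ} (hR : 0 ≤ R)
    (h0 : ∀ᵐ t ∂ν, IsPositive (x t))
    (h1 : ∀ᵐ t ∂ν, IsPositive ((R : ℂ) • (1 : 𝓜(ℂ, A)) - x t)) :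
    ∃ b, HasCStarIntegral ν (fun t => star (a t) * x t * a t) b := by
  obtain ⟨U, hUm, hUmeas, hUfin, hUa, hU0⟩ := ha.exists_exhaustion
  set b : T → 𝓜(ℂ, A) := fun t => star (a t) * x t * a t with hb
  have hbm : IsWeakStarMeasurable ν b := (ha.1.star.mul hx).mul ha.1
  have hbpos : ∀ᵐ t ∂ν, IsPositive (b t) := h0.mono fun t ht => ht.conj _
  have hbb : ∀ k : ℕ, ∀ᵐ t ∂ν, t ∈ U k → ‖b t‖ ≤ k * R * k := by
    intro k
    filter_upwards [h0, h1, hUa] with t h0 h1 h2 ht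
    have h3 := h2 k ht
    have h4 := norm_le_of_isPositive h0 hR h1
    refine (norm_mul_le _ _).trans (mul_le_mul ((norm_mul_le _ _).trans
      (mul_le_mul ?_ h4 (norm_nonneg _) (Nat.cast_nonneg k))) h3 (norm_nonneg _) (by positivity))
    rwa [norm_star]
  have hle : ∀ c, ∀ᵐ t ∂ν, star c * (b t).fst c ≤
      (R : ℂ) • (star ((a t).fst c) * (a t).fst c) := by
    intro c
    filter_upwards [h1] with t h1
    rw [hb, star_conj_fst]
    exact star_mul_fst_le h1 _
  -- the quadratic forms of the column field
  set h : A → T → A := fun c t => star ((a t).fst c) * (a t).fst c with hh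
  have hhm : ∀ c, AEStronglyMeasurable (h c) ν := fun c => (ha.1.fst c).star.mul (ha.1.fst c)
  have hhi : ∀ c k, IntegrableOn (h c) (U k) ν := by
    intro c k
    refine Measure.integrableOn_of_bounded (M := (k * ‖c‖) * (k * ‖c‖)) (hUfin k).ne (hhm c) ?_
    rw [ae_restrict_iff' (hUmeas k)]
    filter_upwards [hUa] with t ht htk
    have h3 : ‖(a t).fst c‖ ≤ k * ‖c‖ := by
      refine ((a t).fst.le_opNorm c).trans (mul_le_mul_of_nonneg_right ?_ (norm_nonneg _))
      rw [DoubleCentralizer.norm_fst]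
      exact ht k htk
    rw [hh, CStarRing.norm_star_mul_self]
    exact mul_le_mul h3 h3 (norm_nonneg _) (by positivity)
  have hh0 : ∀ c t, 0 ≤ h c t := fun c t => star_mul_self_nonneg _
  let H : A → ℕ → A := fun c k => ∫ t in U k, h c t ∂ν
  have hHdiff : ∀ c k l, k ≤ l → ∫ t in U l \ U k, h c t ∂ν = H c l - H c k := fun c k l hkl =>
    setIntegral_sdiff (hUmeas k) (hhi c l) (hUm hkl)
  have hHmono : ∀ c, Monotone (H c) := by
    intro c k l hkl
    rw [← sub_nonneg, ← hHdiff c k l hkl]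
    exact integral_nonneg fun t => hh0 c t
  have hUlim : ∀ {g : T → ℂ}, Integrable g ν → (∀ᵐ t ∂ν, t ∉ ⋃ k, U k → g t = 0) →
      Tendsto (fun k => ∫ t in U k, g t ∂ν) atTop (𝓝 (∫ t, g t ∂ν)) := by
    intro g hg hg0
    rw [← setIntegral_eq_integral_of_ae_compl_eq_zero hg0]
    exact tendsto_setIntegral_of_monotone hUmeas hUm hg.integrableOn
  have hHlim : ∀ c, Tendsto (H c) atTop (𝓝 (star c * c)) ∧ ∀ k, H c k ≤ star c * c := by
    intro c
    refine tendsto_of_monotone_of_tendsto_dual (hHmono c) fun ψ => ?_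
    obtain ⟨h3, h4⟩ := ha.integrable_apply ψ c
    rw [← h4]
    have h5 : ∀ k, ψ (H c k) = ∫ t in U k, ψ (h c t) ∂ν := fun k =>
      (ψ.integral_comp_comm (hhi c k)).symm
    simp only [h5]
    refine hUlim h3 (hU0.mono fun t ht htU => ?_)
    simp only [hh, ht htU]
    simp
  -- integrals over sets where the column field is bounded
  have hE : ∀ E : Set T, MeasurableSet E → ∀ k, E ⊆ U k → ∃ B : 𝓜(ℂ, A),
      (∀ c, B.fst c = ∫ t in E, (b t).fst c ∂ν) ∧ (∀ c, B.snd c = ∫ t in E, (b t).snd c ∂ν) ∧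
      (∀ ψ : A →L[ℂ] ℂ, IntegrableOn (fun t => extend ψ (b t)) E ν ∧
        extend ψ B = ∫ t in E, extend ψ (b t) ∂ν) ∧ IsPositive B ∧
      (∀ c, ‖star c * B.fst c‖ ≤ R * ‖∫ t in E, h c t ∂ν‖) ∧ ‖B‖ ≤ R := by
    intro E hEm k hEk
    have : IsFiniteMeasure (ν.restrict E) :=
      ⟨by rw [Measure.restrict_apply_univ]; exact (measure_mono hEk).trans_lt (hUfin k)⟩
    have hb' : IsWeakStarMeasurable (ν.restrict E) b := hbm.mono_measure Measure.restrict_le_self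
    have hK : ∀ᵐ t ∂(ν.restrict E), ‖b t‖ ≤ k * R * k := by
      rw [ae_restrict_iff' hEm]
      exact (hbb k).mono fun t ht htE => ht (hEk htE)
    obtain ⟨B, hB1, hB2, hB3⟩ := exists_integral_of_bounded hb' hK
    have hBpos := integral_fst_isPositive hb' hK (ae_restrict_of_ae hbpos) hB1 hB2
    have hBc : ∀ c, ‖star c * B.fst c‖ ≤ R * ‖∫ t in E, h c t ∂ν‖ := by
      intro c
      have h3 := (ContinuousLinearMap.mul ℂ A (star c)).integral_comp_comm
        (integrable_fst hb' hK c)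
      simp only [ContinuousLinearMap.mul_apply'] at h3
      have h4 : star c * B.fst c ≤ (R : ℂ) • ∫ t in E, h c t ∂ν := by
        rw [hB1, ← h3, ← integral_smul]
        refine integral_mono_ae ?_ (((hhi c k).mono_set hEk).smul (R : ℂ))
          (ae_restrict_of_ae (hle c))
        exact (ContinuousLinearMap.mul ℂ A (star c)).integrable_comp (integrable_fst hb' hK c)
      refine (CStarAlgebra.norm_le_norm_of_nonneg_of_le (hBpos.nonneg c) h4).trans (le_of_eq ?_)
      rw [norm_smul, Complex.norm_real, Real.norm_of_nonneg hR]
    refine ⟨B, hB1, hB2, hB3, hBpos, hBc, hBpos.norm_le hR fun c => (hBc c).trans ?_⟩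
    refine mul_le_mul_of_nonneg_left ?_ hR
    have h4 : ∫ t in E, h c t ∂ν ≤ star c * c := by
      refine le_trans ?_ ((hHlim c).2 k)
      have h5 : (∫ t in U k \ E, h c t ∂ν) = H c k - ∫ t in E, h c t ∂ν :=
        setIntegral_sdiff hEm (hhi c k) hEk
      rw [← sub_nonneg, ← h5]
      exact integral_nonneg fun t => hh0 c t
    refine (CStarAlgebra.norm_le_norm_of_nonneg_of_le (integral_nonneg fun t => hh0 c t)
      h4).trans (le_of_eq ?_)
    rw [CStarRing.norm_star_mul_self, sq]
  choose B hB1 hB2 hB3 hBpos hBc hBn using fun k => hE (U k) (hUmeas k) k subset_rfl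
  -- the sequence is strictly Cauchy
  have hdist : ∀ c k l, k ≤ l → ‖(B l).fst c - (B k).fst c‖ ≤
      Real.sqrt (R * (R * ‖H c l - H c k‖)) := by
    intro c k l hkl
    obtain ⟨D, hD1, -, -, hDp, hDc, hDn⟩ := hE (U l \ U k) ((hUmeas l).diff (hUmeas k)) l
      Set.sdiff_subset
    have hfin : IsFiniteMeasure (ν.restrict (U l)) :=
      ⟨by rw [Measure.restrict_apply_univ]; exact hUfin l⟩
    have h3 : (B l).fst c - (B k).fst c = D.fst c := by
      rw [hB1, hB1, hD1]
      refine (setIntegral_sdiff (hUmeas k) ?_ (hUm hkl)).symm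
      refine integrable_fst (hbm.mono_measure Measure.restrict_le_self) (K := l * R * l) ?_ c
      rw [ae_restrict_iff' (hUmeas l)]
      exact hbb l
    rw [h3]
    refine Real.le_sqrt_of_sq_le ((hDp.norm_fst_sq_le c).trans ?_)
    refine mul_le_mul hDn ?_ (norm_nonneg _) hR
    rw [← hHdiff c k l hkl]
    exact hDc c
  have hcauchy : ∀ c, CauchySeq fun k => (B k).fst c := by
    intro c
    have hHc := (hHlim c).1.cauchySeq
    rw [Metric.cauchySeq_iff'] at hHc ⊢
    intro ε hε
    obtain ⟨N, hN⟩ := hHc (ε ^ 2 / (R * R + 1)) (by positivity)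
    refine ⟨N, fun k hk => ?_⟩
    have h3 := hN k hk
    rw [dist_eq_norm] at h3 ⊢
    refine (hdist c N k hk).trans_lt ?_
    rw [Real.sqrt_lt' hε]
    rw [lt_div_iff₀ (by positivity)] at h3
    nlinarith [norm_nonneg (H c k - H c N)]
  have hcauchy' : ∀ c, CauchySeq fun k => (B k).snd c := by
    intro c
    have h3 : ∀ k, (B k).snd c = star ((B k).fst (star c)) := by
      intro k
      rw [← DoubleCentralizer.star_snd, (hBpos k).isSelfAdjoint.star_eq]
    simp only [h3]
    exact star_isometry.uniformContinuous.comp_cauchySeq (hcauchy (star c))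
  obtain ⟨β, hβ⟩ := exists_strict_limit hcauchy hcauchy'
  have hint : ∀ ψ : A →L[ℂ] ℂ, Integrable (fun t => extend ψ (b t)) ν ∧
      ∫ t, ‖extend ψ (b t)‖ ∂ν ≤ 4 * (‖ψ‖ * R) := by
    intro ψ
    have hk : ∀ k, ∫ t in U k, ‖extend ψ (b t)‖ ∂ν ≤ 4 * (‖ψ‖ * R) := by
      intro k
      refine integral_norm_le_of_forall_norm_setIntegral_le (hB3 k ψ).1 fun E hEm => ?_
      rw [Measure.restrict_restrict hEm]
      obtain ⟨D, -, -, hD3, -, -, hDn⟩ := hE (E ∩ U k) (hEm.inter (hUmeas k)) k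
        Set.inter_subset_right
      rw [← (hD3 ψ).2]
      exact (norm_extend_le ψ D).trans (mul_le_mul_of_nonneg_left hDn (norm_nonneg _))
    have hz : ∀ᵐ t ∂ν, t ∉ ⋃ k, U k → extend ψ (b t) = 0 := by
      filter_upwards [hU0] with t ht htU
      rw [hb]
      simp only [ht htU, mul_zero]
      simpa using extend_smul ψ 0 0
    have hcov : AECover (ν.restrict (⋃ k, U k)) atTop U := by
      refine ⟨?_, hUmeas⟩
      rw [ae_restrict_iff' (MeasurableSet.iUnion hUmeas)]
      refine Eventually.of_forall fun t ht => ?_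
      obtain ⟨k, hk⟩ := Set.mem_iUnion.mp ht
      exact (eventually_ge_atTop k).mono fun l hl => hUm hl hk
    have hr : ∀ k, (ν.restrict (⋃ k, U k)).restrict (U k) = ν.restrict (U k) := fun k => by
      rw [Measure.restrict_restrict (hUmeas k), Set.inter_eq_left.mpr (Set.subset_iUnion U k)]
    have hi : IntegrableOn (fun t => extend ψ (b t)) (⋃ k, U k) ν := by
      refine hcov.integrable_of_integral_norm_bounded (4 * (‖ψ‖ * R)) (fun k => ?_)
        (Eventually.of_forall fun k => ?_)
      · rw [IntegrableOn, hr]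
        exact (hB3 k ψ).1
      · rw [hr]
        exact hk k
    refine ⟨hi.integrable_of_ae_notMem_eq_zero hz, ?_⟩
    have h3 := hcov.integral_tendsto_of_countably_generated hi.norm
    simp only [hr] at h3
    rw [← setIntegral_eq_integral_of_ae_compl_eq_zero (s := ⋃ k, U k)]
    · exact le_of_tendsto h3 (Eventually.of_forall hk)
    · filter_upwards [hz] with t ht htU
      rw [ht htU, norm_zero]
  refine ⟨β, hbm, ⟨4 * R, fun ψ hψ => ⟨(hint ψ).1, (hint ψ).2.trans ?_⟩⟩, fun ψ =>
    ⟨(hint ψ).1, ?_⟩⟩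
  · rw [hψ.2, one_mul]
  · refine tendsto_nhds_unique ?_ (tendsto_extend_of_strict ψ hBn hβ)
    simp only [fun k => (hB3 k ψ).2]
    refine hUlim (hint ψ).1 ?_
    filter_upwards [hU0] with t ht htU
    rw [hb]
    simp only [ht htU, mul_zero]
    simpa using extend_smul ψ 0 0

/-- Existence of `∫ a_t* x_t a_t` for essentially bounded self-adjoint fields. -/
theorem exists_hasCStarIntegral {a x : T → 𝓜(ℂ, A)}
    (ha : IsUnitalColumnField ν a) (hx : IsWeakStarMeasurable ν x)
    (hs : ∀ᵐ t ∂ν, IsSelfAdjoint (x t)) {R : ℝ} (hR : ∀ᵐ t ∂ν, ‖x t‖ ≤ R) :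
    ∃ b, HasCStarIntegral ν (fun t => star (a t) * x t * a t) b := by
  set R' := max R 0
  have hR' : ∀ᵐ t ∂ν, ‖x t‖ ≤ R' := hR.mono fun t ht => ht.trans (le_max_left _ _)
  obtain ⟨b, hb⟩ := exists_hasCStarIntegral_of_isPositive ha
    (hx.add (isWeakStarMeasurable_const ((R' : ℂ) • (1 : 𝓜(ℂ, A))))) (R := 2 * R')
    (by positivity)
    (by filter_upwards [hs, hR'] with t h1 h2 using isPositive_add_norm h1 h2)
    (by
      filter_upwards [hs, hR'] with t h1 h2
      have h3 := isPositive_norm_sub h1 h2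
      rwa [show ((2 * R' : ℝ) : ℂ) • (1 : 𝓜(ℂ, A)) - (x t + (R' : ℂ) • (1 : 𝓜(ℂ, A))) =
        (R' : ℂ) • (1 : 𝓜(ℂ, A)) - x t by push_cast; module])
  refine ⟨b - (R' : ℂ) • (1 : 𝓜(ℂ, A)), (hb.sub (ha.2.smul (R' : ℂ))).congr ?_⟩
  refine Eventually.of_forall fun t => ?_
  simp [mul_add, add_mul]

end Existence

section Expectation

variable {A : Type*} [NonUnitalCStarAlgebra A] [PartialOrder A] [StarOrderedRing A]
variable {S : Type*} [MetricSpace S] [LocallyCompactSpace S] [MeasurableSpace S] [BorelSpace S]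

/-- A bounded function whose integrals against nonnegative functions in `C₀` are nonnegative is
nonnegative almost everywhere. -/
theorem ae_nonneg_of_forall_integral_mul_nonneg {μ : Measure S} [IsFiniteMeasure μ] [μ.Regular]
    {g : S → ℂ} (hg : MemLp g ∞ μ)
    (h : ∀ z : C₀(S, ℂ), (∀ s, 0 ≤ z s) → 0 ≤ ∫ s, z s * g s ∂μ) : ∀ᵐ s ∂μ, 0 ≤ g s := by
  have hgi : Integrable g μ := hg.integrable le_top
  have hzi : ∀ z : C₀(S, ℂ), Integrable (fun s => z s * g s) μ := fun z =>
    hgi.bdd_mul (c := ‖z.toBCF‖) (map_continuous z).aestronglyMeasurable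
      (Eventually.of_forall fun s => z.toBCF.norm_coe_le_norm s)
  obtain ⟨M, hM0, hM⟩ : ∃ M : ℝ, 0 ≤ M ∧ ∀ᵐ s ∂μ, ‖g s‖ ≤ M := by
    refine ⟨(eLpNormEssSup g μ).toReal, ENNReal.toReal_nonneg, ?_⟩
    have hfin : eLpNormEssSup g μ ≠ ∞ := by
      have := hg.2.ne
      rwa [eLpNorm_exponent_top] at this
    filter_upwards [ae_le_eLpNormEssSup (f := g) (μ := μ)] with s hs
    simpa using ENNReal.toReal_mono hfin hs
  have hset : ∀ E, MeasurableSet E → 0 ≤ ∫ s in E, g s ∂μ := by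
    intro E hE
    have hmem : ∫ s in E, g s ∂μ ∈ closure (Set.Ici (0 : ℂ)) := by
      rw [Metric.mem_closure_iff]
      intro ε hε
      have hε' : 0 < ε / (M + 1) := by positivity
      have hq : MemLp (E.indicator fun _ => (1 : ℝ)) 1 μ :=
        memLp_one_iff_integrable.mpr ((integrable_const _).indicator hE)
      obtain ⟨q, hqs, hqn, hqc, hqi⟩ := hq.exists_hasCompactSupport_eLpNorm_sub_le (by norm_num)
        (ε := ENNReal.ofReal (ε / (M + 1))) (by simpa using hε')
      have hk : Continuous fun u : ℝ => ((max u 0 : ℝ) : ℂ) := by fun_prop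
      let z : C₀(S, ℂ) :=
        { toFun := fun s => ((max (q s) 0 : ℝ) : ℂ)
          continuous_toFun := hk.comp hqc
          zero_at_infty' := by
            have h1 := (hk.tendsto 0).comp hqs.is_zero_at_infty
            rw [max_self, Complex.ofReal_zero] at h1
            exact h1 }
      have hz : ∀ s, z s = ((max (q s) 0 : ℝ) : ℂ) := fun s => rfl
      refine ⟨∫ s, z s * g s ∂μ, h z fun s => ?_, ?_⟩
      · rw [hz, Complex.zero_le_real]
        exact le_max_right _ _
      have hdiff : Integrable ((E.indicator fun _ => (1 : ℝ)) - q) μ :=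
        memLp_one_iff_integrable.mp (hq.sub hqi)
      have h1 : ∫ s in E, g s ∂μ - ∫ s, z s * g s ∂μ =
          ∫ s, (((E.indicator (fun _ => (1 : ℝ)) s - max (q s) 0 : ℝ) : ℂ)) * g s ∂μ := by
        rw [← integral_indicator hE, ← integral_sub (hgi.indicator hE) (hzi z)]
        refine integral_congr_ae (Eventually.of_forall fun s => ?_)
        by_cases hs : s ∈ E <;> simp [hs, hz, sub_mul]
      have h5 : ∫ s, ‖((E.indicator fun _ => (1 : ℝ)) - q) s‖ ∂μ ≤ ε / (M + 1) := by
        rw [← ENNReal.ofReal_le_ofReal_iff hε'.le, ofReal_integral_norm_eq_lintegral_enorm hdiff,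
          ← eLpNorm_one_eq_lintegral_enorm]
        exact hqn
      rw [dist_eq_norm, h1]
      have h6 : ‖∫ s, (((E.indicator (fun _ => (1 : ℝ)) s - max (q s) 0 : ℝ) : ℂ)) * g s ∂μ‖ ≤
          ∫ s, ‖((E.indicator fun _ => (1 : ℝ)) - q) s‖ * M ∂μ := by
        refine norm_integral_le_of_norm_le (hdiff.norm.mul_const _) ?_
        filter_upwards [hM] with s hs
        rw [norm_mul, Complex.norm_real]
        refine mul_le_mul ?_ hs (norm_nonneg _) (norm_nonneg _)
        rw [Pi.sub_apply, Real.norm_eq_abs, Real.norm_eq_abs]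
        have h7 : E.indicator (fun _ => (1 : ℝ)) s =
            max (E.indicator (fun _ => (1 : ℝ)) s) 0 := by
          rw [max_eq_left (Set.indicator_nonneg (fun _ _ => zero_le_one) s)]
        conv_lhs => rw [h7]
        exact abs_max_sub_max_le_abs _ _ _
      refine h6.trans_lt ?_
      rw [integral_mul_const]
      refine (mul_le_mul_of_nonneg_right h5 hM0).trans_lt ?_
      rw [div_mul_eq_mul_div, div_lt_iff₀ (by positivity)]
      nlinarith
    rwa [isClosed_Ici.closure_eq] at hmem
  have hre : ∀ᵐ s ∂μ, 0 ≤ (g s).re := by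
    refine ae_nonneg_of_forall_setIntegral_nonneg hgi.re fun E hE _ => ?_
    have h2 : ∫ s in E, RCLike.re (g s) ∂μ = RCLike.re (∫ s in E, g s ∂μ) :=
      integral_re hgi.integrableOn
    exact (Complex.nonneg_iff.mp (hset E hE)).1.trans_eq h2.symm
  have him : (fun s => (g s).im) =ᵐ[μ] 0 := by
    refine Integrable.ae_eq_zero_of_forall_setIntegral_eq_zero hgi.im fun E hE _ => ?_
    have h2 : ∫ s in E, RCLike.im (g s) ∂μ = RCLike.im (∫ s in E, g s ∂μ) :=
      integral_im hgi.integrableOn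
    exact h2.trans (Complex.nonneg_iff.mp (hset E hE)).2.symm
  filter_upwards [hre, him] with s h1 h2
  exact Complex.nonneg_iff.mpr ⟨h1, h2.symm⟩

variable {C : NonUnitalStarSubalgebra ℂ A} (φ : A →ₚ[ℂ] ℂ) (e : C₀(S, ℂ) ≃⋆ₐ[ℂ] C)
  (hC : (C : Set A) ⊆ centralizer φ)

theorem integrable_mul_condExp (m : 𝓜(ℂ, A)) (z : C₀(S, ℂ)) :
    Integrable (fun s => z s * condExp φ e hC m s) (condMeasure φ e) :=
  ((Lp.memLp (condExp φ e hC m)).integrable le_top).bdd_mul (c := ‖z.toBCF‖)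
    (map_continuous z).aestronglyMeasurable
    (Eventually.of_forall fun s => z.toBCF.norm_coe_le_norm s)

theorem condExp_sub (m k : 𝓜(ℂ, A)) :
    ∀ᵐ s ∂(condMeasure φ e),
      condExp φ e hC (m - k) s = condExp φ e hC m s - condExp φ e hC k s := by
  have h : condExp φ e hC (m - k) = condExp φ e hC m - condExp φ e hC k := by
    refine condExp_unique _ _ _ fun z => ?_
    rw [integral_mul_condExp, DoubleCentralizer.sub_snd, _root_.sub_apply, map_sub,
      ← integral_mul_condExp φ e hC m, ← integral_mul_condExp φ e hC k,
      ← integral_sub (integrable_mul_condExp φ e hC m z) (integrable_mul_condExp φ e hC k z)]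
    refine integral_congr_ae ?_
    filter_upwards [Lp.coeFn_sub (condExp φ e hC m) (condExp φ e hC k)] with s hs
    rw [hs, Pi.sub_apply, mul_sub]
  rw [h]
  exact Lp.coeFn_sub _ _

theorem condExp_smul (c : ℂ) (m : 𝓜(ℂ, A)) :
    ∀ᵐ s ∂(condMeasure φ e), condExp φ e hC (c • m) s = c * condExp φ e hC m s := by
  have h : condExp φ e hC (c • m) = c • condExp φ e hC m := by
    refine condExp_unique _ _ _ fun z => ?_
    rw [integral_mul_condExp, DoubleCentralizer.smul_snd, _root_.smul_apply, map_smul,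
      ← integral_mul_condExp φ e hC m, smul_eq_mul, ← integral_const_mul]
    refine integral_congr_ae ?_
    filter_upwards [Lp.coeFn_smul c (condExp φ e hC m)] with s hs
    rw [hs, Pi.smul_apply, smul_eq_mul, mul_left_comm]
  rw [h]
  exact Lp.coeFn_smul _ _

theorem condExp_add (m k : 𝓜(ℂ, A)) :
    ∀ᵐ s ∂(condMeasure φ e),
      condExp φ e hC (m + k) s = condExp φ e hC m s + condExp φ e hC k s := by
  have h : m + k = m - (-1 : ℂ) • k := by simp
  rw [h]
  filter_upwards [condExp_sub φ e hC m ((-1 : ℂ) • k), condExp_smul φ e hC (-1) k] with s h1 h2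
  rw [h1, h2]
  ring

theorem condExp_sum {ι : Type*} (I : Finset ι) (m : ι → 𝓜(ℂ, A)) :
    ∀ᵐ s ∂(condMeasure φ e),
      condExp φ e hC (∑ i ∈ I, m i) s = ∑ i ∈ I, condExp φ e hC (m i) s := by
  classical
  induction I using Finset.induction_on with
  | empty =>
    filter_upwards [condExp_smul φ e hC 0 0] with s hs
    simpa using hs
  | insert i I hi ih =>
    rw [Finset.sum_insert hi]
    filter_upwards [ih, condExp_add φ e hC (m i) (∑ i ∈ I, m i)] with s h1 h2
    rw [h2, h1, Finset.sum_insert hi]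

theorem condExp_one : ∀ᵐ s ∂(condMeasure φ e), condExp φ e hC (1 : 𝓜(ℂ, A)) s = 1 := by
  have hm : MemLp (fun _ : S => (1 : ℂ)) ∞ (condMeasure φ e) := memLp_const 1
  have h : condExp φ e hC (1 : 𝓜(ℂ, A)) = hm.toLp _ := by
    refine condExp_unique _ _ _ fun z => ?_
    rw [integral_mul_condExp, DoubleCentralizer.one_snd]
    refine (integral_condMeasure φ e z).trans (integral_congr_ae ?_)
    filter_upwards [hm.coeFn_toLp] with s hs
    rw [hs, mul_one]
  rw [h]
  exact hm.coeFn_toLp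

theorem exists_apply_snd_eq (hC : (C : Set A) ⊆ centralizer φ) (z : C₀(S, ℂ)) (hz : ∀ s, 0 ≤ z s) :
    ∃ c : A, ∀ m : 𝓜(ℂ, A), φ (m.snd (e z)) = φ (star c * m.fst c) := by
  let w : C₀(S, ℂ) :=
    { toFun := fun s => (Real.sqrt (z s).re : ℂ)
      continuous_toFun := Complex.continuous_ofReal.comp
        (Real.continuous_sqrt.comp (Complex.continuous_re.comp (map_continuous z)))
      zero_at_infty' := by
        have hc : Continuous fun u : ℂ => (Real.sqrt u.re : ℂ) := by fun_prop
        have h := (hc.tendsto 0).comp (zero_at_infty z)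
        rw [Complex.zero_re, Real.sqrt_zero, Complex.ofReal_zero] at h
        exact h }
  have hws : star w = w := by
    ext s
    exact Complex.conj_ofReal _
  have hw : z = w * w := by
    ext s
    have h1 := Complex.nonneg_iff.mp (hz s)
    apply Complex.ext
    · simp [w, Real.mul_self_sqrt h1.1]
    · simp [w, ← h1.2]
  have hewz : (e z : A) = (e w : A) * (e w : A) := by rw [hw, map_mul]; rfl
  have hews : star (e w : A) = (e w : A) := by
    conv_rhs => rw [← hws, map_star]
    rfl
  refine ⟨e w, fun m => ?_⟩
  rw [hewz, ← mul_snd, ← hC (e w).2, m.central, hews]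

theorem condExp_nonneg {m : 𝓜(ℂ, A)} (h : ∀ c : A, 0 ≤ φ (star c * m.fst c)) :
    ∀ᵐ s ∂(condMeasure φ e), 0 ≤ condExp φ e hC m s := by
  refine ae_nonneg_of_forall_integral_mul_nonneg (Lp.memLp _) fun z hz => ?_
  obtain ⟨c, hc⟩ := exists_apply_snd_eq φ e hC z hz
  rw [integral_mul_condExp, hc]
  exact h c

/-- The bounded functional underlying a positive functional. -/
noncomputable def toFunctional : A →L[ℂ] ℂ :=
  φ.toLinearMap.mkContinuousOfExistsBound (by
    obtain ⟨K, hK⟩ := φ.exists_norm_apply_le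
    exact ⟨K, hK⟩)

theorem toFunctional_apply (x : A) : toFunctional φ x = φ x := rfl

variable {T : Type*} [MeasurableSpace T] {ν : Measure T}

theorem HasCStarIntegral.apply_conj {b : T → 𝓜(ℂ, A)} {B : 𝓜(ℂ, A)}
    (h : HasCStarIntegral ν b B) (c : A) :
    Integrable (fun t => φ (star c * (b t).fst c)) ν ∧
      ∫ t, φ (star c * (b t).fst c) ∂ν = φ (star c * B.fst c) := by
  have h1 := h.integral_eq (((toFunctional φ).comp (ContinuousLinearMap.mul ℂ A (star c))).comp
    ((ContinuousLinearMap.mul ℂ A).flip c))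
  simp only [extend_conj, toFunctional_apply] at h1
  exact h1

theorem HasCStarIntegral.condExp_nonneg {b : T → 𝓜(ℂ, A)} {B : 𝓜(ℂ, A)}
    (h : HasCStarIntegral ν b B) (hb : ∀ᵐ t ∂ν, IsPositive (b t)) :
    ∀ᵐ s ∂(condMeasure φ e), 0 ≤ condExp φ e hC B s := by
  refine CondJensen.condExp_nonneg φ e hC fun c => ?_
  rw [← (h.apply_conj φ c).2]
  exact integral_nonneg_of_ae (hb.mono fun t ht => φ.map_nonneg (ht.nonneg c))

end Expectation

section AffineMinorants

variable {n : ℕ}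

/-- Affine minorants of a continuous convex function approximate it at each point of its domain. -/
theorem exists_affine_minorant {D : Set (Fin n → ℝ)} {f : (Fin n → ℝ) → ℝ}
    (hfc : ContinuousOn f D) (hf : ConvexOn ℝ D f) {p : Fin n → ℝ} (hp : p ∈ D) {ε : ℝ}
    (hε : 0 < ε) :
    ∃ (v : Fin n → ℝ) (c : ℝ), (∀ q ∈ D, c + ∑ i, v i * q i ≤ f q) ∧
      f p - ε < c + ∑ i, v i * p i := by
  set epi : Set ((Fin n → ℝ) × ℝ) := {q | q.1 ∈ D ∧ f q.1 ≤ q.2} with hepi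
  have hconv : Convex ℝ (closure epi) := hf.convex_epigraph.closure
  have hnot : (p, f p - ε) ∉ closure epi := by
    intro h
    have h1 : ∀ᶠ q in 𝓝[D] p, f p - ε / 2 < f q :=
      (hfc p hp).eventually (lt_mem_nhds (by linarith))
    rw [eventually_nhdsWithin_iff] at h1
    have h0 : ∀ᶠ r in 𝓝 (f p - ε), r < f p - ε / 2 := gt_mem_nhds (by linarith)
    have h2 : ∀ᶠ q : (Fin n → ℝ) × ℝ in 𝓝 (p, f p - ε),
        (q.1 ∈ D → f p - ε / 2 < f q.1) ∧ q.2 < f p - ε / 2 :=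
      ((continuous_fst.tendsto (p, f p - ε)).eventually h1).and
        ((continuous_snd.tendsto (p, f p - ε)).eventually h0)
    obtain ⟨q, hq1, hq2⟩ := (mem_closure_iff_frequently.mp h).and_eventually h2 |>.exists
    have h3 := hq2.1 hq1.1
    have h4 : f q.1 ≤ q.2 := hq1.2
    linarith [hq2.2]
  obtain ⟨L, u, hL1, hL2⟩ := geometric_hahn_banach_point_closed hconv isClosed_closure hnot
  have hLs : ∀ (q : Fin n → ℝ) (r : ℝ), L (q, r) = L (q, 0) + r * L (0, 1) := by
    intro q r
    have : (q, r) = (q, (0 : ℝ)) + r • ((0 : Fin n → ℝ), (1 : ℝ)) := by simp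
    rw [this, map_add, map_smul, smul_eq_mul]
  have hL0 : ∀ q : Fin n → ℝ, L (q, 0) = ∑ i, L (Pi.single i 1, 0) * q i := by
    intro q
    have h1 := (L.toLinearMap.comp (LinearMap.inl ℝ (Fin n → ℝ) ℝ)).pi_apply_eq_sum_univ q
    simp only [LinearMap.comp_apply, LinearMap.inl_apply, ContinuousLinearMap.coe_coe,
      smul_eq_mul] at h1
    rw [h1]
    refine Finset.sum_congr rfl fun i _ => ?_
    rw [mul_comm]
    congr 3
    ext j
    simp [Pi.single_apply, eq_comm]
  have hD : ∀ q ∈ D, u < L (q, 0) + f q * L (0, 1) := fun q hq => by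
    rw [← hLs]
    exact hL2 _ (subset_closure ⟨hq, le_rfl⟩)
  set α := L (0, 1) with hα
  rw [hLs] at hL1
  have hα0 : 0 < α := by
    have := hD p hp
    by_contra! h
    nlinarith
  have hsum : ∀ q : Fin n → ℝ, u / α + ∑ i, -(L (Pi.single i 1, 0) / α) * q i =
      (u - L (q, 0)) / α := by
    intro q
    rw [hL0, sub_div, Finset.sum_div, sub_eq_add_neg, ← Finset.sum_neg_distrib]
    congr 1
    refine Finset.sum_congr rfl fun i _ => ?_
    ring
  refine ⟨fun i => -(L (Pi.single i 1, 0) / α), u / α, fun q hq => ?_, ?_⟩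
  · rw [hsum, div_le_iff₀ hα0]
    linarith [hD q hq]
  · rw [hsum, lt_div_iff₀ hα0]
    linarith

/-- A continuous convex function is the supremum of countably many affine minorants. -/
theorem exists_countable_affine_minorants {D : Set (Fin n → ℝ)} {f : (Fin n → ℝ) → ℝ}
    (hfc : ContinuousOn f D) (hf : ConvexOn ℝ D f) :
    ∃ s : Set ((Fin n → ℝ) × ℝ), s.Countable ∧
      (∀ l ∈ s, ∀ q ∈ D, l.2 + ∑ i, l.1 i * q i ≤ f q) ∧
      ∀ p ∈ D, ∀ r, (∀ l ∈ s, l.2 + ∑ i, l.1 i * p i ≤ r) → f p ≤ r := by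
  set M : Set ((Fin n → ℝ) × ℝ) := {l | ∀ q ∈ D, l.2 + ∑ i, l.1 i * q i ≤ f q} with hM
  obtain ⟨s, hsM, hsc, hsd⟩ :=
    (TopologicalSpace.IsSeparable.of_separableSpace M).exists_countable_dense_subset
  refine ⟨s, hsc, fun l hl => hsM hl, fun p hp r hr => ?_⟩
  have hcl : IsClosed {l : (Fin n → ℝ) × ℝ | l.2 + ∑ i, l.1 i * p i ≤ r} :=
    isClosed_le (by fun_prop) continuous_const
  refine le_of_forall_pos_le_add fun ε hε => ?_
  obtain ⟨v, c, h1, h2⟩ := exists_affine_minorant hfc hf hp hε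
  have h3 : (v, c) ∈ closure s := hsd h1
  have h4 : c + ∑ i, v i * p i ≤ r := closure_minimal (fun l hl => hr l hl) hcl h3
  linarith

end AffineMinorants

section CompactExhaustion

/-- An interval is exhausted by compact subsets. -/
theorem exists_compact_exhaustion_of_ordConnected {I : Set ℝ} (hI : I.OrdConnected) :
    ∃ J : ℕ → Set ℝ, (∀ k, IsCompact (J k) ∧ J k ⊆ I) ∧
      ∀ K, IsCompact K → K ⊆ I → ∀ᶠ k in atTop, K ⊆ J k := by
  rcases I.eq_empty_or_nonempty with rfl | hne
  · exact ⟨fun _ => ∅, fun _ => ⟨isCompact_empty, subset_rfl⟩, fun K _ hK =>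
      Eventually.of_forall fun _ => hK⟩
  have : Nonempty I := hne.to_subtype
  have : OrderTopology I := orderTopology_of_ordConnected
  obtain ⟨l, hl⟩ := (atBot : Filter I).exists_seq_tendsto
  obtain ⟨u, hu⟩ := (atTop : Filter I).exists_seq_tendsto
  refine ⟨fun k => Set.Icc (l k) (u k), fun k => ⟨isCompact_Icc, hI.out (l k).2 (u k).2⟩,
    fun K hK hKI => ?_⟩
  rcases K.eq_empty_or_nonempty with rfl | hKne
  · exact Eventually.of_forall fun _ => Set.empty_subset _
  obtain ⟨p, hp, hpK⟩ := hK.exists_isLeast hKne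
  obtain ⟨q, hq, hqK⟩ := hK.exists_isGreatest hKne
  filter_upwards [hl.eventually (eventually_le_atBot ⟨p, hKI hp⟩),
    hu.eventually (eventually_ge_atTop ⟨q, hKI hq⟩)] with k h1 h2 x hx
  exact ⟨le_trans h1 (hpK hx), le_trans (hqK hx) h2⟩

end CompactExhaustion

section JointCalculusProperties

variable {B : Type*} [CStarAlgebra B] {n : ℕ} {x : Fin n → B}

/-- A real function that is continuous on the product of the spectra, as a complex function. -/
noncomputable def boxFun {f : (Fin n → ℝ) → ℝ} (hf : ContinuousOn f (spectralBox x)) :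
    C(spectralBox x, ℂ) :=
  ⟨fun p => (f p.1 : ℂ), Complex.continuous_ofReal.comp hf.domRestrict⟩

theorem boxFun_apply {f : (Fin n → ℝ) → ℝ} (hf : ContinuousOn f (spectralBox x))
    (p : spectralBox x) : boxFun hf p = (f p.1 : ℂ) := rfl

theorem exists_jointCFC_eq (hx : ∀ i, IsSelfAdjoint (x i)) (hc : ∀ i j, Commute (x i) (x j)) :
    ∃ Ψ : C(spectralBox x, ℂ) →⋆ₐ[ℂ] B, (∀ i, Ψ (coordFun x i) = x i) ∧
      ∀ (f : (Fin n → ℝ) → ℝ) (hf : ContinuousOn f (spectralBox x)),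
        jointCFC f x = Ψ (boxFun hf) :=
  have h := exists_jointHom x hx hc
  ⟨h.choose, h.choose_spec, fun _ hf => dif_pos ⟨h, hf⟩⟩

theorem jointCFC_isSelfAdjoint (hx : ∀ i, IsSelfAdjoint (x i))
    (hc : ∀ i j, Commute (x i) (x j)) {f : (Fin n → ℝ) → ℝ}
    (hf : ContinuousOn f (spectralBox x)) : IsSelfAdjoint (jointCFC f x) := by
  obtain ⟨Ψ, -, hΨ⟩ := exists_jointCFC_eq hx hc
  rw [hΨ f hf]
  refine IsSelfAdjoint.map (f := Ψ) ?_
  ext p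
  exact Complex.conj_ofReal _

theorem norm_jointCFC_sub_le (hx : ∀ i, IsSelfAdjoint (x i))
    (hc : ∀ i j, Commute (x i) (x j)) {f g : (Fin n → ℝ) → ℝ}
    (hf : ContinuousOn f (spectralBox x)) (hg : ContinuousOn g (spectralBox x)) {ε : ℝ}
    (hε : 0 ≤ ε) (h : ∀ p ∈ spectralBox x, |f p - g p| ≤ ε) :
    ‖jointCFC f x - jointCFC g x‖ ≤ ε := by
  have : CompactSpace (spectralBox x) := isCompact_iff_compactSpace.mp (isCompact_spectralBox x)
  obtain ⟨Ψ, -, hΨ⟩ := exists_jointCFC_eq hx hc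
  rw [hΨ f hf, hΨ g hg, ← map_sub]
  refine (NonUnitalStarAlgHom.norm_apply_le Ψ _).trans
    ((ContinuousMap.norm_le _ hε).mpr fun p => ?_)
  rw [ContinuousMap.sub_apply, boxFun_apply, boxFun_apply, ← Complex.ofReal_sub,
    Complex.norm_real]
  exact h p.1 p.2

theorem jointCFC_const (hx : ∀ i, IsSelfAdjoint (x i)) (hc : ∀ i j, Commute (x i) (x j))
    (r : ℝ) : jointCFC (fun _ => r) x = (r : ℂ) • (1 : B) := by
  obtain ⟨Ψ, -, hΨ⟩ := exists_jointCFC_eq hx hc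
  rw [hΨ _ continuousOn_const, ← map_one Ψ, ← map_smul]
  congr 1
  ext p
  simp [boxFun_apply]

theorem jointCFC_coord (hx : ∀ i, IsSelfAdjoint (x i)) (hc : ∀ i j, Commute (x i) (x j))
    (i : Fin n) : jointCFC (fun p => p i) x = x i := by
  obtain ⟨Ψ, h1, hΨ⟩ := exists_jointCFC_eq hx hc
  rw [hΨ _ (continuous_apply i).continuousOn]
  exact h1 i

theorem jointCFC_add (hx : ∀ i, IsSelfAdjoint (x i)) (hc : ∀ i j, Commute (x i) (x j))
    {f g : (Fin n → ℝ) → ℝ} (hf : ContinuousOn f (spectralBox x))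
    (hg : ContinuousOn g (spectralBox x)) :
    jointCFC (fun p => f p + g p) x = jointCFC f x + jointCFC g x := by
  obtain ⟨Ψ, -, hΨ⟩ := exists_jointCFC_eq hx hc
  rw [hΨ _ hf, hΨ _ hg, hΨ (fun p => f p + g p) (hf.add hg), ← map_add]
  congr 1
  ext p
  simp [boxFun_apply]

theorem jointCFC_mul (hx : ∀ i, IsSelfAdjoint (x i)) (hc : ∀ i j, Commute (x i) (x j))
    {f g : (Fin n → ℝ) → ℝ} (hf : ContinuousOn f (spectralBox x))
    (hg : ContinuousOn g (spectralBox x)) :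
    jointCFC (fun p => f p * g p) x = jointCFC f x * jointCFC g x := by
  obtain ⟨Ψ, -, hΨ⟩ := exists_jointCFC_eq hx hc
  rw [hΨ _ hf, hΨ _ hg, hΨ (fun p => f p * g p) (hf.mul hg), ← map_mul]
  congr 1
  ext p
  simp [boxFun_apply]

theorem jointCFC_affine (hx : ∀ i, IsSelfAdjoint (x i)) (hc : ∀ i j, Commute (x i) (x j))
    (c : ℝ) (v : Fin n → ℝ) :
    jointCFC (fun p => c + ∑ i, v i * p i) x = (c : ℂ) • (1 : B) + ∑ i, (v i : ℂ) • x i := by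
  have hcont : Continuous fun p : Fin n → ℝ => ∑ i, v i * p i := by fun_prop
  rw [jointCFC_add hx hc continuousOn_const hcont.continuousOn, jointCFC_const hx hc]
  congr 1
  obtain ⟨Ψ, h1, hΨ⟩ := exists_jointCFC_eq hx hc
  rw [hΨ _ hcont.continuousOn]
  simp only [← h1, ← map_smul, ← map_sum]
  congr 1
  ext p
  simp [boxFun_apply, coordFun]

theorem exists_jointCFC_sub_eq (hx : ∀ i, IsSelfAdjoint (x i))
    (hc : ∀ i j, Commute (x i) (x j)) {f g : (Fin n → ℝ) → ℝ}
    (hf : ContinuousOn f (spectralBox x)) (hg : ContinuousOn g (spectralBox x))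
    (h : ∀ p ∈ spectralBox x, g p ≤ f p) :
    ∃ d : B, jointCFC f x - jointCFC g x = star d * d := by
  obtain ⟨Ψ, -, hΨ⟩ := exists_jointCFC_eq hx hc
  have hs : ContinuousOn (fun p => Real.sqrt (f p - g p)) (spectralBox x) := (hf.sub hg).sqrt
  refine ⟨Ψ (boxFun hs), ?_⟩
  rw [hΨ f hf, hΨ g hg, ← map_star, ← map_mul, ← map_sub]
  congr 1
  ext p
  have h1 : Real.sqrt (f p.1 - g p.1) * Real.sqrt (f p.1 - g p.1) = f p.1 - g p.1 :=
    Real.mul_self_sqrt (sub_nonneg.mpr (h p.1 p.2))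
  simp only [ContinuousMap.sub_apply, ContinuousMap.mul_apply, ContinuousMap.star_apply,
    boxFun_apply, Complex.star_def, Complex.conj_ofReal]
  rw [← Complex.ofReal_mul, h1, Complex.ofReal_sub]

end JointCalculusProperties

section Fields

variable {A : Type*} [NonUnitalCStarAlgebra A] [PartialOrder A] [StarOrderedRing A]
  [TopologicalSpace.SeparableSpace A] {T : Type*} [MeasurableSpace T] {ν : Measure T} {n : ℕ}

/-- The algebra of polynomial functions. -/
noncomputable def polyAlgebra (n : ℕ) : Subalgebra ℝ C(Fin n → ℝ, ℝ) :=
  Algebra.adjoin ℝ (Set.range fun i => (⟨fun p => p i, continuous_apply i⟩ : C(Fin n → ℝ, ℝ)))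

theorem polyAlgebra_separatesPoints : (polyAlgebra n).SeparatesPoints := by
  intro p q hpq
  obtain ⟨i, hi⟩ : ∃ i, p i ≠ q i := by
    by_contra! h
    exact hpq (funext h)
  exact ⟨_, ⟨_, Algebra.subset_adjoin ⟨i, rfl⟩, rfl⟩, hi⟩

theorem isWeakStarMeasurable_jointCFC_poly {x : T → Fin n → 𝓜(ℂ, A)}
    (hxm : ∀ i, IsWeakStarMeasurable ν fun t => x t i) (hx : ∀ t i, IsSelfAdjoint (x t i))
    (hc : ∀ t i j, Commute (x t i) (x t j)) {g : C(Fin n → ℝ, ℝ)} (hg : g ∈ polyAlgebra n) :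
    IsWeakStarMeasurable ν fun t => jointCFC g (x t) := by
  induction hg using Algebra.adjoin_induction with
  | mem g hg =>
    obtain ⟨i, rfl⟩ := hg
    simpa only [ContinuousMap.coe_mk, jointCFC_coord (hx _) (hc _)] using hxm i
  | algebraMap r =>
    have h : (algebraMap ℝ C(Fin n → ℝ, ℝ) r : (Fin n → ℝ) → ℝ) = fun _ => r := rfl
    simp only [h, jointCFC_const (hx _) (hc _)]
    exact isWeakStarMeasurable_const _
  | add f g _ _ hf hg =>
    refine (hf.add hg).congr (Eventually.of_forall fun t => ?_)
    exact (jointCFC_add (hx t) (hc t) (map_continuous f).continuousOn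
      (map_continuous g).continuousOn).symm
  | mul f g _ _ hf hg =>
    refine (hf.mul hg).congr (Eventually.of_forall fun t => ?_)
    exact (jointCFC_mul (hx t) (hc t) (map_continuous f).continuousOn
      (map_continuous g).continuousOn).symm

/-- Continuous functions of weak*-measurable abelian fields are weak*-measurable. -/
theorem isWeakStarMeasurable_jointCFC {x : T → Fin n → 𝓜(ℂ, A)}
    (hxm : ∀ i, IsWeakStarMeasurable ν fun t => x t i) (hx : ∀ t i, IsSelfAdjoint (x t i))
    (hc : ∀ t i j, Commute (x t i) (x t j)) {I : Fin n → Set ℝ} (hI : ∀ i, (I i).OrdConnected)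
    (hxI : ∀ t i, spectrum ℝ (x t i) ⊆ I i) {f : (Fin n → ℝ) → ℝ}
    (hf : ContinuousOn f (Set.univ.pi I)) :
    IsWeakStarMeasurable ν fun t => jointCFC f (x t) := by
  choose J hJ hJK using fun i => exists_compact_exhaustion_of_ordConnected (hI i)
  let K : ℕ → Set (Fin n → ℝ) := fun k => Set.univ.pi fun i => J i k
  have hKc : ∀ k, IsCompact (K k) := fun k => isCompact_univ_pi fun i => (hJ i k).1
  have hKI : ∀ k, K k ⊆ Set.univ.pi I := fun k => Set.pi_mono fun i _ => (hJ i k).2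
  have happ : ∀ k : ℕ, ∃ g ∈ polyAlgebra n, ∀ p ∈ K k, |g p - f p| ≤ 1 / ((k : ℝ) + 1) := by
    intro k
    obtain ⟨F, hF⟩ := ContinuousMap.exists_restrict_eq (hKc k).isClosed
      (⟨(K k).domRestrict f, (hf.mono (hKI k)).domRestrict⟩ : C(K k, ℝ))
    obtain ⟨g, hg, hgF⟩ :=
      ContinuousMap.exists_mem_subalgebra_near_continuous_of_isCompact_of_separatesPoints
        polyAlgebra_separatesPoints F (hKc k) (ε := 1 / ((k : ℝ) + 1)) (by positivity)
    refine ⟨g, hg, fun p hp => ?_⟩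
    have h1 : F p = f p := DFunLike.congr_fun hF ⟨p, hp⟩
    rw [← h1]
    exact (hgF p hp).le
  choose g hg hgf using happ
  refine isWeakStarMeasurable_of_tendsto
    (fun k => isWeakStarMeasurable_jointCFC_poly hxm hx hc (hg k)) (Eventually.of_forall fun t => ?_)
  refine tendsto_iff_norm_sub_tendsto_zero.mpr ?_
  refine squeeze_zero' (Eventually.of_forall fun _ => norm_nonneg _) ?_
    tendsto_one_div_add_atTop_nhds_zero_nat
  have hev : ∀ᶠ k in atTop, ∀ i, spectrum ℝ (x t i) ⊆ J i k :=
    eventually_all.mpr fun i => hJK i _ (spectrum.isCompact (𝕜 := ℝ) (x t i)) (hxI t i)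
  filter_upwards [hev] with k hk
  refine norm_jointCFC_sub_le (hx t) (hc t) (map_continuous (g k)).continuousOn
    (hf.mono (Set.pi_mono fun i _ => hxI t i)) (by positivity) fun p hp => hgf k p ?_
  exact Set.pi_mono (fun i _ => hk i) hp

end Fields

section Powers

variable {A : Type*} [NonUnitalCStarAlgebra A] [PartialOrder A] [StarOrderedRing A]

theorem IsPositive.smul {m : 𝓜(ℂ, A)} (hm : IsPositive m) {r : ℝ} (hr : 0 ≤ r) :
    IsPositive ((r : ℂ) • m) := by
  obtain ⟨d, rfl⟩ := hm
  refine ⟨((Real.sqrt r : ℝ) : ℂ) • d, ?_⟩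
  rw [star_smul, smul_mul_smul_comm, Complex.star_def, Complex.conj_ofReal, ← Complex.ofReal_mul,
    Real.mul_self_sqrt hr]

/-- Bernoulli's inequality for positive contractions. -/
theorem isPositive_pow_sub {u : 𝓜(ℂ, A)} (h0 : IsPositive u) (h1 : IsPositive (1 - u)) (m : ℕ) :
    IsPositive (u ^ m) ∧ IsPositive (1 - u ^ m) ∧
      IsPositive (u ^ m - 1 + (m : ℂ) • (1 - u)) := by
  let _ := CStarAlgebra.spectralOrder 𝓜(ℂ, A)
  have := CStarAlgebra.spectralOrderedRing 𝓜(ℂ, A)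
  have hpos : ∀ {k : 𝓜(ℂ, A)}, IsPositive k ↔ 0 ≤ k := fun {k} =>
    CStarAlgebra.nonneg_iff_eq_star_mul_self.symm
  rw [hpos] at h0 h1
  have hu : IsSelfAdjoint u := .of_nonneg h0
  have hs0 : ∀ r ∈ spectrum ℝ u, 0 ≤ r := fun r hr => spectrum_nonneg_of_nonneg h0 hr
  have hs1 : ∀ r ∈ spectrum ℝ u, r ≤ 1 :=
    (CFC.le_one_iff (R := ℝ) u).mp (sub_nonneg.mp h1)
  have hp : cfc (fun r : ℝ => r ^ m) u = u ^ m := cfc_pow_id u m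
  have hq : cfc (fun r : ℝ => 1 - r ^ m) u = 1 - u ^ m := by
    rw [cfc_sub (fun _ => 1) (fun r : ℝ => r ^ m) u, cfc_const_one ℝ u, hp]
  have hr : cfc (fun r : ℝ => r ^ m - 1 + m * (1 - r)) u = u ^ m - 1 + (m : ℂ) • (1 - u) := by
    rw [cfc_add u (fun r : ℝ => r ^ m - 1) (fun r : ℝ => m * (1 - r)),
      cfc_sub (fun r : ℝ => r ^ m) (fun _ => 1) u, cfc_const_one ℝ u, hp,
      cfc_const_mul (m : ℝ) (fun r : ℝ => 1 - r) u, cfc_sub (fun _ => 1) (fun r : ℝ => r) u,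
      cfc_const_one ℝ u, cfc_id' ℝ u]
    congr 1
  rw [hpos, hpos, hpos]
  refine ⟨?_, ?_, ?_⟩
  · rw [← hp]
    exact cfc_nonneg fun r hr => pow_nonneg (hs0 r hr) m
  · rw [← hq]
    exact cfc_nonneg fun r hr => sub_nonneg.mpr (pow_le_one₀ (hs0 r hr) (hs1 r hr))
  · rw [← hr]
    refine cfc_nonneg fun r hr => ?_
    have h2 := one_add_mul_le_pow (a := r - 1) (by linarith [hs0 r hr]) m
    rw [add_sub_cancel] at h2
    linarith

/-- A self-adjoint multiplier with positive spectrum. -/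
theorem isPositive_sub_of_spectrum {m : 𝓜(ℂ, A)} (hm : IsSelfAdjoint m) {l : ℝ}
    (h : ∀ r ∈ spectrum ℝ m, l ≤ r) : IsPositive (m - (l : ℂ) • (1 : 𝓜(ℂ, A))) := by
  let _ := CStarAlgebra.spectralOrder 𝓜(ℂ, A)
  have := CStarAlgebra.spectralOrderedRing 𝓜(ℂ, A)
  refine CStarAlgebra.nonneg_iff_eq_star_mul_self.mp (sub_nonneg.mpr ?_)
  have h1 := (algebraMap_le_iff_le_spectrum (R := ℝ) (r := l) (a := m) hm).mpr h
  rw [Algebra.algebraMap_eq_smul_one] at h1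
  exact h1

theorem norm_one_sub_lt {m : 𝓜(ℂ, A)} (hm : IsSelfAdjoint m) {l R : ℝ} (hR : 0 < R)
    (hmR : ‖m - (l : ℂ) • (1 : 𝓜(ℂ, A))‖ ≤ R) (h : ∀ r ∈ spectrum ℝ m, l < r) :
    ‖1 - ((R⁻¹ : ℝ) : ℂ) • (m - (l : ℂ) • (1 : 𝓜(ℂ, A)))‖ < 1 := by
  obtain ⟨δ, hδ0, hδ⟩ : ∃ δ > 0, ∀ r ∈ spectrum ℝ m, l + δ ≤ r := by
    rcases (spectrum ℝ m).eq_empty_or_nonempty with he | hne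
    · exact ⟨1, one_pos, by simp [he]⟩
    · obtain ⟨r, hr, hrm⟩ := (spectrum.isCompact (𝕜 := ℝ) m).exists_isLeast hne
      exact ⟨r - l, sub_pos.mpr (h r hr), fun q hq => by
        rw [add_sub_cancel]; exact hrm hq⟩
  have hδ' : ∀ r ∈ spectrum ℝ m, l + min δ R ≤ r := fun r hr =>
    (add_le_add_right (min_le_left _ _) l).trans (hδ r hr)
  have hε0 : 0 < min δ R := lt_min hδ0 hR
  have hεR : min δ R ≤ R := min_le_right _ _
  set ε := min δ R
  set X := m - (l : ℂ) • (1 : 𝓜(ℂ, A)) with hX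
  have hXs : IsSelfAdjoint X := by
    refine hm.sub ?_
    rw [IsSelfAdjoint, star_smul, star_one, Complex.star_def, Complex.conj_ofReal]
  have hRR : (((R⁻¹ : ℝ) : ℂ)) * (R : ℂ) = 1 := by
    rw [← Complex.ofReal_mul, inv_mul_cancel₀ hR.ne', Complex.ofReal_one]
  have h1 : IsPositive (1 - ((R⁻¹ : ℝ) : ℂ) • X) := by
    have h2 := (isPositive_norm_sub hXs hmR).smul (inv_nonneg.mpr hR.le)
    rwa [smul_sub, smul_smul, hRR, one_smul] at h2
  have h2 : IsPositive (((1 - R⁻¹ * ε : ℝ) : ℂ) • (1 : 𝓜(ℂ, A)) -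
      (1 - ((R⁻¹ : ℝ) : ℂ) • X)) := by
    have h3 := (isPositive_sub_of_spectrum hm hδ').smul (inv_nonneg.mpr hR.le)
    have h4 : ((1 - R⁻¹ * ε : ℝ) : ℂ) • (1 : 𝓜(ℂ, A)) - (1 - ((R⁻¹ : ℝ) : ℂ) • X) =
        ((R⁻¹ : ℝ) : ℂ) • (m - ((l + ε : ℝ) : ℂ) • (1 : 𝓜(ℂ, A))) := by
      rw [hX]
      push_cast
      module
    rwa [h4]
  have hlt : 0 < R⁻¹ * ε := by positivity
  have hle : R⁻¹ * ε ≤ 1 := by rw [inv_mul_le_iff₀ hR]; linarith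
  refine (norm_le_of_isPositive h1 (by linarith) h2).trans_lt ?_
  linarith

end Powers

section Bounds

variable {A : Type*} [NonUnitalCStarAlgebra A] [PartialOrder A] [StarOrderedRing A]
  [TopologicalSpace.SeparableSpace A]
variable {S : Type*} [MetricSpace S] [LocallyCompactSpace S] [MeasurableSpace S] [BorelSpace S]
variable {C : NonUnitalStarSubalgebra ℂ A} (φ : A →ₚ[ℂ] ℂ) (e : C₀(S, ℂ) ≃⋆ₐ[ℂ] C)
  (hC : (C : Set A) ⊆ centralizer φ)
variable {T : Type*} [MeasurableSpace T] {ν : Measure T}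

theorem tendsto_integral_mul_condExp_pow {a u : T → 𝓜(ℂ, A)}
    (hpow : ∀ᵐ t ∂ν, ∀ m : ℕ, IsPositive (u t ^ m) ∧ IsPositive (1 - u t ^ m))
    (hlt : ∀ᵐ t ∂ν, ‖u t‖ < 1) {B : 𝓜(ℂ, A)} (ha : HasCStarIntegral ν (fun t => star (a t) * a t) B)
    {P : ℕ → 𝓜(ℂ, A)} (hP : ∀ m, HasCStarIntegral ν (fun t => star (a t) * u t ^ m * a t) (P m))
    (z : C₀(S, ℂ)) (hz : ∀ s, 0 ≤ z s) :
    Tendsto (fun m => ∫ s, z s * condExp φ e hC (P m) s ∂(condMeasure φ e)) atTop (𝓝 0) := by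
  obtain ⟨c, hc⟩ := exists_apply_snd_eq φ e hC z hz
  simp only [fun m => (integral_mul_condExp φ e hC (P m) z).trans
    ((hc (P m)).trans ((hP m).apply_conj φ c).2.symm)]
  have hzero : (0 : ℂ) = ∫ _t, (0 : ℂ) ∂ν := by simp
  rw [hzero]
  refine tendsto_integral_of_dominated_convergence
    (fun t => ‖φ (star c * (star (a t) * a t).fst c)‖)
    (fun m => ((hP m).apply_conj φ c).1.1) (ha.apply_conj φ c).1.norm (fun m => ?_) ?_
  · filter_upwards [hpow] with t ht
    refine CStarAlgebra.norm_le_norm_of_nonneg_of_le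
      (φ.map_nonneg (((ht m).1.conj _).nonneg c)) (OrderHomClass.mono φ ?_)
    rw [star_conj_fst, ← star_fst_mul_fst]
    have h2 := star_mul_fst_le (R := 1) (m := u t ^ m) (by simpa using (ht m).2) ((a t).fst c)
    rwa [Complex.ofReal_one, one_smul] at h2
  · filter_upwards [hlt] with t ht
    set χ := ((toFunctional φ).comp (ContinuousLinearMap.mul ℂ A (star c))).comp
      ((ContinuousLinearMap.mul ℂ A).flip c) with hχ
    refine squeeze_zero_norm (a := fun m => ‖χ‖ * (‖a t‖ * ‖u t‖ ^ m * ‖a t‖)) (fun m => ?_) ?_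
    · have h2 := norm_extend_le χ (star (a t) * u t ^ m * a t)
      rw [hχ, extend_conj, toFunctional_apply] at h2
      refine h2.trans (mul_le_mul_of_nonneg_left ?_ (norm_nonneg _))
      refine (norm_mul_le _ _).trans (mul_le_mul_of_nonneg_right ?_ (norm_nonneg _))
      refine (norm_mul_le _ _).trans ?_
      rw [norm_star]
      refine mul_le_mul_of_nonneg_left ?_ (norm_nonneg _)
      rcases subsingleton_or_nontrivial 𝓜(ℂ, A) with hs | hs
      · rw [Subsingleton.elim (u t ^ m) 0, norm_zero]
        positivity
      · exact norm_pow_le _ _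
    · have h2 := tendsto_pow_atTop_nhds_zero_of_lt_one (norm_nonneg _) ht
      have h3 := ((h2.const_mul ‖a t‖).mul_const ‖a t‖).const_mul ‖χ‖
      rwa [mul_zero, zero_mul, mul_zero] at h3

theorem condExp_pow_ge {a u X : T → 𝓜(ℂ, A)} {m : ℕ} {r : ℂ}
    (hpow : ∀ᵐ t ∂ν, IsPositive (u t ^ m - 1 + (m : ℂ) • (1 - u t)))
    (hu : ∀ t, 1 - u t = r • X t) (ha : HasCStarIntegral ν (fun t => star (a t) * a t) 1)
    {P Y : 𝓜(ℂ, A)} (hP : HasCStarIntegral ν (fun t => star (a t) * u t ^ m * a t) P)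
    (hY : HasCStarIntegral ν (fun t => star (a t) * X t * a t) Y) :
    ∀ᵐ s ∂(condMeasure φ e), 0 ≤ condExp φ e hC P s - 1 + m * (r * condExp φ e hC Y s) := by
  have h2 := (hP.sub ha).add ((hY.smul r).smul (m : ℂ))
  have h3 := h2.condExp_nonneg φ e hC (by
    filter_upwards [hpow] with t ht
    have h4 := ht.conj (a t)
    rw [hu] at h4
    have h5 : star (a t) * (u t ^ m - 1 + (m : ℂ) • r • X t) * a t =
        star (a t) * u t ^ m * a t - star (a t) * a t +
          (m : ℂ) • r • (star (a t) * X t * a t) := by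
      simp only [mul_add, add_mul, mul_sub, sub_mul, mul_one, mul_smul_comm, smul_mul_assoc]
    rwa [h5] at h4)
  filter_upwards [h3, condExp_add φ e hC (P - 1) ((m : ℂ) • r • Y), condExp_sub φ e hC P 1,
    condExp_one φ e hC, condExp_smul φ e hC (m : ℂ) (r • Y), condExp_smul φ e hC r Y]
    with s h3 h4 h5 h6 h7 h8
  rwa [h4, h5, h6, h7, h8] at h3

/-- The conditional expectation of `∫ a_t* X_t a_t` is strictly positive if the positive fields
`X_t` are invertible. -/
theorem condExp_pos {a X : T → 𝓜(ℂ, A)} (ha : IsUnitalColumnField ν a)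
    (hX : IsWeakStarMeasurable ν X) {R : ℝ} (hR : 0 < R) (h0 : ∀ᵐ t ∂ν, IsPositive (X t))
    (h1 : ∀ᵐ t ∂ν, IsPositive ((R : ℂ) • (1 : 𝓜(ℂ, A)) - X t))
    (hlt : ∀ᵐ t ∂ν, ‖1 - ((R⁻¹ : ℝ) : ℂ) • X t‖ < 1) {Y : 𝓜(ℂ, A)}
    (hY : HasCStarIntegral ν (fun t => star (a t) * X t * a t) Y) :
    ∀ᵐ s ∂(condMeasure φ e), 0 < condExp φ e hC Y s := by
  set u : T → 𝓜(ℂ, A) := fun t => 1 - ((R⁻¹ : ℝ) : ℂ) • X t with hu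
  have hRR : (((R⁻¹ : ℝ) : ℂ)) * (R : ℂ) = 1 := by
    rw [← Complex.ofReal_mul, inv_mul_cancel₀ hR.ne', Complex.ofReal_one]
  have h1u : ∀ t, 1 - u t = ((R⁻¹ : ℝ) : ℂ) • X t := fun t => sub_sub_cancel _ _
  have hu0 : ∀ᵐ t ∂ν, IsPositive (u t) := by
    filter_upwards [h1] with t ht
    have h2 := ht.smul (inv_nonneg.mpr hR.le)
    rwa [smul_sub, smul_smul, hRR, one_smul] at h2
  have hu1 : ∀ᵐ t ∂ν, IsPositive (1 - u t) := by
    filter_upwards [h0] with t ht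
    rw [h1u]
    exact ht.smul (inv_nonneg.mpr hR.le)
  have hpow : ∀ᵐ t ∂ν, ∀ m : ℕ, IsPositive (u t ^ m) ∧ IsPositive (1 - u t ^ m) ∧
      IsPositive (u t ^ m - 1 + (m : ℂ) • (1 - u t)) := by
    filter_upwards [hu0, hu1] with t h2 h3 m using isPositive_pow_sub h2 h3 m
  have hum : IsWeakStarMeasurable ν u := (isWeakStarMeasurable_const 1).sub (hX.smul _)
  have hP : ∀ m : ℕ, ∃ P, HasCStarIntegral ν (fun t => star (a t) * u t ^ m * a t) P := fun m =>
    exists_hasCStarIntegral_of_isPositive ha (hum.pow m) zero_le_one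
      (hpow.mono fun t ht => (ht m).1)
      (hpow.mono fun t ht => by simpa using (ht m).2.1)
  choose P hP using hP
  have hP0 : ∀ m, ∀ᵐ s ∂(condMeasure φ e), 0 ≤ condExp φ e hC (P m) s := fun m =>
    (hP m).condExp_nonneg φ e hC (hpow.mono fun t ht => (ht m).1.conj _)
  have hP1 := fun m => condExp_pow_ge φ e hC (hpow.mono fun t ht => (ht m).2.2) h1u ha.2 (hP m) hY
  have hY0 : ∀ᵐ s ∂(condMeasure φ e), 0 ≤ condExp φ e hC Y s :=
    hY.condExp_nonneg φ e hC (h0.mono fun t ht => ht.conj _)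
  set E : Set S := {s | condExp φ e hC Y s = 0} with hE
  have hEm : MeasurableSet E :=
    (Lp.stronglyMeasurable (condExp φ e hC Y)).measurable (measurableSet_singleton 0)
  have hlim := fun z hz => tendsto_integral_mul_condExp_pow φ e hC
    (hpow.mono fun t ht m => ⟨(ht m).1, (ht m).2.1⟩) hlt ha.2 hP z hz
  have hind : MemLp (E.indicator fun _ => (-1 : ℂ)) ∞ (condMeasure φ e) :=
    (memLp_const (-1)).indicator hEm
  have hEnull : ∀ᵐ s ∂(condMeasure φ e), 0 ≤ E.indicator (fun _ => (-1 : ℂ)) s := by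
    refine ae_nonneg_of_forall_integral_mul_nonneg hind fun z hz => ?_
    have hzi : Integrable (fun s => z s * E.indicator (fun _ => (-1 : ℂ)) s) (condMeasure φ e) :=
      (hind.integrable le_top).bdd_mul (c := ‖z.toBCF‖) (map_continuous z).aestronglyMeasurable
        (Eventually.of_forall fun s => z.toBCF.norm_coe_le_norm s)
    have h2 : ∀ m, -∫ s, z s * condExp φ e hC (P m) s ∂(condMeasure φ e) ≤
        ∫ s, z s * E.indicator (fun _ => (-1 : ℂ)) s ∂(condMeasure φ e) := by
      intro m
      rw [← integral_neg]
      refine integral_mono_ae (integrable_mul_condExp φ e hC (P m) z).neg hzi ?_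
      filter_upwards [hP0 m, hP1 m] with s h3 h4
      rw [← mul_neg]
      refine mul_le_mul_of_nonneg_left ?_ (hz s)
      by_cases hs : s ∈ E
      · have h5 : condExp φ e hC Y s = 0 := hs
        rw [h5, mul_zero, mul_zero, add_zero] at h4
        rw [Set.indicator_of_mem hs]
        exact neg_le_neg (sub_nonneg.mp h4)
      · rw [Set.indicator_of_notMem hs]
        exact neg_nonpos.mpr h3
    have h3 := (hlim z hz).neg
    rw [neg_zero] at h3
    exact le_of_tendsto h3 (Eventually.of_forall h2)
  filter_upwards [hY0, hEnull] with s h2 h3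
  refine lt_of_le_of_ne h2 fun h4 => ?_
  have hs : s ∈ E := h4.symm
  rw [Set.indicator_of_mem hs, Complex.nonneg_iff] at h3
  have := h3.1
  norm_num at this

variable {a x : T → 𝓜(ℂ, A)} {y : 𝓜(ℂ, A)}

theorem hasCStarIntegral_sub_const (ha : IsUnitalColumnField ν a)
    (hy : HasCStarIntegral ν (fun t => star (a t) * x t * a t) y) (l : ℂ) :
    HasCStarIntegral ν (fun t => star (a t) * (x t - l • (1 : 𝓜(ℂ, A))) * a t)
      (y - l • (1 : 𝓜(ℂ, A))) := by
  refine (hy.sub (ha.2.smul l)).congr (Eventually.of_forall fun t => ?_)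
  simp [mul_sub, sub_mul]

theorem condExp_sub_const (l : ℂ) : ∀ᵐ s ∂(condMeasure φ e),
    condExp φ e hC (y - l • (1 : 𝓜(ℂ, A))) s = condExp φ e hC y s - l := by
  filter_upwards [condExp_sub φ e hC y (l • (1 : 𝓜(ℂ, A))), condExp_smul φ e hC l 1,
    condExp_one φ e hC] with s h1 h2 h3
  rw [h1, h2, h3, mul_one]

theorem le_condExp (ha : IsUnitalColumnField ν a) (hs : ∀ t, IsSelfAdjoint (x t))
    (hy : HasCStarIntegral ν (fun t => star (a t) * x t * a t) y) {l : ℝ}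
    (hl : ∀ᵐ t ∂ν, ∀ r ∈ spectrum ℝ (x t), l ≤ r) :
    ∀ᵐ s ∂(condMeasure φ e), (l : ℂ) ≤ condExp φ e hC y s := by
  have h1 := (hasCStarIntegral_sub_const ha hy (l : ℂ)).condExp_nonneg φ e hC
    (hl.mono fun t ht => (isPositive_sub_of_spectrum (hs t) ht).conj _)
  filter_upwards [h1, condExp_sub_const φ e hC (y := y) (l : ℂ)] with s h2 h3
  rw [h3] at h2
  exact sub_nonneg.mp h2

theorem lt_condExp (ha : IsUnitalColumnField ν a) (hx : IsWeakStarMeasurable ν x)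
    (hs : ∀ t, IsSelfAdjoint (x t)) {R : ℝ} (hR : ∀ᵐ t ∂ν, ‖x t‖ ≤ R)
    (hy : HasCStarIntegral ν (fun t => star (a t) * x t * a t) y) {l : ℝ}
    (hl : ∀ t, ∀ r ∈ spectrum ℝ (x t), l < r) :
    ∀ᵐ s ∂(condMeasure φ e), (l : ℂ) < condExp φ e hC y s := by
  set R' := |R| + |l| * ‖(1 : 𝓜(ℂ, A))‖ + 1
  have hR' : ∀ᵐ t ∂ν, ‖x t - (l : ℂ) • (1 : 𝓜(ℂ, A))‖ ≤ R' := by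
    filter_upwards [hR] with t ht
    refine (norm_sub_le _ _).trans ?_
    rw [norm_smul, Complex.norm_real, Real.norm_eq_abs]
    linarith [le_abs_self R]
  have hR0 : 0 < R' := by positivity
  have hsl : ∀ t, IsSelfAdjoint (x t - (l : ℂ) • (1 : 𝓜(ℂ, A))) := fun t => by
    refine (hs t).sub ?_
    rw [IsSelfAdjoint, star_smul, star_one, Complex.star_def, Complex.conj_ofReal]
  have h1 := condExp_pos φ e hC ha (hx.sub (isWeakStarMeasurable_const _)) hR0
    (Eventually.of_forall fun t => isPositive_sub_of_spectrum (hs t) fun r hr => (hl t r hr).le)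
    (hR'.mono fun t ht => isPositive_norm_sub (hsl t) ht)
    (hR'.mono fun t ht => norm_one_sub_lt (hs t) hR0 ht (hl t))
    (hasCStarIntegral_sub_const ha hy (l : ℂ))
  filter_upwards [h1, condExp_sub_const φ e hC (y := y) (l : ℂ)] with s h2 h3
  rw [h3] at h2
  exact sub_pos.mp h2

theorem condExp_im_eq_zero (ha : IsUnitalColumnField ν a)
    (hs : ∀ t, IsSelfAdjoint (x t)) {R : ℝ} (hR : ∀ᵐ t ∂ν, ‖x t‖ ≤ R)
    (hy : HasCStarIntegral ν (fun t => star (a t) * x t * a t) y) :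
    ∀ᵐ s ∂(condMeasure φ e), (condExp φ e hC y s).im = 0 := by
  have h1 := (hasCStarIntegral_sub_const ha hy ((-R : ℝ) : ℂ)).condExp_nonneg φ e hC
    (hR.mono fun t ht => by
      have h2 := isPositive_add_norm (hs t) ht
      refine IsPositive.conj ?_ _
      simpa using h2)
  filter_upwards [h1, condExp_sub_const φ e hC (y := y) ((-R : ℝ) : ℂ)] with s h2 h3
  rw [h3, Complex.nonneg_iff, Complex.sub_im, Complex.ofReal_im, sub_zero] at h2
  exact h2.2.symm

theorem exists_le_condExp (ha : IsUnitalColumnField ν a) (hx : IsWeakStarMeasurable ν x)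
    (hs : ∀ t, IsSelfAdjoint (x t)) {R : ℝ} (hR : ∀ᵐ t ∂ν, ‖x t‖ ≤ R)
    (hy : HasCStarIntegral ν (fun t => star (a t) * x t * a t) y) {I : Set ℝ}
    (hI : ∀ t, spectrum ℝ (x t) ⊆ I) :
    ∀ᵐ s ∂(condMeasure φ e), ∃ p ∈ I, p ≤ (condExp φ e hC y s).re := by
  have hlt := fun l (hl : ∀ t, ∀ r ∈ spectrum ℝ (x t), l < r) =>
    (lt_condExp φ e hC ha hx hs hR hy hl).mono fun s h => (Complex.lt_def.mp h).1
  rcases I.eq_empty_or_nonempty with rfl | hne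
  · have h1 : ∀ k : ℕ, ∀ᵐ s ∂(condMeasure φ e), (k : ℝ) < (condExp φ e hC y s).re := fun k =>
      hlt k fun t r hr => absurd (hI t hr) (Set.notMem_empty r)
    filter_upwards [ae_all_iff.mpr h1] with s h2
    obtain ⟨k, hk⟩ := exists_nat_gt (condExp φ e hC y s).re
    exact absurd (h2 k) hk.not_gt
  by_cases hb : BddBelow I
  · by_cases hmem : sInf I ∈ I
    · filter_upwards [le_condExp φ e hC ha hs hy (l := sInf I)
        (Eventually.of_forall fun t r hr => csInf_le hb (hI t hr))] with s h
      exact ⟨sInf I, hmem, (Complex.le_def.mp h).1⟩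
    · filter_upwards [hlt (sInf I) fun t r hr => lt_of_le_of_ne (csInf_le hb (hI t hr))
        fun h => hmem (h ▸ hI t hr)] with s h
      obtain ⟨p, hp, hps⟩ := exists_lt_of_csInf_lt hne h
      exact ⟨p, hp, hps.le⟩
  · refine Eventually.of_forall fun s => ?_
    obtain ⟨p, hp, hps⟩ := not_bddBelow_iff.mp hb (condExp φ e hC y s).re
    exact ⟨p, hp, hps.le⟩

theorem condExp_mem (ha : IsUnitalColumnField ν a) (hx : IsWeakStarMeasurable ν x)
    (hs : ∀ t, IsSelfAdjoint (x t)) {R : ℝ} (hR : ∀ᵐ t ∂ν, ‖x t‖ ≤ R)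
    (hy : HasCStarIntegral ν (fun t => star (a t) * x t * a t) y) {I : Set ℝ}
    (hIc : I.OrdConnected) (hI : ∀ t, spectrum ℝ (x t) ⊆ I) :
    ∀ᵐ s ∂(condMeasure φ e), condExp φ e hC y s ∈ Complex.ofReal '' I := by
  have h1 := exists_le_condExp φ e hC ha hx hs hR hy hI
  have h2 := exists_le_condExp φ e hC ha (hx.smul (-1)) (I := -I)
    (fun t => by simpa using (hs t).neg) (R := R) (hR.mono fun t ht => by simpa using ht)
    ((hy.smul (-1)).congr (Eventually.of_forall fun t => by simp)) (fun t r hr => by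
      rw [neg_one_smul, ← spectrum.neg_eq] at hr
      exact hI t hr)
  filter_upwards [h1, h2, condExp_smul φ e hC (-1) y, condExp_im_eq_zero φ e hC ha hs hR hy]
    with s ⟨p, hp, hps⟩ ⟨q, hq, hqs⟩ h5 h6
  rw [h5, neg_one_mul, Complex.neg_re] at hqs
  refine ⟨(condExp φ e hC y s).re, hIc.out hp (Set.mem_neg.mp hq) ⟨hps, by linarith⟩, ?_⟩
  exact Complex.ext rfl (by rw [Complex.ofReal_im, h6])

end Bounds

section Jensen

variable {A : Type*} [NonUnitalCStarAlgebra A] [PartialOrder A] [StarOrderedRing A]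
  [TopologicalSpace.SeparableSpace A] {T : Type*} [MeasurableSpace T] {ν : Measure T} {n : ℕ}

theorem isSelfAdjoint_coe {x : A} (hx : IsSelfAdjoint x) : IsSelfAdjoint (x : 𝓜(ℂ, A)) :=
  hx.map (DoubleCentralizer.coeHom (𝕜 := ℂ) (A := A))

theorem commute_coe {x y : A} (h : Commute x y) : Commute (x : 𝓜(ℂ, A)) (y : 𝓜(ℂ, A)) :=
  h.map (DoubleCentralizer.coeHom (𝕜 := ℂ) (A := A))

theorem norm_coe_le (x : A) : ‖(x : 𝓜(ℂ, A))‖ ≤ ‖x‖ :=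
  NonUnitalStarAlgHom.norm_apply_le (DoubleCentralizer.coeHom (𝕜 := ℂ) (A := A)) x

/-- A continuous function of an essentially bounded field is essentially bounded if its domain
is a product of closed intervals. -/
theorem exists_norm_jointCFC_le {x : T → Fin n → 𝓜(ℂ, A)} (hx : ∀ t i, IsSelfAdjoint (x t i))
    (hc : ∀ t i j, Commute (x t i) (x t j)) {I : Fin n → Set ℝ} (hI : ∀ i, IsClosed (I i))
    (hxI : ∀ t i, spectrum ℝ (x t i) ⊆ I i) {f : (Fin n → ℝ) → ℝ}
    (hf : ContinuousOn f (Set.univ.pi I)) {R : ℝ} (hR : ∀ᵐ t ∂ν, ∀ i, ‖x t i‖ ≤ R) :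
    ∃ M : ℝ, ∀ᵐ t ∂ν, ‖jointCFC f (x t)‖ ≤ M := by
  set r := R * ‖(1 : 𝓜(ℂ, A))‖
  set K : Set (Fin n → ℝ) := Set.univ.pi fun i => I i ∩ Metric.closedBall 0 r
  have hK : IsCompact K := isCompact_univ_pi fun i =>
    (isCompact_closedBall 0 r).inter_left (hI i)
  obtain ⟨M, hM⟩ := hK.exists_bound_of_continuousOn
    (hf.mono (Set.pi_mono fun i _ => Set.inter_subset_left))
  refine ⟨max M 0, ?_⟩
  filter_upwards [hR] with t ht
  have h0 : jointCFC (fun _ => 0) (x t) = 0 := by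
    rw [jointCFC_const (hx t) (hc t), Complex.ofReal_zero, zero_smul]
  rw [← sub_zero (jointCFC f (x t)), ← h0]
  refine norm_jointCFC_sub_le (hx t) (hc t) (hf.mono (Set.pi_mono fun i _ => hxI t i))
    continuousOn_const (le_max_right _ _) fun p hp => ?_
  rw [sub_zero]
  refine (hM p fun i hi => ⟨hxI t i (hp i hi), ?_⟩).trans (le_max_left _ _)
  refine Metric.closedBall_subset_closedBall ?_ (spectrum.subset_closedBall_norm_mul (𝕜 := ℝ) _ (hp i hi))
  exact mul_le_mul_of_nonneg_right (ht i) (norm_nonneg _)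

theorem HasCStarIntegral.sum {ι : Type*} (F : Finset ι) {b : ι → T → 𝓜(ℂ, A)}
    {B : ι → 𝓜(ℂ, A)} {b₀ : T → 𝓜(ℂ, A)} {B₀ : 𝓜(ℂ, A)} (h₀ : HasCStarIntegral ν b₀ B₀)
    (h : ∀ i, HasCStarIntegral ν (b i) (B i)) :
    HasCStarIntegral ν (fun t => b₀ t + ∑ i ∈ F, b i t) (B₀ + ∑ i ∈ F, B i) := by
  classical
  induction F using Finset.induction_on with
  | empty => simpa using h₀
  | insert i F hi ih =>
    simp only [Finset.sum_insert hi]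
    rw [add_left_comm]
    exact ((h i).add ih).congr (Eventually.of_forall fun t => by simp only [add_left_comm])

variable {S : Type*} [MetricSpace S] [LocallyCompactSpace S] [MeasurableSpace S] [BorelSpace S]
variable {C : NonUnitalStarSubalgebra ℂ A} (φ : A →ₚ[ℂ] ℂ) (e : C₀(S, ℂ) ≃⋆ₐ[ℂ] C)
  (hC : (C : Set A) ⊆ centralizer φ)

/-- The Jensen inequality for an affine minorant. -/
theorem affine_condExp_le {a : T → 𝓜(ℂ, A)} (ha : IsUnitalColumnField ν a)
    {x : T → Fin n → 𝓜(ℂ, A)} (hx : ∀ t i, IsSelfAdjoint (x t i))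
    (hc : ∀ t i j, Commute (x t i) (x t j)) {f : (Fin n → ℝ) → ℝ}
    (hf : ∀ t, ContinuousOn f (spectralBox (x t))) {c : ℝ} {v : Fin n → ℝ}
    (hle : ∀ t, ∀ p ∈ spectralBox (x t), c + ∑ i, v i * p i ≤ f p) {y : Fin n → 𝓜(ℂ, A)}
    (hy : ∀ i, HasCStarIntegral ν (fun t => star (a t) * x t i * a t) (y i)) {b : 𝓜(ℂ, A)}
    (hb : HasCStarIntegral ν (fun t => star (a t) * jointCFC f (x t) * a t) b) :
    ∀ᵐ s ∂(condMeasure φ e),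
      (c : ℂ) + ∑ i, (v i : ℂ) * condExp φ e hC (y i) s ≤ condExp φ e hC b s := by
  have h1 := hb.sub (HasCStarIntegral.sum Finset.univ (ha.2.smul (c : ℂ))
    fun i => (hy i).smul (v i : ℂ))
  have h2 := h1.condExp_nonneg φ e hC (Eventually.of_forall fun t => by
    have hl : Continuous fun p : Fin n → ℝ => c + ∑ i, v i * p i := by fun_prop
    have h3 : IsPositive (jointCFC f (x t) - jointCFC (fun p => c + ∑ i, v i * p i) (x t)) :=
      exists_jointCFC_sub_eq (hx t) (hc t) (hf t) hl.continuousOn (hle t)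
    have h4 := h3.conj (a t)
    rw [jointCFC_affine (hx t) (hc t)] at h4
    have h5 : star (a t) * (jointCFC f (x t) -
        ((c : ℂ) • (1 : 𝓜(ℂ, A)) + ∑ i, (v i : ℂ) • x t i)) * a t =
        star (a t) * jointCFC f (x t) * a t - ((c : ℂ) • (star (a t) * a t) +
          ∑ i, (v i : ℂ) • (star (a t) * x t i * a t)) := by
      simp only [mul_sub, sub_mul, mul_add, add_mul, mul_smul_comm, smul_mul_assoc, mul_one,
        Finset.mul_sum, Finset.sum_mul]
    rwa [h5] at h4)
  filter_upwards [h2, condExp_sub φ e hC b ((c : ℂ) • 1 + ∑ i, (v i : ℂ) • y i),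
    condExp_add φ e hC ((c : ℂ) • 1) (∑ i, (v i : ℂ) • y i), condExp_smul φ e hC (c : ℂ) 1,
    condExp_one φ e hC, condExp_sum φ e hC Finset.univ fun i => (v i : ℂ) • y i,
    ae_all_iff.mpr fun i => condExp_smul φ e hC (v i : ℂ) (y i)] with s h3 h4 h5 h6 h7 h8 h9
  rw [h4, h5, h6, h7, h8, mul_one, sub_nonneg] at h3
  simpa only [h9] using h3

end Jensen

end CondJensen

theorem mainTheorem2
    {A : Type*} [NonUnitalCStarAlgebra A] [PartialOrder A] [StarOrderedRing A]
    [TopologicalSpace.SeparableSpace A]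
    {S : Type*} [MetricSpace S] [LocallyCompactSpace S] [MeasurableSpace S] [BorelSpace S]
    {T : Type*} [TopologicalSpace T] [T2Space T] [LocallyCompactSpace T] [MeasurableSpace T]
    [BorelSpace T]
    -- the abelian C*-subalgebra `C = C₀(S)` and the positive functional
    (C : NonUnitalStarSubalgebra ℂ A) (hCcl : IsClosed (C : Set A)) (e : C₀(S, ℂ) ≃⋆ₐ[ℂ] C)
    (φ : A →ₚ[ℂ] ℂ) (hC : (C : Set A) ⊆ CondJensen.centralizer φ)
    -- the convex function on a cube of intervals
    (n : ℕ) (I : Fin n → Set ℝ) (hI : ∀ i, (I i).OrdConnected) (f : (Fin n → ℝ) → ℝ)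
    (hfc : ContinuousOn f (Set.univ.pi I)) (hf : ConvexOn ℝ (Set.univ.pi I) f)
    -- the unital column field
    (ν : Measure T) [ν.Regular] (a : T → 𝓜(ℂ, A)) (ha : CondJensen.IsUnitalColumnField ν a)
    -- the field of abelian tuples
    (x : T → Fin n → A)
    (hxm : ∀ i, CondJensen.IsWeakStarMeasurable ν fun t => (x t i : 𝓜(ℂ, A)))
    (hxb : ∃ R : ℝ, ∀ᵐ t ∂ν, ∀ i, ‖x t i‖ ≤ R)
    (hxs : ∀ t i, IsSelfAdjoint (x t i)) (hxc : ∀ t i j, Commute (x t i) (x t j))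
    (hxI : ∀ t i, spectrum ℝ (x t i : 𝓜(ℂ, A)) ⊆ I i) :
    -- the integrals defining `y` exist
    (∀ i, ∃ b, CondJensen.HasCStarIntegral ν
      (fun t => star (a t) * (x t i : 𝓜(ℂ, A)) * a t) b) ∧
    -- the integral of `a_t* f(x_t) a_t` exists for closed intervals, and whenever `f(x_t)` is
    -- essentially bounded
    (((∀ i, IsClosed (I i)) ∨
        ∃ R : ℝ, ∀ᵐ t ∂ν, ‖CondJensen.jointCFC f fun i => (x t i : 𝓜(ℂ, A))‖ ≤ R) →
      ∃ b, CondJensen.HasCStarIntegral ν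
        (fun t => star (a t) * CondJensen.jointCFC f (fun i => (x t i : 𝓜(ℂ, A))) * a t) b) ∧
    ∀ y : Fin n → 𝓜(ℂ, A),
      (∀ i, CondJensen.HasCStarIntegral ν
        (fun t => star (a t) * (x t i : 𝓜(ℂ, A)) * a t) (y i)) →
      (∀ᵐ s ∂(CondJensen.condMeasure φ e), ∀ i,
        CondJensen.condExp φ e hC (y i) s ∈ Complex.ofReal '' I i) ∧
      ∀ b : 𝓜(ℂ, A),
        CondJensen.HasCStarIntegral ν
          (fun t => star (a t) * CondJensen.jointCFC f (fun i => (x t i : 𝓜(ℂ, A))) * a t) b →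
        ∀ᵐ s ∂(CondJensen.condMeasure φ e),
          (f (fun i => (CondJensen.condExp φ e hC (y i) s).re) : ℂ) ≤
            CondJensen.condExp φ e hC b s := by
  have hxs' : ∀ t i, IsSelfAdjoint (x t i : 𝓜(ℂ, A)) := fun t i =>
    CondJensen.isSelfAdjoint_coe (hxs t i)
  have hxc' : ∀ t i j, Commute (x t i : 𝓜(ℂ, A)) (x t j : 𝓜(ℂ, A)) := fun t i j =>
    CondJensen.commute_coe (hxc t i j)
  obtain ⟨R, hR⟩ := hxb
  have hR' : ∀ᵐ t ∂ν, ∀ i, ‖(x t i : 𝓜(ℂ, A))‖ ≤ R :=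
    hR.mono fun t ht i => (CondJensen.norm_coe_le _).trans (ht i)
  have hbox : ∀ t, CondJensen.spectralBox (fun i => (x t i : 𝓜(ℂ, A))) ⊆ Set.univ.pi I :=
    fun t => Set.pi_mono fun i _ => hxI t i
  refine ⟨fun i => CondJensen.exists_hasCStarIntegral ha (hxm i)
    (Eventually.of_forall fun t => hxs' t i) (hR'.mono fun t ht => ht i), fun h => ?_,
    fun y hy => ⟨ae_all_iff.mpr fun i => CondJensen.condExp_mem φ e hC ha (hxm i)
      (fun t => hxs' t i) (hR'.mono fun t ht => ht i) (hy i) (hI i) fun t => hxI t i,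
      fun b hb => ?_⟩⟩
  · obtain ⟨M, hM⟩ : ∃ M : ℝ, ∀ᵐ t ∂ν,
        ‖CondJensen.jointCFC f fun i => (x t i : 𝓜(ℂ, A))‖ ≤ M := by
      rcases h with h | h
      · exact CondJensen.exists_norm_jointCFC_le hxs' hxc' h hxI hfc hR'
      · exact h
    exact CondJensen.exists_hasCStarIntegral ha
      (CondJensen.isWeakStarMeasurable_jointCFC hxm hxs' hxc' hI hxI hfc)
      (Eventually.of_forall fun t =>
        CondJensen.jointCFC_isSelfAdjoint (hxs' t) (hxc' t) (hfc.mono (hbox t))) hM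
  · obtain ⟨L, hLc, hLle, hLsup⟩ := CondJensen.exists_countable_affine_minorants hfc hf
    have h1 : ∀ᵐ s ∂(CondJensen.condMeasure φ e), ∀ l ∈ L,
        (l.2 : ℂ) + ∑ i, (l.1 i : ℂ) * CondJensen.condExp φ e hC (y i) s ≤
          CondJensen.condExp φ e hC b s :=
      (ae_ball_iff hLc).mpr fun l hl => CondJensen.affine_condExp_le φ e hC ha hxs' hxc'
        (fun t => hfc.mono (hbox t)) (fun t p hp => hLle l hl p (hbox t hp)) hy hb
    have h2 : ∀ᵐ s ∂(CondJensen.condMeasure φ e), ∀ i,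
        CondJensen.condExp φ e hC (y i) s ∈ Complex.ofReal '' I i :=
      ae_all_iff.mpr fun i => CondJensen.condExp_mem φ e hC ha (hxm i)
        (fun t => hxs' t i) (hR'.mono fun t ht => ht i) (hy i) (hI i) fun t => hxI t i
    filter_upwards [h1, h2] with s h4 h5
    choose p hpI hp using h5
    simp only [← hp, Complex.ofReal_re]
    simp only [← hp] at h4
    have hval : ∀ l : (Fin n → ℝ) × ℝ, (l.2 : ℂ) + ∑ i, (l.1 i : ℂ) * (p i : ℂ) =
        ((l.2 + ∑ i, l.1 i * p i : ℝ) : ℂ) := fun l => by push_cast; rfl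
    simp only [hval] at h4
    obtain ⟨l₀, hl₀⟩ : L.Nonempty := by
      by_contra! hL
      have h6 := hLsup p (fun i _ => hpI i) (f p - 1) (by simp [hL])
      linarith
    have h6 := (Complex.le_def.mp (h4 l₀ hl₀)).2
    refine Complex.le_def.mpr ⟨?_, h6⟩
    exact hLsup p (fun i _ => hpI i) _ fun l hl => (Complex.le_def.mp (h4 l hl)).1
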